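/- **Theorem (Presentation of $\bigoplus_s\Omega_{s,2}(H)$).** Let $\Bbbk$ be a field of characteristic $0$ and $H$ a $\Bbbk$-vector space (for instance $H=H_1(\Sigma_{g,1};\Bbbk)$). *The space $\Omega_{s,r}(H)$.* A hairy graph is a union of $k$ unitrivalent trees, with a cyclic order at each trivalent vertex and the trees numbered $1,\dots,k$, some of whose univalent vertices are joined in pairs by directed external edges, while each remaining univalent vertex (a hair) is labelled by an element of $H$. Let $C_{k,r,s}$ be the space spanned by the connected hairy graphs with $k$ trees, first Betti number $r$ and $s$ hairs, modulo IHX and AS within the trees, multilinearity in the hair labels, the rule that reversing an external edge changes the sign, and the rule that renumbering the trees multiplies by the sign of the permutation. For a graph with two trees, $\partial$ is the sum over the external edges joining the two trees of the graph obtained by contracting this edge, with sign $+$ if the edge is directed from tree $1$ to tree $2$ and $-$ otherwise. Let $S_{2,r,s}\subset C_{2,r,s}$ be spanned by the graphs one of whose trees is a tripod that either is joined to the other tree by three of its legs, or is joined to it by two of its legs and has a hair as third leg, or has two legs joined to each other by an external edge and the third leg joined to the other tree. Then $\Omega_{s,r}(H)=C_{1,r,s}/\partial S_{2,r,s}$.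 *The algebraic side.* Let $T(H)$ be the tensor algebra, $T^+(H)$ its positive degree part, $\rho\colon T(H)\to T(H)$, $\rho(v_1\cdots v_m)=\overline{v_1\cdots v_m}=(-1)^m v_m\cdots v_1$, and let $\Delta(v_K)=\sum_{K=I\sqcup J}v_I\otimes v_J$, the algebra homomorphism $T(H)\to T(H)\otimes T(H)$ with $\Delta(v)=v\otimes 1+1\otimes v$ for $v\in H$. Let $\mathbb Z_2\times\mathbb Z_2$ act on $T^+(H)\otimes T^+(H)$ through the two commuting involutions $v_I\otimes w_J\mapsto \overline{v_I}\otimes\overline{w_J}$ and $v_I\otimes w_J\mapsto\overline{w_J}\otimes\overline{v_I}$ (so that the group is also generated by $\rho\otimes\rho$ and the swap of the two factors). Let $\mathrm{Rel}$ be the subspace of the coinvariants spanned by the classes of the following elements, for $v_I,w_J\in T^+(H)$ and $v_0\in H$, where terms lying in $1\otimes T(H)$ or $T(H)\otimes 1$ are read as zero: 1. $-(v_0\otimes1+1\otimes v_0)(v_I\otimes w_J)+(v_I\otimes w_J)(v_0\otimes1+1\otimes v_0)$; 2. $(\rho\otimes1)\bigl(\Delta(v_I)(1\otimes w_J)\bigr)+v_I\otimes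 w_J+(1\otimes\rho)\bigl((v_I\otimes1)\Delta(w_J)\bigr)$. Then there is an isomorphism of vector spaces $$\bigoplus_{s\ge0}\Omega_{s,2}(H)\;\cong\;[T^+(H)\otimes T^+(H)]_{\mathbb Z_2\times\mathbb Z_2}/\mathrm{Rel}$$ that sends the class $[v_1\cdots v_m\,|\,w_1\cdots w_n]\in\Omega_{m+n,2}(H)$ of the theta graph to the class of $v_1\cdots v_m\otimes w_1\cdots w_n$ (which is zero if $m=0$ or $n=0$), for all $v_1,\dots,v_m,w_1,\dots,w_n\in H$. Here the theta graph has a single tree, formed by two rooted planar binary trees $A$ and $B$ whose roots are joined to one edge, and two external edges $e,f$, with tails $e^-,f^-$ in $A$ and heads $e^+,f^+$ in $B$: $$A=\bigl[[v_1,[v_2,\dots,[v_m,e^-]\cdots]],\,f^-\bigr],\qquad B=\bigl[e^+,\,[w_1,[w_2,\dots,[w_n,f^+]\cdots]]\bigr],$$ where $[X,Y]$ is the rooted tree with branches $X,Y$ and cyclic order (root, $X$, $Y$) at its first vertex. -/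

import Mathlib

open scoped TensorProduct DirectSum

namespace HairyGraph

universe u v

/-! ### Hairy graphs -/

/-- Decorations of the univalent vertices of the trees of a hairy graph with external edges
numbered by `Fin n`: either a hair labelled by a vector `h : H`, or one of the two ends of an
external edge. Every external edge `e` is directed: `edge e false` is its tail (initial end) and
`edge e true` its head (terminal end). -/
inductive Leaf (H : Type v) (n : ℕ) : Type v
  | hair (h : H) : Leaf H n
  | edge (e : Fin n) (b : Bool) : Leaf H n

/-- A unitrivalent tree with a cyclic order at each trivalent vertex, univalent vertices decorated
by `X`, and one marked edge: cutting the marked edge gives two rooted planar binary trees.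
At an internal vertex `A * B` of a rooted tree the cyclic order is (root edge, `A`, `B`). The tree
itself, without the mark, is obtained by the relations `mark_symm` and `mark_move` below. -/
abbrev Tree (X : Type v) : Type v := FreeMagma X × FreeMagma X

/-- The multiset of leaves of a rooted planar binary tree. -/
def rootedLeaves {X : Type v} : FreeMagma X → Multiset X
  | .of x => {x}
  | .mul A B => rootedLeaves A + rootedLeaves B

/-- The multiset of decorations of the univalent vertices of a tree. -/
def Tree.leaves {X : Type v} (t : Tree X) : Multiset X := rootedLeaves t.1 + rootedLeaves t.2

/-- Change the decorations of the univalent vertices. -/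
def Tree.relabel {X Y : Type v} (f : X → Y) (t : Tree X) : Tree Y :=
  (FreeMagma.map f t.1, FreeMagma.map f t.2)

/-- The univalent vertices with decorations `m` form a hairy graph with `n` external edges and `s`
hairs: each of the two ends of each external edge occurs exactly once, and the remaining univalent
vertices are `s` labelled hairs. -/
def IsHairy {H : Type v} {n : ℕ} (s : ℕ) (m : Multiset (Leaf H n)) : Prop :=
  ∃ hs : Multiset H, hs.card = s ∧
    m = hs.map Leaf.hair +
      (Finset.univ : Finset (Fin n × Bool)).val.map (fun p => Leaf.edge p.1 p.2)

/-- Generators of `C_{1,r,s}`: hairy graphs with a single tree, `r` external edges (so that the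
first Betti number is `r`) and `s` hairs. -/
def Graph (H : Type v) (r s : ℕ) : Type v :=
  {t : Tree (Leaf H r) // IsHairy s t.leaves}

section Chains

variable (k : Type u) [Field k] {H : Type v} [AddCommGroup H] [Module k H]

open Classical in
/-- The generator given by a tree, and zero if the tree is not a hairy graph with `r` external
edges and `s` hairs. -/
noncomputable def gen (r s : ℕ) (t : Tree (Leaf H r)) : Graph H r s →₀ k :=
  if h : IsHairy s t.leaves then Finsupp.single ⟨t, h⟩ 1 else 0

/-- Reverse the direction of the external edge `e`. -/
def Leaf.reverse {n : ℕ} (e : Fin n) : Leaf H n → Leaf H n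
  | .hair h => .hair h
  | .edge f b => .edge f (if f = e then !b else b)

/-- Renumber the external edges. -/
def Leaf.renumber {n : ℕ} (π : Equiv.Perm (Fin n)) : Leaf H n → Leaf H n
  | .hair h => .hair h
  | .edge f b => .edge (π f) b

/-- The relations of `C_{1,r,s}`. As the marked edge can be moved anywhere in the tree, it is
enough to write the local relations next to the marked edge. -/
inductive ChainRel (r s : ℕ) : (Graph H r s →₀ k) → Prop
  /-- the marked edge has no direction -/
  | mark_symm (A B : FreeMagma (Leaf H r)) :
      ChainRel r s (gen k r s (A, B) - gen k r s (B, A))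
  /-- the marked edge can be moved across a trivalent vertex -/
  | mark_move (A B C : FreeMagma (Leaf H r)) :
      ChainRel r s (gen k r s (A * B, C) - gen k r s (A, B * C))
  /-- the external edges are not numbered -/
  | renumber (π : Equiv.Perm (Fin r)) (t : Tree (Leaf H r)) :
      ChainRel r s (gen k r s (t.relabel (Leaf.renumber π)) - gen k r s t)
  /-- switching the direction of an external edge gives a minus sign -/
  | reverse (e : Fin r) (t : Tree (Leaf H r)) :
      ChainRel r s (gen k r s (t.relabel (Leaf.reverse e)) + gen k r s t)
  /-- AS -/
  | antisymm (A B C : FreeMagma (Leaf H r)) :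
      ChainRel r s (gen k r s (A * B, C) + gen k r s (B * A, C))
  /-- IHX -/
  | ihx (A B C D : FreeMagma (Leaf H r)) :
      ChainRel r s (gen k r s ((A * B) * C, D) + gen k r s ((B * C) * A, D)
        + gen k r s ((C * A) * B, D))
  /-- multilinearity in the labels of the hairs -/
  | hair_add (h h' : H) (B : FreeMagma (Leaf H r)) :
      ChainRel r s (gen k r s (.of (.hair (h + h')), B) - gen k r s (.of (.hair h), B)
        - gen k r s (.of (.hair h'), B))
  | hair_smul (c : k) (h : H) (B : FreeMagma (Leaf H r)) :
      ChainRel r s (gen k r s (.of (.hair (c • h)), B) - c • gen k r s (.of (.hair h), B))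

variable (H) in
/-- `C_{1,r,s}`: the space of connected hairy graphs with one tree, first Betti number `r` and `s`
hairs. -/
abbrev Chains (r s : ℕ) : Type (max u v) :=
  (Graph H r s →₀ k) ⧸ Submodule.span k {x | ChainRel k r s x}

/-- The class of a hairy graph in `C_{1,r,s}`. -/
noncomputable def chain (r s : ℕ) (t : Tree (Leaf H r)) : Chains k H r s :=
  Submodule.Quotient.mk (gen k r s t)

end Chains

/-! ### The boundary of a hairy graph with two trees -/

open Classical in
/-- `cutAux x A C` looks in `A` for the univalent vertex `x` of the tree `(A, C)` and returns the
same tree rooted at `x`. -/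
noncomputable def cutAux {X : Type v} (x : X) : FreeMagma X → FreeMagma X → Option (FreeMagma X)
  | .of y, C => if y = x then some C else none
  | .mul A B, C => cutAux x A (B * C) <|> cutAux x B (C * A)

/-- The tree `t` rooted at its univalent vertex `x`; `none` if there is no such vertex. -/
noncomputable def Tree.cut {X : Type v} (x : X) (t : Tree X) : Option (FreeMagma X) :=
  cutAux x t.1 t.2 <|> cutAux x t.2 t.1

/-- In a rooted tree without ends of the external edge `e`, renumber the other external edges
monotonically by `Fin n`. -/
def dropEdge {H : Type v} {n : ℕ} (e : Fin (n + 1)) :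
    FreeMagma (Leaf H (n + 1)) → Option (FreeMagma (Leaf H n))
  | .of (.hair h) => some (.of (.hair h))
  | .of (.edge f b) => (finSuccEquiv' e f).map fun g => .of (.edge g b)
  | .mul A B => Option.map₂ (· * ·) (dropEdge e A) (dropEdge e B)

/-- Join two trees along the external edge `e`, whose end `b` lies on `t₁` and whose other end lies
on `t₂`; `none` if this is not where the ends of `e` are. -/
noncomputable def join {H : Type v} {n : ℕ} (e : Fin (n + 1)) (b : Bool)
    (t₁ t₂ : Tree (Leaf H (n + 1))) : Option (Tree (Leaf H n)) :=
  Option.map₂ Prod.mk ((t₁.cut (.edge e b)).bind (dropEdge e))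
    ((t₂.cut (.edge e !b)).bind (dropEdge e))

section Omega

variable (k : Type u) [Field k] {H : Type v} [AddCommGroup H] [Module k H]

/-- The boundary of the hairy graph with trees `t₁` (numbered 1) and `t₂` (numbered 2), `r + 1`
external edges and `s` hairs: the sum over the external edges that join the two trees of the hairy
graph in which this edge is contracted, with sign `+` if it is directed from `t₁` to `t₂` and `-`
if it is directed from `t₂` to `t₁`. -/
noncomputable def boundary (r s : ℕ) (t₁ t₂ : Tree (Leaf H (r + 1))) : Chains k H r s :=
  ∑ e : Fin (r + 1),
    ((join e false t₁ t₂).elim 0 (chain k r s) - (join e true t₁ t₂).elim 0 (chain k r s))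

/-- The tripod with univalent vertices `x`, `y`, `z` in this cyclic order. -/
def tripod {X : Type v} (x y z : X) : Tree X := (.of x, .of y * .of z)

/-- The tripods that occur in generators of `S₂`. In a hairy graph with two trees, one of them such
a tripod, the ends of external edges that do not pair on the tripod are joined to the other
tree. Up to rotation the tripod
* is joined to the other tree by all three legs, or
* is joined to it by two legs and has a hair, or
* has two legs joined to each other and is joined to the other tree by the third. -/
inductive IsS₂Tripod {H : Type v} {n : ℕ} : Tree (Leaf H n) → Prop
  | three (e f g : Fin n) (a b c : Bool) (hef : e ≠ f) (heg : e ≠ g) (hfg : f ≠ g) :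
      IsS₂Tripod (tripod (.edge e a) (.edge f b) (.edge g c))
  | two (e f : Fin n) (a b : Bool) (h : H) (hef : e ≠ f) :
      IsS₂Tripod (tripod (.edge e a) (.edge f b) (.hair h))
  | loop (e f : Fin n) (a b : Bool) (hef : e ≠ f) :
      IsS₂Tripod (tripod (.edge e a) (.edge f b) (.edge f !b))

variable (H) in
/-- `∂ S_{2,r,s}`. A connected hairy graph with two trees has first Betti number `r` when it has
`r + 1` external edges. Exchanging the numbers of the two trees changes the sign of the boundary,
so the tripod may be numbered 1. -/
noncomputable def boundaryS₂ (r s : ℕ) : Submodule k (Chains k H r s) :=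
  Submodule.span k {x | ∃ t₁ t₂ : Tree (Leaf H (r + 1)),
    IsHairy s (t₁.leaves + t₂.leaves) ∧ IsS₂Tripod t₁ ∧ x = boundary k r s t₁ t₂}

variable (H) in
/-- `Ω_{s,r}(H) = C_{1,r,s} / ∂ S_{2,r,s}`. -/
def Omega (s r : ℕ) : Type (max u v) := Chains k H r s ⧸ boundaryS₂ k H r s

noncomputable instance (s r : ℕ) : AddCommGroup (Omega k H s r) :=
  inferInstanceAs (AddCommGroup (Chains k H r s ⧸ boundaryS₂ k H r s))

noncomputable instance (s r : ℕ) : Module k (Omega k H s r) :=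
  inferInstanceAs (Module k (Chains k H r s ⧸ boundaryS₂ k H r s))

/-- The projection `C_{1,r,s} → Ω_{s,r}(H)`. -/
noncomputable def toOmega (s r : ℕ) : Chains k H r s →ₗ[k] Omega k H s r :=
  (boundaryS₂ k H r s).mkQ

/-- The rooted tree `v₁ * (v₂ * (⋯ * (v_m * x)))`: hairs `v₁, …, v_m` along the edge to `x`. -/
def comb {n : ℕ} (v : List H) (x : Leaf H n) : FreeMagma (Leaf H n) :=
  v.foldr (fun h A => .of (.hair h) * A) (.of x)

/-- The theta graph with hairs `v₁, …, v_m` along the first external edge, near its tail, and hairs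
`w₁, …, w_n` along the second one, near its head; both external edges are directed from the first
trivalent vertex of the core to the second one. -/
def thetaTree (v w : List H) : Tree (Leaf H 2) :=
  (comb v (.edge 0 false) * .of (.edge 1 false), .of (.edge 0 true) * comb w (.edge 1 true))

/-- The class `[v₁ ⋯ v_m | w₁ ⋯ w_n]` of the theta graph in `Ω_{m+n,2}(H)`. -/
noncomputable def theta (v w : List H) : Omega k H (v.length + w.length) 2 :=
  toOmega k (v.length + w.length) 2 (chain k 2 (v.length + w.length) (thetaTree v w))

end Omega

/-! ### The algebraic side -/

section Presentation

variable (k : Type u) [Field k] (H : Type v) [AddCommGroup H] [Module k H]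

/-- The positive degree part of the tensor algebra as a subspace: the kernel of the projection to
the degree zero part. -/
noncomputable def augmentation : Submodule k (TensorAlgebra k H) :=
  LinearMap.ker (TensorAlgebra.algebraMapInv : TensorAlgebra k H →ₐ[k] k).toLinearMap

/-- The positive degree part `T⁺(H)` of the tensor algebra. -/
def TPlus : Type (max u v) := augmentation k H

noncomputable instance : AddCommGroup (TPlus k H) :=
  inferInstanceAs (AddCommGroup (augmentation k H))

noncomputable instance : Module k (TPlus k H) :=
  inferInstanceAs (Module k (augmentation k H))

/-- The inclusion `T⁺(H) → T(H)`. -/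
noncomputable def inclPlus : TPlus k H →ₗ[k] TensorAlgebra k H :=
  (augmentation k H).subtype

/-- The projection `T(H) → T⁺(H)` that kills the unit. -/
noncomputable def projPlus : TensorAlgebra k H →ₗ[k] TPlus k H :=
  LinearMap.codRestrict (augmentation k H)
    (LinearMap.id - (Algebra.linearMap k (TensorAlgebra k H)) ∘ₗ
      (TensorAlgebra.algebraMapInv : TensorAlgebra k H →ₐ[k] k).toLinearMap)
    (fun x => by simp [augmentation])

/-- The projection `T(H) ⊗ T(H) → T⁺(H) ⊗ T⁺(H)` that kills `1 ⊗ T(H)` and `T(H) ⊗ 1`. -/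
noncomputable def projPlus₂ :
    TensorAlgebra k H ⊗[k] TensorAlgebra k H →ₗ[k] TPlus k H ⊗[k] TPlus k H :=
  TensorProduct.map (projPlus k H) (projPlus k H)

/-- The involution `ρ(v₁ ⋯ v_m) = (-1)^m v_m ⋯ v₁`: the algebra anti-homomorphism with
`ρ(v) = -v`. -/
noncomputable def rho : TensorAlgebra k H →ₗ[k] TensorAlgebra k H :=
  (MulOpposite.opLinearEquiv k).symm.toLinearMap ∘ₗ
    (TensorAlgebra.lift k
      (-((MulOpposite.opLinearEquiv k).toLinearMap ∘ₗ TensorAlgebra.ι k (M := H)))).toLinearMap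

/-- The coproduct `Δ(v_K) = ∑_{K = I ⊔ J} v_I ⊗ v_J`: the algebra homomorphism with
`Δ(v) = v ⊗ 1 + 1 ⊗ v`. -/
noncomputable def Delta :
    TensorAlgebra k H →ₐ[k] TensorAlgebra k H ⊗[k] TensorAlgebra k H :=
  TensorAlgebra.lift k
    ((TensorProduct.mk k _ _).flip 1 ∘ₗ TensorAlgebra.ι k (M := H) +
      TensorProduct.mk k _ _ 1 ∘ₗ TensorAlgebra.ι k (M := H))

/-- The involution `v ⊗ w ↦ ρ(v) ⊗ ρ(w)` of `T⁺(H) ⊗ T⁺(H)`. -/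
noncomputable def actRho : TPlus k H ⊗[k] TPlus k H →ₗ[k] TPlus k H ⊗[k] TPlus k H :=
  TensorProduct.map (projPlus k H ∘ₗ rho k H ∘ₗ inclPlus k H)
    (projPlus k H ∘ₗ rho k H ∘ₗ inclPlus k H)

/-- The involution `v ⊗ w ↦ ρ(w) ⊗ ρ(v)` of `T⁺(H) ⊗ T⁺(H)`. -/
noncomputable def actSwap : TPlus k H ⊗[k] TPlus k H →ₗ[k] TPlus k H ⊗[k] TPlus k H :=
  actRho k H ∘ₗ (TensorProduct.comm k (TPlus k H) (TPlus k H)).toLinearMap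

/-- The coinvariants of `T⁺(H) ⊗ T⁺(H)` under the group `ℤ/2 × ℤ/2` generated by the two commuting
involutions `actRho` and `actSwap`. -/
abbrev Coinv : Type (max u v) :=
  (TPlus k H ⊗[k] TPlus k H) ⧸ Submodule.span k
    ({x | ∃ y : TPlus k H ⊗[k] TPlus k H, x = y - actRho k H y} ∪
      {x | ∃ y : TPlus k H ⊗[k] TPlus k H, x = y - actSwap k H y})

/-- The first family of relators: the commutator of `v ⊗ w` with `v₀ ⊗ 1 + 1 ⊗ v₀`. -/
noncomputable def commRelator (v₀ : H) (v w : TensorAlgebra k H) :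
    TensorAlgebra k H ⊗[k] TensorAlgebra k H :=
  -((TensorAlgebra.ι k v₀ ⊗ₜ[k] 1 + 1 ⊗ₜ[k] TensorAlgebra.ι k v₀) * (v ⊗ₜ[k] w))
    + (v ⊗ₜ[k] w) * (TensorAlgebra.ι k v₀ ⊗ₜ[k] 1 + 1 ⊗ₜ[k] TensorAlgebra.ι k v₀)

/-- The second family of relators:
`(ρ ⊗ 1)(Δ(v)(1 ⊗ w)) + v ⊗ w + (1 ⊗ ρ)((v ⊗ 1)Δ(w))`. -/
noncomputable def triRelator (v w : TensorAlgebra k H) :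
    TensorAlgebra k H ⊗[k] TensorAlgebra k H :=
  (rho k H).rTensor (TensorAlgebra k H) (Delta k H v * (1 ⊗ₜ[k] w)) + v ⊗ₜ[k] w
    + (rho k H).lTensor (TensorAlgebra k H) ((v ⊗ₜ[k] 1) * Delta k H w)

/-- The subspace of relations in the coinvariants. The terms of a relator in `1 ⊗ T(H)` or
`T(H) ⊗ 1` are read as zero. -/
noncomputable def relations : Submodule k (Coinv k H) :=
  Submodule.span k
    ({x | ∃ (v₀ : H) (v w : TPlus k H),
        x = Submodule.Quotient.mk
          (projPlus₂ k H (commRelator k H v₀ (inclPlus k H v) (inclPlus k H w)))} ∪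
      {x | ∃ v w : TPlus k H,
        x = Submodule.Quotient.mk
          (projPlus₂ k H (triRelator k H (inclPlus k H v) (inclPlus k H w)))})

/-- `[T⁺(H) ⊗ T⁺(H)]_{ℤ/2 × ℤ/2} / Rel`. -/
abbrev Presentation : Type (max u v) := Coinv k H ⧸ relations k H

variable {H}

/-- The class of `v₁ ⋯ v_m ⊗ w₁ ⋯ w_n`; it is zero if one of the two words is empty. -/
noncomputable def wordClass (v w : List H) : Presentation k H :=
  Submodule.Quotient.mk (Submodule.Quotient.mk (projPlus₂ k H
    ((v.map (TensorAlgebra.ι k)).prod ⊗ₜ[k] (w.map (TensorAlgebra.ι k)).prod)))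

end Presentation

end HairyGraph

/-! A function of trees that ignores the mark and satisfies AS and IHX is the same thing as an
invariant symmetric form on a Lie algebra generated by the leaves: divide the linear combinations of
rooted trees by the radical of the form (`TreeForm.toFun_eq`). Graph manipulations then become Lie
algebra. Hairs along an edge act through `T(H)` by the adjoint action; the Leibniz rule for this
action is `Delta` (`act_lie`) and the adjoint of an element is its image under `rho` (`act_form`),
which is how the coproduct and the involution enter the relations.

Consider a form on trees with two external edges that is closed, that is, vanishes on the boundaries
of tripod graphs. Leibniz and IHX reduce a tree with four edge ends to H-shaped trees with combs of
hairs in two of the three groupings (`TreeForm.mem_of_four`); one is the theta graph, the other is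
minus a theta graph after an edge is reversed. Tripods with a hair let hairs slide along external
edges (`Closed.theta_slide`), so the value of a theta graph depends on two words only. Tripods with
a loop kill the theta graphs that have a bare edge (`Closed.theta_one`), the symmetries of the theta
graph give the coinvariants, invariance across the middle edge gives the commutator relators, and
tripods with three joined legs give the second family (`form_three`). Hence a closed form factors
over a linear map `Ψ` from the presentation whose range contains all values of the form on hairy
graphs. For the universal form `omegaForm`, `Ψ` is onto.

For injectivity one needs a closed form with values in the presentation and the expected values on
theta graphs. `wordForm` roots a tree at the tail of edge 0, lets the three other ends act as
creation operators on words, and keeps the words whose letters come in one fixed order: the theta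
graph gets its word class, the crossed tree gets 0 (`wordForm_theta`, `wordForm_crossed`). Signed
averaging over renumberings and reversals gives `presForm`, with unchanged theta values thanks to
the coinvariants. It is closed: for a fixed tripod the boundary is again a tree form in the other
tree, so combs suffice, and there the relators appear (`presForm_boundary`). The induced map
`toPresentation` satisfies `toPresentation ∘ Ψ = id`, and as `Ψ` is onto, both are isomorphisms.
Characteristic 0 enters through the invertibility of 2. -/

namespace HairyGraph

universe u v w

/-! ### Tree forms and the Lie algebras they define -/

/-- A function of trees with a marked edge that does not depend on the mark and satisfies AS and
IHX. -/
structure TreeForm (X : Type v) (W : Type w) [AddCommGroup W] where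
  /-- The value on the tree obtained by joining two rooted trees. -/
  toFun : FreeMagma X → FreeMagma X → W
  symm : ∀ A B, toFun A B = toFun B A
  move : ∀ A B C, toFun (A * B) C = toFun A (B * C)
  antisymm : ∀ A B C, toFun (A * B) C + toFun (B * A) C = 0
  ihx : ∀ A B C D, toFun ((A * B) * C) D + toFun ((B * C) * A) D + toFun ((C * A) * B) D = 0

namespace TreeForm

section Alg

variable (k : Type u) [Field k] {X : Type v} {W : Type w} [AddCommGroup W] [Module k W]

/-- The product of linear combinations of rooted trees. -/
noncomputable def preBracket (k : Type u) [Field k] (X : Type v) :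
    (FreeMagma X →₀ k) →ₗ[k] (FreeMagma X →₀ k) →ₗ[k] (FreeMagma X →₀ k) :=
  Finsupp.linearCombination k fun A =>
    Finsupp.linearCombination k fun B => Finsupp.single (A * B) 1

variable (φ : TreeForm X W)

/-- The bilinear extension of a tree form. -/
noncomputable def preForm : (FreeMagma X →₀ k) →ₗ[k] (FreeMagma X →₀ k) →ₗ[k] W :=
  Finsupp.linearCombination k fun A => Finsupp.linearCombination k fun B => φ.toFun A B

@[simp] theorem preBracket_single (A B : FreeMagma X) :
    preBracket k X (Finsupp.single A 1) (Finsupp.single B 1) = Finsupp.single (A * B) 1 := by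
  simp [preBracket]

@[simp] theorem preForm_single (A B : FreeMagma X) :
    preForm k φ (Finsupp.single A 1) (Finsupp.single B 1) = φ.toFun A B := by
  simp [preForm]

theorem preForm_symm (a b : FreeMagma X →₀ k) : preForm k φ a b = preForm k φ b a := by
  have : preForm k φ = (preForm k φ).flip := by
    ext A B
    simpa using φ.symm A B
  exact LinearMap.congr_fun₂ this a b

theorem preForm_bracket (a b c : FreeMagma X →₀ k) :
    preForm k φ (preBracket k X a b) c = preForm k φ a (preBracket k X b c) := by
  have : (preBracket k X).compr₂ (preForm k φ) =
      (LinearMap.lcomp k _ (preBracket k X) ∘ₗ LinearMap.llcomp k _ _ _ ∘ₗ preForm k φ) := by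
    ext A B C
    simpa using φ.move A B C
  exact LinearMap.congr_fun (LinearMap.congr_fun₂ this a b) c

theorem preForm_antisymm (a b c : FreeMagma X →₀ k) :
    preForm k φ (preBracket k X a b) c + preForm k φ (preBracket k X b a) c = 0 := by
  have : (preBracket k X).compr₂ (preForm k φ) +
      (preBracket k X).flip.compr₂ (preForm k φ) = 0 := by
    ext A B C
    simpa using φ.antisymm A B C
  exact LinearMap.congr_fun (LinearMap.congr_fun₂ this a b) c

theorem preForm_jacobi (a b c d : FreeMagma X →₀ k) :
    preForm k φ (preBracket k X (preBracket k X a b) c) d +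
      preForm k φ (preBracket k X (preBracket k X b c) a) d +
      preForm k φ (preBracket k X (preBracket k X c a) b) d = 0 := by
  induction a using Finsupp.induction_linear with
  | zero => simp
  | add f g hf hg =>
    simp only [map_add, LinearMap.add_apply]
    linear_combination (norm := abel) hf + hg
  | single A s =>
  induction b using Finsupp.induction_linear with
  | zero => simp
  | add f g hf hg =>
    simp only [map_add, LinearMap.add_apply]
    linear_combination (norm := abel) hf + hg
  | single B t =>
  induction c using Finsupp.induction_linear with
  | zero => simp
  | add f g hf hg =>
    simp only [map_add, LinearMap.add_apply]
    linear_combination (norm := abel) hf + hg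
  | single C u =>
  induction d using Finsupp.induction_linear with
  | zero => simp
  | add f g hf hg =>
    simp only [map_add]
    linear_combination (norm := abel) hf + hg
  | single D v =>
    have h := congrArg (fun w => (s * t * u * v) • w) (φ.ihx A B C D)
    simp only [smul_add, smul_zero] at h
    simp only [preBracket, preForm, Finsupp.linearCombination_single, LinearMap.smul_apply,
      map_smul,
      one_smul, smul_smul]
    rw [← h]
    congr 3 <;> ring

/-- The radical of a tree form. -/
noncomputable def radical : Submodule k (FreeMagma X →₀ k) := LinearMap.ker (preForm k φ)

theorem mem_radical {a : FreeMagma X →₀ k} :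
    a ∈ radical k φ ↔ ∀ c, preForm k φ a c = 0 := by
  simp only [radical, LinearMap.mem_ker, LinearMap.ext_iff, LinearMap.zero_apply]

/-- The Lie algebra of rooted trees modulo the radical of a tree form. -/
def Alg : Type (max u v) := (FreeMagma X →₀ k) ⧸ radical k φ

noncomputable instance : AddCommGroup (Alg k φ) :=
  inferInstanceAs (AddCommGroup ((FreeMagma X →₀ k) ⧸ radical k φ))

noncomputable instance : Module k (Alg k φ) :=
  inferInstanceAs (Module k ((FreeMagma X →₀ k) ⧸ radical k φ))

/-- The class of a linear combination of rooted trees. -/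
noncomputable def cls : (FreeMagma X →₀ k) →ₗ[k] Alg k φ := (radical k φ).mkQ

theorem cls_surjective : Function.Surjective (cls k φ) := Submodule.mkQ_surjective _

theorem cls_eq_zero {a : FreeMagma X →₀ k} : cls k φ a = 0 ↔ a ∈ radical k φ :=
  Submodule.Quotient.mk_eq_zero _

/-- The bracket of the Lie algebra of a tree form. -/
noncomputable def bracketMap : Alg k φ →ₗ[k] Alg k φ →ₗ[k] Alg k φ :=
  (radical k φ).liftQ
    (((radical k φ).liftQ ((preBracket k X).compr₂ (cls k φ)).flip (by
      intro b hb
      refine LinearMap.mem_ker.2 ?_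
      refine LinearMap.ext fun a => ?_
      rw [LinearMap.zero_apply, LinearMap.flip_apply, LinearMap.compr₂_apply, cls_eq_zero]
      rw [mem_radical] at hb ⊢
      intro c
      -- The radical is an ideal: invariance moves the bracket off the radical element, and
      -- antisymmetry reduces the second argument to the first.
      have := preForm_antisymm k φ a b c
      rwa [preForm_bracket k φ b, hb, add_zero] at this)).flip)
    (by
      intro a ha
      refine LinearMap.mem_ker.2 ?_
      refine LinearMap.ext fun b => ?_
      obtain ⟨b, rfl⟩ := cls_surjective k φ b
      change cls k φ (preBracket k X a b) = 0
      rw [cls_eq_zero]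
      rw [mem_radical] at ha ⊢
      intro c
      rw [preForm_bracket, ha])

theorem bracketMap_cls (a b : FreeMagma X →₀ k) :
    bracketMap k φ (cls k φ a) (cls k φ b) = cls k φ (preBracket k X a b) := rfl

/-- The invariant form of the Lie algebra of a tree form. -/
noncomputable def form : Alg k φ →ₗ[k] Alg k φ →ₗ[k] W :=
  (radical k φ).liftQ
    (((radical k φ).liftQ (preForm k φ).flip (by
      intro b hb
      refine LinearMap.mem_ker.2 ?_
      refine LinearMap.ext fun a => ?_
      rw [mem_radical] at hb
      rw [LinearMap.zero_apply, LinearMap.flip_apply, preForm_symm, hb])).flip)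
    (by
      intro a ha
      refine LinearMap.mem_ker.2 ?_
      refine LinearMap.ext fun b => ?_
      obtain ⟨b, rfl⟩ := cls_surjective k φ b
      exact (mem_radical k φ).1 ha b)

theorem form_cls (a b : FreeMagma X →₀ k) :
    form k φ (cls k φ a) (cls k φ b) = preForm k φ a b := rfl

theorem form_symm (a b : Alg k φ) : form k φ a b = form k φ b a := by
  obtain ⟨a, rfl⟩ := cls_surjective k φ a
  obtain ⟨b, rfl⟩ := cls_surjective k φ b
  exact preForm_symm k φ a b

theorem form_eq_zero {a : Alg k φ} (h : ∀ c, form k φ a c = 0) : a = 0 := by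
  obtain ⟨a, rfl⟩ := cls_surjective k φ a
  exact (cls_eq_zero k φ).2 ((mem_radical k φ).2 fun c => h (cls k φ c))

variable [CharZero k]

/-- Each axiom holds because the defect pairs to zero with every tree, hence lies in the radical.
Passing from antisymmetry to `⁅a, a⁆ = 0` divides by 2. -/
noncomputable instance : LieRing (Alg k φ) where
  bracket a b := bracketMap k φ a b
  add_lie a b c := by simp
  lie_add a b c := by simp
  lie_self a := by
    obtain ⟨a, rfl⟩ := cls_surjective k φ a
    refine (cls_eq_zero k φ).2 ((mem_radical k φ).2 fun c => ?_)
    have h := preForm_antisymm k φ a a c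
    rw [← two_smul k] at h
    exact (smul_eq_zero.1 h).resolve_left two_ne_zero
  leibniz_lie a b c := by
    obtain ⟨a, rfl⟩ := cls_surjective k φ a
    obtain ⟨b, rfl⟩ := cls_surjective k φ b
    obtain ⟨c, rfl⟩ := cls_surjective k φ c
    refine sub_eq_zero.1 ((cls_eq_zero k φ).2 ((mem_radical k φ).2 fun d => ?_)
      : cls k φ (preBracket k X a (preBracket k X b c) - (preBracket k X (preBracket k X a b) c +
        preBracket k X b (preBracket k X a c))) = 0)
    have h1 := preForm_jacobi k φ a b c d
    have h2 := preForm_antisymm k φ a (preBracket k X b c) d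
    have h3 := preForm_antisymm k φ b (preBracket k X a c) d
    -- Antisymmetry is only known at the outermost vertex; moving `b` across the form and back gives
    -- it for the inner bracket of `a` and `c`.
    have h4 := preForm_antisymm k φ a c (preBracket k X b d)
    rw [← preForm_bracket, ← preForm_bracket] at h4
    simp only [map_sub, map_add, LinearMap.sub_apply, LinearMap.add_apply]
    linear_combination (norm := abel) h2 - h1 - h3 + h4

noncomputable instance : LieAlgebra k (Alg k φ) where
  lie_smul c a b := by simp [Bracket.bracket]

theorem form_lie (a b c : Alg k φ) : form k φ ⁅a, b⁆ c = form k φ a ⁅b, c⁆ := by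
  obtain ⟨a, rfl⟩ := cls_surjective k φ a
  obtain ⟨b, rfl⟩ := cls_surjective k φ b
  obtain ⟨c, rfl⟩ := cls_surjective k φ c
  exact preForm_bracket k φ a b c

/-- The element of the Lie algebra given by a leaf. -/
noncomputable def leaf (x : X) : Alg k φ := cls k φ (Finsupp.single (.of x) 1)

end Alg

end TreeForm

/-! ### Evaluation of rooted trees in Lie algebras -/

section Evaluation

variable {X : Type v} {L : Type w} [LieRing L]

/-- The value of a rooted tree in a Lie algebra, given the values of the leaves. -/
def ev (ψ : X → L) : FreeMagma X → L
  | .of x => ψ x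
  | .mul A B => ⁅ev ψ A, ev ψ B⁆

@[simp] theorem ev_of (ψ : X → L) (x : X) : ev ψ (.of x) = ψ x := rfl

@[simp] theorem ev_mul (ψ : X → L) (A B : FreeMagma X) : ev ψ (A * B) = ⁅ev ψ A, ev ψ B⁆ := rfl

theorem ev_map {Y : Type*} (g : Y → X) (ψ : X → L) (A : FreeMagma Y) :
    ev ψ (FreeMagma.map g A) = ev (ψ ∘ g) A := by
  induction A with
  | ih1 x => rfl
  | ih2 A B hA hB =>
    rw [map_mul, ev_mul, ev_mul, hA, hB]

@[simp] theorem rootedLeaves_of (x : X) : rootedLeaves (.of x) = {x} := rfl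

@[simp] theorem rootedLeaves_mul (A B : FreeMagma X) :
    rootedLeaves (A * B) = rootedLeaves A + rootedLeaves B := rfl

theorem ev_congr {ψ χ : X → L} (A : FreeMagma X) (h : ∀ x ∈ rootedLeaves A, ψ x = χ x) :
    ev ψ A = ev χ A := by
  induction A with
  | ih1 x => exact h x (by simp)
  | ih2 A B hA hB =>
    change ⁅_, _⁆ = ⁅_, _⁆
    rw [hA fun x hx => h x (Multiset.mem_add.2 (Or.inl hx)),
      hB fun x hx => h x (Multiset.mem_add.2 (Or.inr hx))]

end Evaluation

namespace TreeForm

variable (k : Type u) [Field k] [CharZero k] {X : Type v} {W : Type w} [AddCommGroup W]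
  [Module k W] (φ : TreeForm X W)

theorem ev_leaf (A : FreeMagma X) : ev (leaf k φ) A = cls k φ (Finsupp.single A 1) := by
  induction A with
  | ih1 x => rfl
  | ih2 A B hA hB =>
    rw [ev_mul, hA, hB]
    change bracketMap k φ _ _ = _
    rw [bracketMap_cls, preBracket_single]

/-- The bridge from graphs to Lie algebra: every tree form is an evaluation of trees in a Lie
algebra followed by an invariant form. -/
theorem toFun_eq (A B : FreeMagma X) :
    φ.toFun A B = form k φ (ev (leaf k φ) A) (ev (leaf k φ) B) := by
  rw [ev_leaf, ev_leaf, form_cls, preForm_single]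

end TreeForm

/-! ### Antipode and coproduct of the tensor algebra -/

section TensorAlgebraLemmas

variable (k : Type u) [Field k] {H : Type v} [AddCommGroup H] [Module k H]

/-- The product of the letters of a word in the tensor algebra. -/
noncomputable def word (v : List H) : TensorAlgebra k H := (v.map (TensorAlgebra.ι k)).prod

@[simp] theorem word_nil : word k ([] : List H) = 1 := rfl

@[simp] theorem word_cons (h : H) (v : List H) :
    word k (h :: v) = TensorAlgebra.ι k h * word k v := by simp [word]

@[simp] theorem word_append (v w : List H) : word k (v ++ w) = word k v * word k w := by
  simp [word]

variable {k}

theorem word_induction {p : TensorAlgebra k H → Prop} (add : ∀ x y, p x → p y → p (x + y))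
    (smul : ∀ (c : k) x, p x → p (c • x)) (wd : ∀ v : List H, p (word k v)) (x) : p x := by
  have hspan : x ∈ Submodule.span k (Set.range (word k (H := H))) := by
    induction x using TensorAlgebra.induction with
    | algebraMap r =>
      rw [Algebra.algebraMap_eq_smul_one]
      exact Submodule.smul_mem _ _ (Submodule.subset_span ⟨[], rfl⟩)
    | ι h => exact Submodule.subset_span ⟨[h], by simp⟩
    | mul a b ha hb =>
      have := Submodule.mul_mem_mul ha hb
      rw [Submodule.span_mul_span] at this
      refine Submodule.span_mono ?_ this
      rintro _ ⟨_, ⟨v, rfl⟩, _, ⟨w, rfl⟩, rfl⟩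
      exact ⟨v ++ w, by simp⟩
    | add a b ha hb => exact Submodule.add_mem _ ha hb
  induction hspan using Submodule.span_induction with
  | mem y hy => obtain ⟨v, rfl⟩ := hy; exact wd v
  | zero => simpa using smul 0 _ (wd [])
  | add x y _ _ hx hy => exact add x y hx hy
  | smul c x _ hx => exact smul c x hx

/-- Induction on the tensor algebra by left multiplication with letters. -/
theorem left_induction {p : TensorAlgebra k H → Prop} (add : ∀ x y, p x → p y → p (x + y))
    (smul : ∀ (c : k) x, p x → p (c • x)) (one : p 1)
    (mul : ∀ h x, p x → p (TensorAlgebra.ι k h * x)) (x) : p x := by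
  refine word_induction add smul (fun v => ?_) x
  induction v with
  | nil => exact one
  | cons h v ih => rw [word_cons]; exact mul h _ ih

variable (k)

@[simp] theorem rho_one : rho k H 1 = 1 := by simp [rho]

@[simp] theorem rho_ι (h : H) : rho k H (TensorAlgebra.ι k h) = -TensorAlgebra.ι k h := by
  simp [rho]

@[simp] theorem rho_mul (x y : TensorAlgebra k H) : rho k H (x * y) = rho k H y * rho k H x := by
  simp [rho]

@[simp] theorem rho_rho (x : TensorAlgebra k H) : rho k H (rho k H x) = x := by
  induction x using TensorAlgebra.induction with
  | algebraMap r => simp [Algebra.algebraMap_eq_smul_one]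
  | ι h => simp
  | mul a b ha hb => simp [ha, hb]
  | add a b ha hb => simp [ha, hb]

@[simp] theorem Delta_ι (h : H) : Delta k H (TensorAlgebra.ι k h) =
    TensorAlgebra.ι k h ⊗ₜ[k] 1 + 1 ⊗ₜ[k] TensorAlgebra.ι k h := by
  simp [Delta]

theorem comm_Delta (x : TensorAlgebra k H) :
    TensorProduct.comm k _ _ (Delta k H x) = Delta k H x := by
  have : (Algebra.TensorProduct.comm k (TensorAlgebra k H) (TensorAlgebra k H)).toAlgHom.comp
      (Delta k H) = Delta k H := by
    ext h
    simp [add_comm]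
  exact DFunLike.congr_fun this x

theorem map_rho_mul (x y : TensorAlgebra k H ⊗[k] TensorAlgebra k H) :
    TensorProduct.map (rho k H) (rho k H) (x * y) =
      TensorProduct.map (rho k H) (rho k H) y * TensorProduct.map (rho k H) (rho k H) x := by
  induction x using TensorProduct.induction_on with
  | zero => simp
  | add a b ha hb => simp [add_mul, mul_add, ha, hb]
  | tmul a b =>
    induction y using TensorProduct.induction_on with
    | zero => simp
    | add a b ha hb => simp [add_mul, mul_add, ha, hb]
    | tmul c d => simp

/-- An antipode reverses the coproduct up to a flip of the factors, and cocommutativity makes the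
flip invisible. -/
theorem Delta_rho (x : TensorAlgebra k H) :
    Delta k H (rho k H x) = TensorProduct.map (rho k H) (rho k H) (Delta k H x) := by
  induction x using TensorAlgebra.induction with
  | algebraMap r => simp [Algebra.algebraMap_eq_smul_one, Algebra.TensorProduct.one_def]
  | ι h => simp [TensorProduct.neg_tmul, TensorProduct.tmul_neg, add_comm]
  | mul a b ha hb => simp [ha, hb, map_rho_mul]
  | add a b ha hb => simp [ha, hb]

end TensorAlgebraLemmas

/-! ### The presentation: relations extended from `T⁺(H)` to `T(H)`, universal property -/

section PresentationLemmas

variable (k : Type u) [Field k] {H : Type v} [AddCommGroup H] [Module k H]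

/-- The projection of `T(H) ⊗ T(H)` to the presentation. -/
noncomputable def pres : TensorAlgebra k H ⊗[k] TensorAlgebra k H →ₗ[k] Presentation k H :=
  (relations k H).mkQ ∘ₗ Submodule.mkQ _ ∘ₗ projPlus₂ k H

theorem pres_word (v w : List H) : pres k (word k v ⊗ₜ[k] word k w) = wordClass k v w := rfl

variable {k} in
theorem projPlus_inclPlus (x : TPlus k H) : projPlus k H (inclPlus k H x) = x := by
  apply Subtype.ext
  have : (TensorAlgebra.algebraMapInv : TensorAlgebra k H →ₐ[k] k) (inclPlus k H x) = 0 := x.2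
  change inclPlus k H x - Algebra.linearMap k _ (TensorAlgebra.algebraMapInv (inclPlus k H x)) = _
  rw [this]
  simp
  rfl

variable {k} in
theorem inclPlus_projPlus (x : TensorAlgebra k H) :
    inclPlus k H (projPlus k H x) =
      x - TensorAlgebra.algebraMapInv (R := k) x • (1 : TensorAlgebra k H) := by
  rw [← Algebra.algebraMap_eq_smul_one]; rfl

@[simp] theorem projPlus_one : projPlus k H 1 = 0 := by
  apply Subtype.ext
  change (1 : TensorAlgebra k H) - Algebra.linearMap k _ (TensorAlgebra.algebraMapInv 1) = 0
  simp

theorem pres_one_left (w : TensorAlgebra k H) : pres k ((1 : TensorAlgebra k H) ⊗ₜ[k] w) = 0 := by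
  simp [pres, projPlus₂]

theorem pres_one_right (v : TensorAlgebra k H) : pres k (v ⊗ₜ[k] (1 : TensorAlgebra k H)) = 0 := by
  simp [pres, projPlus₂]

variable {k}

/-- Two linear maps on `T(H) ⊗ T(H)` that vanish on `1 ⊗ T(H)` and `T(H) ⊗ 1` agree if they agree on
`T⁺(H) ⊗ T⁺(H)`. -/
theorem tensor_eq_of_plus {W : Type w} [AddCommGroup W] [Module k W]
    (F : TensorAlgebra k H ⊗[k] TensorAlgebra k H →ₗ[k] W)
    (h₁ : ∀ w, F ((1 : TensorAlgebra k H) ⊗ₜ[k] w) = 0)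
    (h₂ : ∀ v, F (v ⊗ₜ[k] (1 : TensorAlgebra k H)) = 0) :
    F ∘ₗ TensorProduct.map (inclPlus k H) (inclPlus k H) ∘ₗ projPlus₂ k H = F := by
  ext v w
  simp [projPlus₂, inclPlus_projPlus, TensorProduct.sub_tmul, TensorProduct.tmul_sub, h₁, h₂,
    ← TensorProduct.smul_tmul']

theorem pres_incl (x : TPlus k H ⊗[k] TPlus k H) :
    pres k (TensorProduct.map (inclPlus k H) (inclPlus k H) x) =
      (relations k H).mkQ (Submodule.mkQ _ x) := by
  have : projPlus₂ k H (TensorProduct.map (inclPlus k H) (inclPlus k H) x) = x := by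
    induction x using TensorProduct.induction_on with
    | zero => simp
    | add a b ha hb => simp [ha, hb]
    | tmul a b => simp [projPlus₂, projPlus_inclPlus]
  simp [pres, this]

variable (k)

/-- As `T(H)` is the sum of `T⁺(H)` and the line of the unit, an identity of bilinear maps needs a
check on `T⁺(H)` and one for the unit in each slot. -/
theorem pres_ind {W : Type w} [AddCommGroup W] [Module k W]
    (F G : TensorAlgebra k H →ₗ[k] TensorAlgebra k H →ₗ[k] W)
    (h₁ : ∀ w, F 1 w = G 1 w) (h₂ : ∀ v, F v 1 = G v 1)
    (h : ∀ v w : TPlus k H, F (inclPlus k H v) (inclPlus k H w) =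
      G (inclPlus k H v) (inclPlus k H w)) (v w) : F v w = G v w := by
  have key : ∀ x : TensorAlgebra k H, x = inclPlus k H (projPlus k H x) +
      TensorAlgebra.algebraMapInv (R := k) x • (1 : TensorAlgebra k H) := by
    intro x; rw [inclPlus_projPlus]; abel
  rw [key v, key w]
  simp [h₁, h₂, h]

theorem pres_rho (v w : TensorAlgebra k H) :
    pres k (rho k H v ⊗ₜ[k] rho k H w) = pres k (v ⊗ₜ[k] w) := by
  refine pres_ind k
    ((TensorProduct.mk k _ _).compr₂ (pres k) |>.compl₁₂ (rho k H) (rho k H))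
    ((TensorProduct.mk k _ _).compr₂ (pres k)) ?_ ?_ ?_ v w
  · intro w; simp [pres_one_left]
  · intro w; simp [pres_one_right]
  · intro v w
    have h : (Submodule.Quotient.mk (v ⊗ₜ[k] w - actRho k H (v ⊗ₜ[k] w)) : Coinv k H) = 0 :=
      (Submodule.Quotient.mk_eq_zero _).2 (Submodule.subset_span (Or.inl ⟨_, rfl⟩))
    have h' := congrArg (relations k H).mkQ h
    have e := pres_incl (v ⊗ₜ[k] w)
    simp only [TensorProduct.map_tmul] at e
    simp only [LinearMap.compl₁₂_apply, LinearMap.compr₂_apply, TensorProduct.mk_apply, e]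
    rw [map_zero, Submodule.Quotient.mk_sub, map_sub, sub_eq_zero] at h'
    refine Eq.trans ?_ h'.symm
    simp only [actRho, TensorProduct.map_tmul]
    rfl

theorem pres_swap (v w : TensorAlgebra k H) :
    pres k (rho k H w ⊗ₜ[k] rho k H v) = pres k (v ⊗ₜ[k] w) := by
  refine pres_ind k
    ((TensorProduct.mk k _ _).compr₂ (pres k) |>.compl₁₂ (rho k H) (rho k H)).flip
    ((TensorProduct.mk k _ _).compr₂ (pres k)) ?_ ?_ ?_ v w
  · intro w; simp [pres_one_left, pres_one_right]
  · intro w; simp [pres_one_right, pres_one_left]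
  · intro v w
    have h : (Submodule.Quotient.mk (v ⊗ₜ[k] w - actSwap k H (v ⊗ₜ[k] w)) : Coinv k H) = 0 :=
      (Submodule.Quotient.mk_eq_zero _).2 (Submodule.subset_span (Or.inr ⟨_, rfl⟩))
    have h' := congrArg (relations k H).mkQ h
    have e := pres_incl (v ⊗ₜ[k] w)
    simp only [TensorProduct.map_tmul] at e
    simp only [LinearMap.compl₁₂_apply, LinearMap.compr₂_apply, TensorProduct.mk_apply, e,
      LinearMap.flip_apply]
    rw [map_zero, Submodule.Quotient.mk_sub, map_sub, sub_eq_zero] at h'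
    refine Eq.trans ?_ h'.symm
    simp only [actRho, actSwap, LinearMap.comp_apply, LinearEquiv.coe_coe, TensorProduct.comm_tmul,
      TensorProduct.map_tmul]
    rfl

theorem pres_flip (v w : TensorAlgebra k H) : pres k (w ⊗ₜ[k] v) = pres k (v ⊗ₜ[k] w) := by
  rw [← pres_swap, pres_rho]

theorem pres_comm (h : H) (v w : TensorAlgebra k H) :
    pres k ((TensorAlgebra.ι k h * v) ⊗ₜ[k] w) + pres k (v ⊗ₜ[k] (TensorAlgebra.ι k h * w)) =
      pres k ((v * TensorAlgebra.ι k h) ⊗ₜ[k] w) + pres k (v ⊗ₜ[k] (w * TensorAlgebra.ι k h)) := by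
  let M : TensorAlgebra k H →ₗ[k] TensorAlgebra k H →ₗ[k] Presentation k H :=
    (TensorProduct.mk k _ _).compr₂ (pres k)
  refine pres_ind k
    (M.compl₁₂ (LinearMap.mulLeft k (TensorAlgebra.ι k h)) LinearMap.id +
      M.compl₁₂ LinearMap.id (LinearMap.mulLeft k (TensorAlgebra.ι k h)))
    (M.compl₁₂ (LinearMap.mulRight k (TensorAlgebra.ι k h)) LinearMap.id +
      M.compl₁₂ LinearMap.id (LinearMap.mulRight k (TensorAlgebra.ι k h))) ?_ ?_ ?_ v w
  · intro w; simp [M, pres_one_left]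
  · intro w; simp [M, pres_one_right]
  · intro v w
    have h : pres k (commRelator k H h (inclPlus k H v) (inclPlus k H w)) = 0 :=
      (Submodule.Quotient.mk_eq_zero _).2 (Submodule.subset_span (Or.inl ⟨_, _, _, rfl⟩))
    simp only [commRelator, add_mul, mul_add, Algebra.TensorProduct.tmul_mul_tmul, one_mul, mul_one,
      map_add, map_neg] at h
    simp only [M, LinearMap.add_apply, LinearMap.compl₁₂_apply, LinearMap.compr₂_apply,
      TensorProduct.mk_apply, LinearMap.mulLeft_apply, LinearMap.mulRight_apply, LinearMap.id_apply]
    rw [← sub_eq_zero, ← neg_eq_zero, ← h]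
    abel

theorem pres_tri_incl (v w : TPlus k H) :
    pres k (triRelator k H (inclPlus k H v) (inclPlus k H w)) = 0 :=
  (Submodule.Quotient.mk_eq_zero _).2 (Submodule.subset_span (Or.inr ⟨_, _, rfl⟩))

/-- This is the second relator with the one-letter word `h` on the left: its first term is `-h ⊗ y +
1 ⊗ h y`, so the first two terms cancel up to `1 ⊗ T(H)`. -/
theorem pres_Delta_left (h : H) (y : TensorAlgebra k H) :
    pres k ((rho k H).lTensor _ ((TensorAlgebra.ι k h ⊗ₜ[k] 1) * Delta k H y)) = 0 := by
  have hplus : ∀ y : TPlus k H, pres k ((rho k H).lTensor _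
      ((TensorAlgebra.ι k h ⊗ₜ[k] 1) * Delta k H (inclPlus k H y))) = 0 := by
    intro y
    have hι : inclPlus k H (projPlus k H (TensorAlgebra.ι k h)) = TensorAlgebra.ι k h := by
      simp [inclPlus_projPlus, TensorAlgebra.algebraMapInv]
    have := pres_tri_incl k (projPlus k H (TensorAlgebra.ι k h)) y
    rw [hι] at this
    simpa [triRelator, add_mul, TensorProduct.neg_tmul, pres_one_left] using this
  have key : y = inclPlus k H (projPlus k H y) +
      TensorAlgebra.algebraMapInv (R := k) y • (1 : TensorAlgebra k H) := by
    rw [inclPlus_projPlus]; abel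
  rw [key, map_add, mul_add, map_add, map_add, hplus]
  simp [pres_one_right]

/-- Split off the first letter `h` of `w`. The part where `h` goes left vanishes by
`pres_Delta_left`; the part where it goes right equals that one by the swap symmetry and
cocommutativity. -/
theorem pres_Delta_rho (w : TensorAlgebra k H) :
    pres k ((rho k H).lTensor _ (Delta k H w)) = 0 := by
  induction w using left_induction with
  | add x y hx hy => simp [hx, hy]
  | smul c x hx => simp [hx]
  | one => simp [Algebra.TensorProduct.one_def, pres_one_right]
  | mul h y _ =>
    have hswap : ∀ X : TensorAlgebra k H ⊗[k] TensorAlgebra k H,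
        pres k ((rho k H).lTensor _ ((1 ⊗ₜ[k] TensorAlgebra.ι k h) * X)) =
          pres k ((rho k H).lTensor _
            ((TensorAlgebra.ι k h ⊗ₜ[k] 1) * TensorProduct.comm k _ _ X)) := by
      intro X
      induction X using TensorProduct.induction_on with
      | zero => simp
      | add a b ha hb => simp only [mul_add, map_add, ha, hb]
      | tmul a b =>
        simp only [Algebra.TensorProduct.tmul_mul_tmul, one_mul, LinearMap.lTensor_tmul,
          TensorProduct.comm_tmul]
        rw [← pres_swap, rho_rho]
    rw [map_mul, Delta_ι, add_mul, map_add, map_add, hswap, comm_Delta, pres_Delta_left, add_zero]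

/-- The relators are imposed for words of positive length only. With an empty word on one side all
that remains is `pres_Delta_rho`, so no exception has to be made later. -/
theorem pres_tri (v w : TensorAlgebra k H) : pres k (triRelator k H v w) = 0 := by
  let M := LinearMap.mul k (TensorAlgebra k H ⊗[k] TensorAlgebra k H)
  let I := TensorProduct.mk k (TensorAlgebra k H) (TensorAlgebra k H)
  have := pres_ind k
    (((M.compl₁₂ (Delta k H).toLinearMap (I 1)).compr₂ ((rho k H).rTensor _) + I +
      (M.compl₁₂ (I.flip 1) (Delta k H).toLinearMap).compr₂ ((rho k H).lTensor _)).compr₂ (pres k))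
    0 ?_ ?_ ?_ v w
  · exact this
  · intro w
    have h := pres_Delta_rho k w
    simp [M, I, ← Algebra.TensorProduct.one_def, pres_one_left, h]
  · intro v
    -- Coinvariance under `ρ ⊗ ρ` moves `ρ` from one factor to the other.
    have h : ∀ X : TensorAlgebra k H ⊗[k] TensorAlgebra k H,
        pres k ((rho k H).rTensor _ X) = pres k ((rho k H).lTensor _ X) := by
      intro X
      induction X using TensorProduct.induction_on with
      | zero => simp
      | add a b ha hb => simp only [map_add, ha, hb]
      | tmul a b =>
        rw [LinearMap.lTensor_tmul, LinearMap.rTensor_tmul, ← pres_rho, rho_rho]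
    simp [M, I, ← Algebra.TensorProduct.one_def, pres_one_right, h, pres_Delta_rho]
  · intro v w
    exact pres_tri_incl k v w

/-- The universal property of the presentation. -/
theorem exists_lift {W : Type w} [AddCommGroup W] [Module k W]
    (G : TensorAlgebra k H ⊗[k] TensorAlgebra k H →ₗ[k] W)
    (one_left : ∀ w, G ((1 : TensorAlgebra k H) ⊗ₜ[k] w) = 0)
    (one_right : ∀ v, G (v ⊗ₜ[k] (1 : TensorAlgebra k H)) = 0)
    (rho_rho : ∀ v w, G (rho k H v ⊗ₜ[k] rho k H w) = G (v ⊗ₜ[k] w))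
    (swap : ∀ v w, G (rho k H w ⊗ₜ[k] rho k H v) = G (v ⊗ₜ[k] w))
    (comm : ∀ h v w, G (commRelator k H h v w) = 0)
    (tri : ∀ v w, G (triRelator k H v w) = 0) :
    ∃ Ψ : Presentation k H →ₗ[k] W, ∀ x, Ψ (pres k x) = G x := by
  let ι₂ := TensorProduct.map (inclPlus k H) (inclPlus k H)
  have key : ∀ x, G (ι₂ (projPlus₂ k H x)) = G x := fun x =>
    LinearMap.congr_fun (tensor_eq_of_plus G one_left one_right) x
  have h₁ : ∀ y, G (ι₂ (actRho k H y)) = G (ι₂ y) := by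
    intro y
    induction y using TensorProduct.induction_on with
    | zero => simp
    | add a b ha hb => simp only [map_add, ha, hb]
    | tmul a b =>
      refine (key (rho k H (inclPlus k H a) ⊗ₜ[k] rho k H (inclPlus k H b))).trans ?_
      rw [rho_rho]
      rfl
  have h₂ : ∀ y, G (ι₂ (TensorProduct.comm k _ _ y)) = G (ι₂ y) := by
    intro y
    induction y using TensorProduct.induction_on with
    | zero => simp
    | add a b ha hb => simp only [map_add, ha, hb]
    | tmul a b =>
      rw [TensorProduct.comm_tmul]
      change G (inclPlus k H b ⊗ₜ[k] inclPlus k H a) = G (inclPlus k H a ⊗ₜ[k] inclPlus k H b)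
      rw [← swap, rho_rho]
  let G₁ : Coinv k H →ₗ[k] W := Submodule.liftQ _ (G ∘ₗ ι₂) (by
    rw [Submodule.span_le]
    rintro _ (⟨y, rfl⟩ | ⟨y, rfl⟩)
    · simp [h₁]
    · simp only [SetLike.mem_coe, LinearMap.mem_ker, map_sub, LinearMap.comp_apply, actSwap, h₁,
        LinearEquiv.coe_coe, h₂, sub_self])
  refine ⟨(relations k H).liftQ G₁ ?_, fun x => key x⟩
  rw [relations, Submodule.span_le]
  rintro _ (⟨h, v, w, rfl⟩ | ⟨v, w, rfl⟩)
  · exact (key _).trans (comm _ _ _)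
  · exact (key _).trans (tri _ _)

end PresentationLemmas

/-! ### Hairs as adjoint operators -/

section LieMap

variable (k : Type u) [Field k] (L : Type w) [LieRing L] [LieAlgebra k L]

/-- The bracket as a bilinear map. -/
def lieMap : L →ₗ[k] L →ₗ[k] L :=
  LinearMap.mk₂ k (fun a b => ⁅a, b⁆) add_lie smul_lie lie_add (fun c a b => lie_smul c a b)

@[simp] theorem lieMap_apply (a b : L) : lieMap k L a b = ⁅a, b⁆ := rfl

end LieMap

section Action

variable {k : Type u} [Field k] {H : Type v} [AddCommGroup H] [Module k H]
  {L : Type w} [LieRing L] [LieAlgebra k L] (η : H →ₗ[k] L)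

/-- The adjoint action of the tensor algebra of `H` on a Lie algebra, induced by a linear map from
`H`. -/
noncomputable def act : TensorAlgebra k H →ₐ[k] Module.End k L :=
  TensorAlgebra.lift k (lieMap k L ∘ₗ η)

@[simp] theorem act_ι (h : H) (a : L) : act η (TensorAlgebra.ι k h) a = ⁅η h, a⁆ := by
  simp [act]

/-- The map `x ⊗ y ↦ [x · a, y · b]`. -/
noncomputable def actLie (a b : L) : TensorAlgebra k H ⊗[k] TensorAlgebra k H →ₗ[k] L :=
  TensorProduct.lift ((lieMap k L).compl₁₂
    ((LinearMap.applyₗ a).comp (act η).toLinearMap)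
    ((LinearMap.applyₗ b).comp (act η).toLinearMap))

@[simp] theorem actLie_tmul (a b : L) (x y : TensorAlgebra k H) :
    actLie η a b (x ⊗ₜ y) = ⁅act η x a, act η y b⁆ := rfl

/-- Letters act by derivations and are primitive for `Delta`. -/
theorem act_lie (a b : L) (x : TensorAlgebra k H) :
    act η x ⁅a, b⁆ = actLie η a b (Delta k H x) := by
  induction x using left_induction with
  | add x y hx hy => simp [hx, hy]
  | smul c x hx => simp [hx]
  | one => simp [Algebra.TensorProduct.one_def]
  | mul h x hx =>
    rw [map_mul, Module.End.mul_apply, hx, map_mul, Delta_ι, act_ι]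
    induction Delta k H x using TensorProduct.induction_on with
    | zero => simp
    | add p q hp hq => simp only [map_add, mul_add, lie_add, hp, hq]
    | tmul p q => simp [add_mul]

/-- A letter acts skew-adjointly by invariance, and products change their order when moved across
the form; this is the antipode. -/
theorem act_form {W : Type*} [AddCommGroup W] [Module k W] (F : L →ₗ[k] L →ₗ[k] W)
    (hF : ∀ a b c, F ⁅a, b⁆ c = F a ⁅b, c⁆) (x : TensorAlgebra k H) (a b : L) :
    F (act η x a) b = F a (act η (rho k H x) b) := by
  induction x using TensorAlgebra.induction generalizing a b with
  | algebraMap r => simp [Algebra.algebraMap_eq_smul_one]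
  | ι h =>
    rw [rho_ι, map_neg, LinearMap.neg_apply, act_ι, act_ι, ← lie_skew, map_neg, LinearMap.neg_apply,
      map_neg, hF]
  | mul x y hx hy => simp [hx, hy]
  | add x y hx hy => simp [hx, hy]

end Action

@[simp] theorem comb_nil {H : Type v} {n : ℕ} (x : Leaf H n) : comb [] x = .of x := rfl

@[simp] theorem comb_cons {H : Type v} {n : ℕ} (h : H) (v : List H) (x : Leaf H n) :
    comb (h :: v) x = .of (.hair h) * comb v x := rfl

theorem ev_comb {k : Type u} [Field k] {H : Type v} [AddCommGroup H] [Module k H]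
    {L : Type w} [LieRing L] [LieAlgebra k L] (η : H →ₗ[k] L) {n : ℕ} (ψ : Leaf H n → L)
    (hψ : ∀ h, ψ (.hair h) = η h) (v : List H) (x : Leaf H n) :
    ev ψ (comb v x) = act η (word k v) (ψ x) := by
  induction v with
  | nil => simp
  | cons h v ih => simp [ih, hψ]

/-! ### Rooting a tree at one of its leaves -/

section Root

variable (k : Type u) [Field k] {X : Type v} {L : Type w} [LieRing L] [LieAlgebra k L]

open Classical in
/-- The value of the tree `(A, C)` rooted at the univalent vertex `x` of `A`, as a function of the
value of `C`. -/
noncomputable def rootAux (ψ : X → L) (x : X) : FreeMagma X → L →ₗ[k] L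
  | .of y => if y = x then LinearMap.id else 0
  | .mul A B => rootAux ψ x A ∘ₗ lieMap k L (ev ψ B) -
      rootAux ψ x B ∘ₗ lieMap k L (ev ψ A)

/-- The value of the tree `(A, B)` rooted at its univalent vertex `x`. -/
noncomputable def root (ψ : X → L) (x : X) (A B : FreeMagma X) : L :=
  rootAux k ψ x A (ev ψ B) + rootAux k ψ x B (ev ψ A)

/-- In this sign-free form the recursion follows the cyclic order at the vertex, exactly as `cutAux`
does. -/
theorem rootAux_mul (ψ : X → L) (x : X) (A B : FreeMagma X) (c : L) :
    rootAux k ψ x (A * B) c = rootAux k ψ x A ⁅ev ψ B, c⁆ + rootAux k ψ x B ⁅c, ev ψ A⁆ := by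
  rw [← lie_skew c, map_neg, ← sub_eq_add_neg]
  rfl

theorem rootAux_of_self (ψ : X → L) (x : X) (c : L) : rootAux k ψ x (.of x) c = c := by
  simp [rootAux]

theorem rootAux_of_ne (ψ : X → L) {x y : X} (h : y ≠ x) (c : L) :
    rootAux k ψ x (.of y) c = 0 := by
  simp [rootAux, h]

theorem rootAux_eq_zero (ψ : X → L) {x : X} {A : FreeMagma X} (h : x ∉ rootedLeaves A) (c : L) :
    rootAux k ψ x A c = 0 := by
  induction A generalizing c with
  | ih1 y => exact rootAux_of_ne k ψ (fun e => h (by simp [e])) c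
  | ih2 A B hA hB =>
    rw [rootedLeaves_mul, Multiset.mem_add, not_or] at h
    rw [rootAux_mul, hA h.1, hB h.2, add_zero]

/-- The value of a tree rooted at a given vertex, composed with a linear map, is a tree form. -/
noncomputable def rootForm {W : Type*} [AddCommGroup W] [Module k W] (ψ : X → L) (x : X)
    (y : L →ₗ[k] W) : TreeForm X W where
  toFun A B := y (root k ψ x A B)
  symm A B := by rw [root, root, add_comm]
  move A B C := by
    simp only [root, rootAux_mul, ev_mul]
    rw [add_assoc, add_comm (rootAux k ψ x B _)]
  antisymm A B C := by
    simp only [root, rootAux_mul, ev_mul]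
    rw [← map_add, ← lie_skew (ev ψ A) (ev ψ C), ← lie_skew (ev ψ B) (ev ψ C),
      ← lie_skew (ev ψ A) (ev ψ B)]
    simp only [map_neg]
    convert map_zero y using 2
    abel
  ihx A B C D := by
    simp only [root, rootAux_mul, ev_mul]
    -- Four subtrees meet in an IHX relation. For each of them that may contain the root leaf, the
    -- relation becomes the Jacobi identity for the other three.
    have J : ∀ b c d : L, ⁅b, ⁅c, d⁆⁆ + ⁅d, ⁅b, c⁆⁆ + ⁅⁅b, d⁆, c⁆ = 0 := by
      intro b c d
      rw [← lie_skew d ⁅b, c⁆, leibniz_lie b c d, ← lie_skew c ⁅b, d⁆]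
      abel
    have J' : ∀ a b c : L, ⁅⁅a, b⁆, c⁆ + ⁅⁅b, c⁆, a⁆ + ⁅⁅c, a⁆, b⁆ = 0 := by
      intro a b c
      rw [← lie_skew ⁅a, b⁆ c, ← lie_skew ⁅b, c⁆ a, ← lie_skew ⁅c, a⁆ b]
      linear_combination (norm := abel) -lie_jacobi a b c
    have hA := congrArg (rootAux k ψ x A) (J (ev ψ B) (ev ψ C) (ev ψ D))
    have hB := congrArg (rootAux k ψ x B) (J (ev ψ C) (ev ψ A) (ev ψ D))
    have hC := congrArg (rootAux k ψ x C) (J (ev ψ A) (ev ψ B) (ev ψ D))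
    have hD := congrArg (rootAux k ψ x D) (J' (ev ψ A) (ev ψ B) (ev ψ C))
    rw [← map_add, ← map_add]
    convert map_zero y using 2
    simp only [map_add, map_zero] at hA hB hC hD
    linear_combination (norm := abel) hA + hB + hC + hD

open Classical in
theorem cutAux_eq_none {x : X} {A : FreeMagma X} (h : x ∉ rootedLeaves A) (C : FreeMagma X) :
    cutAux x A C = none := by
  induction A generalizing C with
  | ih1 y =>
    have : y ≠ x := fun e => h (by simp [e])
    simp [cutAux, this]
  | ih2 A B hA hB =>
    rw [rootedLeaves_mul, Multiset.mem_add, not_or] at h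
    change (cutAux x A (B * C) <|> cutAux x B (C * A)) = none
    rw [hA h.1, hB h.2]
    rfl

open Classical in
theorem exists_cutAux {x : X} {A : FreeMagma X} (h : (rootedLeaves A).count x = 1)
    (C : FreeMagma X) :
    ∃ D, cutAux x A C = some D ∧ x ::ₘ rootedLeaves D = rootedLeaves A + rootedLeaves C := by
  induction A generalizing C with
  | ih1 y =>
    have : x = y := by
      by_contra e
      simp [e] at h
    subst this
    exact ⟨C, by simp [cutAux], by simp⟩
  | ih2 A B hA hB =>
    rw [rootedLeaves_mul, Multiset.count_add] at h
    change ∃ D, (cutAux x A (B * C) <|> cutAux x B (C * A)) = _ ∧ _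
    by_cases hx : x ∈ rootedLeaves A
    · have := Multiset.one_le_count_iff_mem.2 hx
      obtain ⟨D, h1, h2⟩ := hA (by omega) (B * C)
      refine ⟨D, by rw [h1]; rfl, ?_⟩
      rw [h2, rootedLeaves_mul, rootedLeaves_mul, add_assoc]
    · rw [Multiset.count_eq_zero_of_notMem hx, zero_add] at h
      obtain ⟨D, h1, h2⟩ := hB h (C * A)
      refine ⟨D, by rw [cutAux_eq_none hx, h1]; rfl, ?_⟩
      rw [h2, rootedLeaves_mul, rootedLeaves_mul]
      abel

open Classical in
theorem ev_cutAux (ψ : X → L) {x : X} {A C D : FreeMagma X} (h : (rootedLeaves A).count x = 1)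
    (hD : cutAux x A C = some D) : ev ψ D = rootAux k ψ x A (ev ψ C) := by
  induction A generalizing C with
  | ih1 y =>
    have : x = y := by
      by_contra e
      simp [e] at h
    subst this
    rw [rootAux_of_self]
    simp only [cutAux, if_true, Option.some.injEq] at hD
    rw [hD]
  | ih2 A B hA hB =>
    rw [rootedLeaves_mul, Multiset.count_add] at h
    change (cutAux x A (B * C) <|> cutAux x B (C * A)) = _ at hD
    rw [rootAux_mul]
    by_cases hx : x ∈ rootedLeaves A
    · have := Multiset.one_le_count_iff_mem.2 hx
      have hB0 : x ∉ rootedLeaves B := by rw [← Multiset.count_eq_zero]; omega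
      obtain ⟨D', h1, -⟩ := exists_cutAux (show (rootedLeaves A).count x = 1 by omega) (B * C)
      rw [h1] at hD
      obtain rfl : D' = D := Option.some.inj hD
      rw [hA (by omega) h1, rootAux_eq_zero k ψ hB0, add_zero, ev_mul]
    · rw [Multiset.count_eq_zero_of_notMem hx, zero_add] at h
      rw [cutAux_eq_none hx] at hD
      rw [rootAux_eq_zero k ψ hx, zero_add, hB h hD, ev_mul]

open Classical in
theorem cut_eq_none {x : X} {t : Tree X} (h : x ∉ t.leaves) : t.cut x = none := by
  rw [Tree.leaves, Multiset.mem_add, not_or] at h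
  rw [Tree.cut, cutAux_eq_none h.1, cutAux_eq_none h.2]
  rfl

open Classical in
theorem exists_cut {x : X} {t : Tree X} (h : t.leaves.count x = 1) :
    ∃ D, t.cut x = some D ∧ x ::ₘ rootedLeaves D = t.leaves := by
  rw [Tree.leaves, Multiset.count_add] at h
  by_cases hx : x ∈ rootedLeaves t.1
  · have := Multiset.one_le_count_iff_mem.2 hx
    obtain ⟨D, h1, h2⟩ := exists_cutAux (show (rootedLeaves t.1).count x = 1 by omega) t.2
    exact ⟨D, by rw [Tree.cut, h1]; rfl, h2⟩
  · rw [Multiset.count_eq_zero_of_notMem hx, zero_add] at h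
    obtain ⟨D, h1, h2⟩ := exists_cutAux h t.1
    exact ⟨D, by rw [Tree.cut, cutAux_eq_none hx, h1]; rfl, by rw [h2, add_comm, Tree.leaves]⟩

-- Links the combinatorial cut with the linear `root`: as `x` occurs once, one of the two summands
-- of `root` is zero and the other follows the branches chosen by the cut.
open Classical in
theorem ev_cut (ψ : X → L) {x : X} {t : Tree X} {D : FreeMagma X} (h : t.leaves.count x = 1)
    (hD : t.cut x = some D) : ev ψ D = root k ψ x t.1 t.2 := by
  rw [Tree.leaves, Multiset.count_add] at h
  by_cases hx : x ∈ rootedLeaves t.1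
  · have := Multiset.one_le_count_iff_mem.2 hx
    have hB0 : x ∉ rootedLeaves t.2 := by rw [← Multiset.count_eq_zero]; omega
    obtain ⟨D', h1, -⟩ := exists_cutAux (show (rootedLeaves t.1).count x = 1 by omega) t.2
    rw [Tree.cut, h1] at hD
    obtain rfl : D' = D := Option.some.inj hD
    rw [root, rootAux_eq_zero k ψ hB0, add_zero, ev_cutAux k ψ (by omega) h1]
  · rw [Multiset.count_eq_zero_of_notMem hx, zero_add] at h
    rw [Tree.cut, cutAux_eq_none hx] at hD
    rw [root, rootAux_eq_zero k ψ hx, zero_add, ev_cutAux k ψ h hD]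

end Root

/-! ### Trees with few edge ends are spanned by combs of hairs -/

section LeafEnds

variable {H : Type v} {n : ℕ}

/-- The end of an external edge at a univalent vertex, if it is not a hair. -/
def Leaf.end? : Leaf H n → Option (Fin n × Bool)
  | .hair _ => none
  | .edge e b => some (e, b)

/-- The ends of external edges on a rooted tree. -/
def rootedEnds (A : FreeMagma (Leaf H n)) : Multiset (Fin n × Bool) :=
  (rootedLeaves A).filterMap Leaf.end?

@[simp] theorem rootedEnds_hair (h : H) : rootedEnds (.of (.hair h) : FreeMagma (Leaf H n)) = 0 :=
  rfl

@[simp] theorem rootedEnds_edge (e : Fin n) (b : Bool) :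
    rootedEnds (.of (.edge e b) : FreeMagma (Leaf H n)) = {(e, b)} := rfl

@[simp] theorem rootedEnds_mul (A B : FreeMagma (Leaf H n)) :
    rootedEnds (A * B) = rootedEnds A + rootedEnds B := by
  simp [rootedEnds]

theorem mem_rootedEnds {A : FreeMagma (Leaf H n)} {x : Fin n × Bool} :
    x ∈ rootedEnds A ↔ Leaf.edge x.1 x.2 ∈ rootedLeaves A := by
  rw [rootedEnds, Multiset.mem_filterMap]
  constructor
  · rintro ⟨l, hl, h⟩
    cases l with
    | hair h' => simp [Leaf.end?] at h
    | edge e b =>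
      simp only [Leaf.end?, Option.some.injEq] at h
      subst h
      exact hl
  · intro h
    exact ⟨_, h, rfl⟩

@[simp] theorem rootedEnds_comb (v : List H) (e : Fin n) (b : Bool) :
    rootedEnds (comb v (.edge e b)) = {(e, b)} := by
  induction v with
  | nil => rfl
  | cons h v ih => simp [ih]

theorem Multiset.add_eq_cons {α : Type*} {s t u : Multiset α} {a : α} (h : s + t = a ::ₘ u) :
    (∃ s', s = a ::ₘ s' ∧ s' + t = u) ∨ (∃ t', t = a ::ₘ t' ∧ s + t' = u) := by
  have ha : a ∈ s + t := by rw [h]; exact Multiset.mem_cons_self a u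
  rcases Multiset.mem_add.1 ha with ha | ha
  · obtain ⟨s', rfl⟩ := Multiset.exists_cons_of_mem ha
    refine Or.inl ⟨s', rfl, ?_⟩
    rwa [Multiset.cons_add, Multiset.cons_inj_right] at h
  · obtain ⟨t', rfl⟩ := Multiset.exists_cons_of_mem ha
    refine Or.inr ⟨t', rfl, ?_⟩
    rwa [Multiset.add_cons, Multiset.cons_inj_right] at h

end LeafEnds

section Span

variable (k : Type u) [Field k] {H : Type v} {n : ℕ} {L : Type w} [LieRing L] [LieAlgebra k L]
  (ψ : Leaf H n → L)

theorem lie_mem_of_span {s t : Set L} {U : Submodule k L} (h : ∀ a ∈ s, ∀ b ∈ t, ⁅a, b⁆ ∈ U)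
    {x y : L} (hx : x ∈ Submodule.span k s) (hy : y ∈ Submodule.span k t) : ⁅x, y⁆ ∈ U := by
  induction hx using Submodule.span_induction with
  | mem a ha =>
    induction hy using Submodule.span_induction with
    | mem b hb => exact h a ha b hb
    | zero => simp
    | add x y _ _ hx hy => rw [lie_add]; exact U.add_mem hx hy
    | smul c x _ hx => rw [lie_smul]; exact U.smul_mem _ hx
  | zero => simp
  | add x y _ _ hx hy => rw [add_lie]; exact U.add_mem hx hy
  | smul c x _ hx => rw [smul_lie]; exact U.smul_mem _ hx

/-- A tree with hairs only is a Lie monomial in the hairs and acts by iterated commutators of their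
operators. -/
theorem ev_lie_mem {U : Submodule k L} (hU : ∀ h, ∀ y ∈ U, ⁅ψ (.hair h), y⁆ ∈ U)
    {A : FreeMagma (Leaf H n)} (hA : rootedEnds A = 0) {y : L} (hy : y ∈ U) : ⁅ev ψ A, y⁆ ∈ U := by
  induction A generalizing y with
  | ih1 x =>
    cases x with
    | hair h => exact hU h y hy
    | edge e b => simp at hA
  | ih2 A B ihA ihB =>
    rw [rootedEnds_mul, add_eq_zero] at hA
    rw [ev_mul, lie_lie]
    exact U.sub_mem (ihA hA.1 (ihB hA.2 hy)) (ihB hA.2 (ihA hA.1 hy))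

/-- The values of the rooted trees with hairs along an edge. -/
def combSet (a : Fin n × Bool) : Set L := Set.range fun v => ev ψ (comb v (.edge a.1 a.2))

theorem hair_lie_mem_combSet {a : Fin n × Bool} {x : L} (h : H) (hx : x ∈ combSet ψ a) :
    ⁅ψ (.hair h), x⁆ ∈ combSet ψ a := by
  obtain ⟨v, rfl⟩ := hx
  exact ⟨h :: v, rfl⟩

theorem stable_of_span {s : Set L} {U : Submodule k L} (hs : U = Submodule.span k s)
    (h : ∀ h, ∀ x ∈ s, ⁅ψ (.hair h), x⁆ ∈ U) : ∀ h, ∀ y ∈ U, ⁅ψ (.hair h), y⁆ ∈ U := by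
  intro g y hy
  exact lie_mem_of_span k (s := {ψ (.hair g)}) (t := s) (by rintro a rfl; exact h g)
    (Submodule.subset_span rfl) (hs ▸ hy)

/-- On the path from the root to the only end, all side branches consist of hairs; commutators
straighten each of them into single hairs. -/
theorem ev_mem_span_one {a : Fin n × Bool} {A : FreeMagma (Leaf H n)} (hA : rootedEnds A = {a}) :
    ev ψ A ∈ Submodule.span k (combSet ψ a) := by
  have hU := stable_of_span k ψ rfl fun h x hx =>
    Submodule.subset_span (hair_lie_mem_combSet (a := a) ψ h hx)
  induction A with
  | ih1 x =>
    cases x with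
    | hair h => simp at hA
    | edge e b =>
      rw [rootedEnds_edge, Multiset.singleton_inj] at hA
      subst hA
      exact Submodule.subset_span ⟨[], rfl⟩
  | ih2 A B ihA ihB =>
    rw [rootedEnds_mul, ← Multiset.cons_zero] at hA
    rw [ev_mul]
    rcases Multiset.add_eq_cons hA with ⟨s, h, h0⟩ | ⟨s, h, h0⟩
    · obtain ⟨h1, h2⟩ := add_eq_zero.1 h0
      rw [h1] at h
      rw [← lie_skew]
      exact Submodule.neg_mem _ (ev_lie_mem k ψ hU h2 (ihA h))
    · obtain ⟨h1, h2⟩ := add_eq_zero.1 h0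
      rw [h2] at h
      exact ev_lie_mem k ψ hU h1 (ihB h)

/-- The values of the rooted trees with two branches that have hairs along an edge. -/
def combSet₂ (a b : Fin n × Bool) : Set L :=
  {x | ∃ y ∈ combSet ψ a, ∃ z ∈ combSet ψ b, x = ⁅y, z⁆}

theorem hair_lie_mem_combSet₂ {a b : Fin n × Bool} {x : L} (h : H) (hx : x ∈ combSet₂ ψ a b) :
    ⁅ψ (.hair h), x⁆ ∈ Submodule.span k (combSet₂ ψ a b) := by
  obtain ⟨y, hy, z, hz, rfl⟩ := hx
  rw [leibniz_lie]
  exact Submodule.add_mem _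
    (Submodule.subset_span ⟨_, hair_lie_mem_combSet ψ h hy, _, hz, rfl⟩)
    (Submodule.subset_span ⟨_, hy, _, hair_lie_mem_combSet ψ h hz, rfl⟩)

/-- Hairs between the root and the vertex where the two ends separate are distributed to the two
branches by the Leibniz rule. -/
theorem ev_mem_span_two {a b : Fin n × Bool} {A : FreeMagma (Leaf H n)}
    (hA : rootedEnds A = {a, b}) : ev ψ A ∈ Submodule.span k (combSet₂ ψ a b) := by
  have subset_combSet₂ : ∀ {y z}, y ∈ combSet ψ a → z ∈ combSet ψ b →
      ⁅y, z⁆ ∈ Submodule.span k (combSet₂ ψ a b) :=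
    fun hy hz => Submodule.subset_span ⟨_, hy, _, hz, rfl⟩
  have hU := stable_of_span k ψ rfl fun h x hx => hair_lie_mem_combSet₂ k ψ (a := a) (b := b) h hx
  induction A with
  | ih1 x =>
    have := congrArg Multiset.card hA
    cases x <;> simp at this
  | ih2 A B ihA ihB =>
    rw [rootedEnds_mul, Multiset.insert_eq_cons] at hA
    rw [ev_mul]
    rcases Multiset.add_eq_cons hA with ⟨s, h, h0⟩ | ⟨s, h, h0⟩ <;>
    rw [← Multiset.cons_zero] at h0 <;>
    rcases Multiset.add_eq_cons h0 with ⟨s', h', h0'⟩ | ⟨s', h', h0'⟩ <;>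
    obtain ⟨h1, h2⟩ := add_eq_zero.1 h0' <;> subst_vars
    · rw [← lie_skew]
      exact Submodule.neg_mem _ (ev_lie_mem k ψ hU h2 (ihA h))
    · exact lie_mem_of_span k (fun y hy z hz => subset_combSet₂ hy hz)
        (ev_mem_span_one k ψ h) (ev_mem_span_one k ψ h')
    · rw [← lie_skew]
      exact Submodule.neg_mem _
        (lie_mem_of_span k (fun y hy z hz => subset_combSet₂ hy hz)
          (ev_mem_span_one k ψ h) (ev_mem_span_one k ψ h'))
    · exact ev_lie_mem k ψ hU h1 (ihB h)

/-- The values of the rooted trees with three branches `a`, `b`, `c` that have hairs along an edge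
and where `b` is not grouped with `c`. -/
def combSet₃ (a b c : Fin n × Bool) : Set L :=
  {x | ∃ y ∈ combSet ψ a, ∃ z ∈ combSet ψ b, ∃ t ∈ combSet ψ c,
    x = ⁅z, ⁅y, t⁆⁆ ∨ x = ⁅t, ⁅y, z⁆⁆}

theorem hair_lie_mem_combSet₃ {a b c : Fin n × Bool} {x : L} (h : H)
    (hx : x ∈ combSet₃ ψ a b c) :
    ⁅ψ (.hair h), x⁆ ∈ Submodule.span k (combSet₃ ψ a b c) := by
  obtain ⟨y, hy, z, hz, t, ht, rfl | rfl⟩ := hx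
  · rw [leibniz_lie, leibniz_lie (ψ (.hair h)) y, lie_add]
    refine Submodule.add_mem _ ?_ (Submodule.add_mem _ ?_ ?_) <;> refine Submodule.subset_span ?_
    · exact ⟨_, hy, _, hair_lie_mem_combSet ψ h hz, _, ht, Or.inl rfl⟩
    · exact ⟨_, hair_lie_mem_combSet ψ h hy, _, hz, _, ht, Or.inl rfl⟩
    · exact ⟨_, hy, _, hz, _, hair_lie_mem_combSet ψ h ht, Or.inl rfl⟩
  · rw [leibniz_lie, leibniz_lie (ψ (.hair h)) y, lie_add]
    refine Submodule.add_mem _ ?_ (Submodule.add_mem _ ?_ ?_) <;> refine Submodule.subset_span ?_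
    · exact ⟨_, hy, _, hz, _, hair_lie_mem_combSet ψ h ht, Or.inr rfl⟩
    · exact ⟨_, hair_lie_mem_combSet ψ h hy, _, hz, _, ht, Or.inr rfl⟩
    · exact ⟨_, hy, _, hair_lie_mem_combSet ψ h hz, _, ht, Or.inr rfl⟩

/-- Of the three ways to group three branches, Jacobi expresses the last through the first two. -/
theorem lie_mem_combSet₃ {a b c : Fin n × Bool} {y z t : L} (hy : y ∈ combSet ψ a)
    (hz : z ∈ combSet ψ b) (ht : t ∈ combSet ψ c) :
    ⁅z, ⁅y, t⁆⁆ ∈ Submodule.span k (combSet₃ ψ a b c) ∧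
      ⁅t, ⁅y, z⁆⁆ ∈ Submodule.span k (combSet₃ ψ a b c) ∧
      ⁅y, ⁅z, t⁆⁆ ∈ Submodule.span k (combSet₃ ψ a b c) := by
  have h1 : ⁅z, ⁅y, t⁆⁆ ∈ Submodule.span k (combSet₃ ψ a b c) :=
    Submodule.subset_span ⟨y, hy, z, hz, t, ht, Or.inl rfl⟩
  have h2 : ⁅t, ⁅y, z⁆⁆ ∈ Submodule.span k (combSet₃ ψ a b c) :=
    Submodule.subset_span ⟨y, hy, z, hz, t, ht, Or.inr rfl⟩
  refine ⟨h1, h2, ?_⟩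
  rw [leibniz_lie, ← lie_skew _ t]
  exact Submodule.add_mem _ (Submodule.neg_mem _ h2) h1

theorem ev_mem_span_three {a b c : Fin n × Bool} {A : FreeMagma (Leaf H n)}
    (hA : rootedEnds A = {a, b, c}) : ev ψ A ∈ Submodule.span k (combSet₃ ψ a b c) := by
  have hU := stable_of_span k ψ rfl fun h x hx =>
    hair_lie_mem_combSet₃ k ψ (a := a) (b := b) (c := c) h hx
  have hab : ∀ {x y}, x ∈ Submodule.span k (combSet₂ ψ a b) → y ∈ Submodule.span k (combSet ψ c) →
      ⁅y, x⁆ ∈ Submodule.span k (combSet₃ ψ a b c) := fun hx hy =>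
    lie_mem_of_span k (by
      rintro t ht _ ⟨y, hy, z, hz, rfl⟩
      exact (lie_mem_combSet₃ k ψ hy hz ht).2.1) hy hx
  have hac : ∀ {x y}, x ∈ Submodule.span k (combSet₂ ψ a c) → y ∈ Submodule.span k (combSet ψ b) →
      ⁅y, x⁆ ∈ Submodule.span k (combSet₃ ψ a b c) := fun hx hy =>
    lie_mem_of_span k (by
      rintro t ht _ ⟨y, hy, z, hz, rfl⟩
      exact (lie_mem_combSet₃ k ψ hy ht hz).1) hy hx
  have hbc : ∀ {x y}, x ∈ Submodule.span k (combSet₂ ψ b c) → y ∈ Submodule.span k (combSet ψ a) →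
      ⁅y, x⁆ ∈ Submodule.span k (combSet₃ ψ a b c) := fun hx hy =>
    lie_mem_of_span k (by
      rintro t ht _ ⟨y, hy, z, hz, rfl⟩
      exact (lie_mem_combSet₃ k ψ ht hy hz).2.2) hy hx
  induction A with
  | ih1 x =>
    have := congrArg Multiset.card hA
    cases x <;> simp at this
  | ih2 A B ihA ihB =>
    rw [rootedEnds_mul, Multiset.insert_eq_cons] at hA
    rw [ev_mul]
    rcases Multiset.add_eq_cons hA with ⟨s, h, h0⟩ | ⟨s, h, h0⟩ <;>
    rw [Multiset.insert_eq_cons] at h0 <;>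
    rcases Multiset.add_eq_cons h0 with ⟨s', h', h0'⟩ | ⟨s', h', h0'⟩ <;>
    rw [← Multiset.cons_zero] at h0' <;>
    rcases Multiset.add_eq_cons h0' with ⟨s'', h'', h0''⟩ | ⟨s'', h'', h0''⟩ <;>
    obtain ⟨h1, h2⟩ := add_eq_zero.1 h0'' <;> subst_vars
    · rw [← lie_skew]
      exact Submodule.neg_mem _ (ev_lie_mem k ψ hU h2 (ihA h))
    · rw [← lie_skew]
      exact Submodule.neg_mem _ (hab (ev_mem_span_two k ψ h) (ev_mem_span_one k ψ h''))
    · rw [← lie_skew]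
      exact Submodule.neg_mem _ (hac (ev_mem_span_two k ψ h) (ev_mem_span_one k ψ h'))
    · exact hbc (ev_mem_span_two k ψ h') (ev_mem_span_one k ψ h)
    · rw [← lie_skew]
      exact Submodule.neg_mem _ (hbc (ev_mem_span_two k ψ h') (ev_mem_span_one k ψ h))
    · exact hac (ev_mem_span_two k ψ h) (ev_mem_span_one k ψ h')
    · exact hab (ev_mem_span_two k ψ h) (ev_mem_span_one k ψ h'')
    · exact ev_lie_mem k ψ hU h1 (ihB h)

end Span

namespace TreeForm

section

variable (k : Type u) [Field k] [CharZero k] {H : Type v} {n : ℕ} {W : Type w} [AddCommGroup W]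
  [Module k W]

/-- The mark moves to the edge at the chosen end. Having that end as root leaves no hairs on its
edge, so only the remaining ends carry combs. -/
theorem exists_reroot {a : Fin n × Bool} {A : FreeMagma (Leaf H n)} (ha : a ∈ rootedEnds A)
    (C : FreeMagma (Leaf H n)) : ∃ D, a ::ₘ rootedEnds D = rootedEnds A + rootedEnds C ∧
      ∀ φ : TreeForm (Leaf H n) W, φ.toFun A C = φ.toFun (.of (.edge a.1 a.2)) D := by
  induction A generalizing C with
  | ih1 x =>
    cases x with
    | hair h => simp at ha
    | edge e b =>
      rw [rootedEnds_edge, Multiset.mem_singleton] at ha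
      subst ha
      exact ⟨C, by simp, fun φ => rfl⟩
  | ih2 A B ihA ihB =>
    rw [rootedEnds_mul, Multiset.mem_add] at ha
    rcases ha with ha | ha
    · obtain ⟨D, h1, h2⟩ := ihA ha (B * C)
      exact ⟨D, by rw [h1, rootedEnds_mul, rootedEnds_mul, add_assoc],
        fun φ => by rw [φ.move, h2]⟩
    · obtain ⟨D, h1, h2⟩ := ihB ha (C * A)
      refine ⟨D, ?_, fun φ => by rw [φ.symm, ← φ.move, φ.symm, h2]⟩
      rw [h1, rootedEnds_mul, rootedEnds_mul]
      abel

theorem exists_reroot' {a : Fin n × Bool} {A C : FreeMagma (Leaf H n)}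
    (ha : a ∈ rootedEnds A + rootedEnds C) :
    ∃ D, a ::ₘ rootedEnds D = rootedEnds A + rootedEnds C ∧
      ∀ φ : TreeForm (Leaf H n) W, φ.toFun A C = φ.toFun (.of (.edge a.1 a.2)) D := by
  rcases Multiset.mem_add.1 ha with ha | ha
  · exact exists_reroot (W := W) ha C
  · obtain ⟨D, h1, h2⟩ := exists_reroot (W := W) ha A
    exact ⟨D, by rw [h1, add_comm], fun φ => by rw [φ.symm, h2]⟩

theorem mem_of_three (φ : TreeForm (Leaf H n) W) (S : Submodule k W) (a b c : Fin n × Bool)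
    (h : ∀ v w, φ.toFun (.of (.edge a.1 a.2))
      (comb v (.edge b.1 b.2) * comb w (.edge c.1 c.2)) ∈ S)
    {A C : FreeMagma (Leaf H n)} (hA : rootedEnds A + rootedEnds C = {a, b, c}) :
    φ.toFun A C ∈ S := by
  obtain ⟨D, h1, h2⟩ := exists_reroot' (W := W) (a := a) (A := A) (C := C) (by rw [hA]; simp)
  rw [hA, Multiset.insert_eq_cons, Multiset.cons_inj_right] at h1
  rw [h2, toFun_eq k]
  have hD := ev_mem_span_two k (leaf k φ) h1
  refine (Submodule.span_le
    (p := S.comap (form k φ (ev (leaf k φ) (.of (.edge a.1 a.2)))))).2 ?_ hD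
  rintro _ ⟨_, ⟨v, rfl⟩, _, ⟨w, rfl⟩, rfl⟩
  have := h v w
  rwa [toFun_eq k] at this

/-- Rooting at `a` leaves a tree with three ends, and `combSet₃` avoids the grouping of `c` with
`d`; thus the H-shaped trees that pair `a` with `b` need no check. -/
theorem mem_of_four (φ : TreeForm (Leaf H n) W) (S : Submodule k W) (a b c d : Fin n × Bool)
    (h : ∀ u v w, φ.toFun (.of (.edge a.1 a.2) * comb v (.edge c.1 c.2))
      (comb u (.edge b.1 b.2) * comb w (.edge d.1 d.2)) ∈ S)
    (h' : ∀ u v w, φ.toFun (.of (.edge a.1 a.2) * comb w (.edge d.1 d.2))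
      (comb u (.edge b.1 b.2) * comb v (.edge c.1 c.2)) ∈ S)
    {A C : FreeMagma (Leaf H n)} (hA : rootedEnds A + rootedEnds C = {a, b, c, d}) :
    φ.toFun A C ∈ S := by
  obtain ⟨D, h1, h2⟩ := exists_reroot' (W := W) (a := a) (A := A) (C := C) (by rw [hA]; simp)
  rw [hA, Multiset.insert_eq_cons, Multiset.cons_inj_right] at h1
  rw [h2, toFun_eq k]
  have hD := ev_mem_span_three k (leaf k φ) h1
  refine (Submodule.span_le
    (p := S.comap (form k φ (ev (leaf k φ) (.of (.edge a.1 a.2)))))).2 ?_ hD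
  rintro _ ⟨_, ⟨u, rfl⟩, _, ⟨v, rfl⟩, _, ⟨w, rfl⟩, rfl | rfl⟩
  · have := h u v w
    rwa [φ.move, toFun_eq k] at this
  · have := h' u v w
    rwa [φ.move, toFun_eq k] at this

end

end TreeForm

/-! ### Forms linear in the hairs and compatible with the external edges -/

/-- A tree form on trees with hairs and ends of external edges, linear in the labels of the
hairs. -/
structure HairForm (k : Type u) [Field k] (H : Type v) [AddCommGroup H] [Module k H] (n : ℕ)
    (W : Type w) [AddCommGroup W] [Module k W] extends TreeForm (Leaf H n) W where
  hair_add : ∀ h h' B, toFun (.of (.hair (h + h'))) B =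
    toFun (.of (.hair h)) B + toFun (.of (.hair h')) B
  hair_smul : ∀ (c : k) h B, toFun (.of (.hair (c • h))) B = c • toFun (.of (.hair h)) B

/-- A tree form with two external edges that does not depend on their numbering and changes the sign
when an edge is reversed. -/
structure SymForm (k : Type u) [Field k] (H : Type v) [AddCommGroup H] [Module k H]
    (W : Type w) [AddCommGroup W] [Module k W] extends HairForm k H 2 W where
  renumber : ∀ π A B, toFun (FreeMagma.map (Leaf.renumber π) A)
    (FreeMagma.map (Leaf.renumber π) B) = toFun A B
  reverse : ∀ e A B, toFun (FreeMagma.map (Leaf.reverse e) A)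
    (FreeMagma.map (Leaf.reverse e) B) = -toFun A B

section HairMap

variable {k : Type u} [Field k] {H : Type v} [AddCommGroup H] [Module k H] {n : ℕ}
  {W : Type w} [AddCommGroup W] [Module k W]

variable [CharZero k]

/-- The form is nondegenerate by construction and rooted trees span the algebra. -/
theorem TreeForm.alg_ext {X : Type v} (φ : TreeForm X W) {a b : φ.Alg k}
    (h : ∀ C, form k φ a (ev (leaf k φ) C) = form k φ b (ev (leaf k φ) C)) : a = b := by
  rw [← sub_eq_zero]
  apply form_eq_zero
  intro c
  obtain ⟨c, rfl⟩ := cls_surjective k φ c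
  induction c using Finsupp.induction_linear with
  | zero => simp
  | add f g hf hg => rw [map_add, map_add, hf, hg, add_zero]
  | single A s =>
    rw [← mul_one s, ← smul_eq_mul, ← Finsupp.smul_single, map_smul, map_smul, ← ev_leaf, map_sub,
      LinearMap.sub_apply, h, sub_self, smul_zero]

/-- The Lie algebra of a form. -/
abbrev HairForm.L (φ : HairForm k H n W) : Type _ := φ.toTreeForm.Alg k

/-- The element of the Lie algebra given by a hair. -/
noncomputable def HairForm.hair (φ : HairForm k H n W) : H →ₗ[k] φ.L where
  toFun h := φ.leaf k (.hair h)
  map_add' h h' := by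
    apply φ.alg_ext
    intro C
    have := φ.hair_add h h' C
    simpa only [φ.toFun_eq k, ev_of, map_add, LinearMap.add_apply] using this
  map_smul' c h := by
    apply φ.alg_ext
    intro C
    have := φ.hair_smul c h C
    simpa only [φ.toFun_eq k, ev_of, map_smul, LinearMap.smul_apply, RingHom.id_apply] using this

/-- The element of the Lie algebra given by an end of an external edge. -/
noncomputable def HairForm.endp (φ : HairForm k H n W) (e : Fin n) (b : Bool) : φ.L :=
  φ.leaf k (.edge e b)

end HairMap

/-! ### Contraction of an external edge in Lie algebra terms -/

section Placement

variable {H : Type v}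

/-- The renumbering of the edges `f` and `g` by `0` and `1`, with reversals. -/
def place {n : ℕ} (f : Fin n) (b : Bool) (c : Bool) : Leaf H n → Leaf H 2
  | .hair h => .hair h
  | .edge i β => if i = f then .edge 0 (xor β b) else .edge 1 (xor β c)

/-- The sign of an end of an external edge: `1` for the tail and `-1` for the head. -/
def sgn (b : Bool) : ℤ := if b then -1 else 1

/-- The renumbering of the edges other than `e`. -/
def dropLeaf [Zero H] {n : ℕ} (e : Fin (n + 1)) : Leaf H (n + 1) → Leaf H n
  | .hair h => .hair h
  -- The value at `e` itself is a dummy that makes the map total; `dropEdge_eq` applies it only to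
  -- trees without ends of `e`.
  | .edge f b => (finSuccEquiv' e f).elim (.hair 0) fun g => .edge g b

theorem dropEdge_eq [Zero H] {n : ℕ} {e : Fin (n + 1)} {A : FreeMagma (Leaf H (n + 1))}
    (hA : ∀ b, Leaf.edge e b ∉ rootedLeaves A) :
    dropEdge e A = some (FreeMagma.map (dropLeaf e) A) := by
  induction A with
  | ih1 x =>
    cases x with
    | hair h => rfl
    | edge f b =>
      have hf : f ≠ e := by
        rintro rfl
        exact hA b (by simp)
      obtain ⟨g, rfl⟩ := Fin.exists_succAbove_eq hf
      simp [dropEdge, dropLeaf]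
  | ih2 A B ihA ihB =>
    change Option.map₂ (· * ·) (dropEdge e A) (dropEdge e B) = _
    rw [ihA fun b hb => hA b (by simp [hb]), ihB fun b hb => hA b (by simp [hb])]
    simp

theorem join_eq_none_left {n : ℕ} {e : Fin (n + 1)} {b : Bool} {t₁ t₂ : Tree (Leaf H (n + 1))}
    (h : Leaf.edge e b ∉ t₁.leaves) : join e b t₁ t₂ = none := by
  rw [join, cut_eq_none h]
  rfl

theorem join_eq_none_right {n : ℕ} {e : Fin (n + 1)} {b : Bool} {t₁ t₂ : Tree (Leaf H (n + 1))}
    (h : Leaf.edge e (!b) ∉ t₂.leaves) : join e b t₁ t₂ = none := by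
  rw [join, cut_eq_none h]
  simp

/-- The ends of external edges on a tree. -/
def Tree.ends {n : ℕ} (t : Tree (Leaf H n)) : Multiset (Fin n × Bool) :=
  rootedEnds t.1 + rootedEnds t.2

theorem mem_ends {n : ℕ} {t : Tree (Leaf H n)} {e : Fin n} {b : Bool} :
    (e, b) ∈ t.ends ↔ Leaf.edge e b ∈ t.leaves := by
  rw [Tree.ends, Tree.leaves, Multiset.mem_add, Multiset.mem_add, mem_rootedEnds, mem_rootedEnds]

open Classical in
theorem count_ends {n : ℕ} {t : Tree (Leaf H n)} {e : Fin n} {b : Bool} :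
    t.leaves.count (.edge e b) = t.ends.count (e, b) := by
  have : t.ends = t.leaves.filterMap Leaf.end? := by
    rw [Tree.ends, Tree.leaves, Multiset.filterMap_add]
    rfl
  rw [this]
  induction t.leaves using Multiset.induction_on with
  | empty => rfl
  | cons x m ih =>
    cases x with
    | hair h =>
      rw [Multiset.filterMap_cons_none _ _ (by rfl), ← ih, Multiset.count_cons_of_ne (by simp)]
    | edge f c =>
      rw [Multiset.filterMap_cons_some _ _ _ (by rfl), Multiset.count_cons, Multiset.count_cons, ih]
      simp

theorem cut_tripod_fst {X : Type*} {x y z : X} : (tripod x y z).cut x = some (.of y * .of z) := by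
  simp [Tree.cut, tripod, cutAux]

theorem cut_tripod_snd {X : Type*} {x y z : X} (hxy : x ≠ y) :
    (tripod x y z).cut y = some (.of z * .of x) := by
  simp only [Tree.cut, tripod]
  rw [cutAux, if_neg hxy]
  change (none <|> (cutAux y (.of y) (.of z * .of x) <|> cutAux y (.of z) (.of x * .of y))) = _
  simp [cutAux]

theorem cut_tripod_thd {X : Type*} {x y z : X} (hxz : x ≠ z) (hyz : y ≠ z) :
    (tripod x y z).cut z = some (.of x * .of y) := by
  simp only [Tree.cut, tripod]
  rw [cutAux, if_neg hxz]
  change (none <|> (cutAux z (.of y) (.of z * .of x) <|> cutAux z (.of z) (.of x * .of y))) = _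
  simp [cutAux, hyz]

end Placement

section Boundary

variable {k : Type u} [Field k] {H : Type v} [AddCommGroup H] [Module k H]
  {W : Type w} [AddCommGroup W] [Module k W]

theorem SymForm.revIf (φ : SymForm k H W) (b : Bool) (e : Fin 2) (A B : FreeMagma (Leaf H 2)) :
    φ.toFun (FreeMagma.map (if b then Leaf.reverse e else id) A)
      (FreeMagma.map (if b then Leaf.reverse e else id) B) = sgn b • φ.toFun A B := by
  have hid : ∀ C : FreeMagma (Leaf H 2), FreeMagma.map id C = C := by
    intro C
    induction C with
    | ih1 x => rfl
    | ih2 A B hA hB => rw [map_mul, hA, hB]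
  cases b
  · simp [hid, sgn]
  · simp [sgn, φ.reverse]

theorem map_map {X Y Z : Type*} (f : X → Y) (g : Y → Z) (A : FreeMagma X) :
    FreeMagma.map g (FreeMagma.map f A) = FreeMagma.map (g ∘ f) A := by
  induction A with
  | ih1 x => rfl
  | ih2 A B hA hB => rw [map_mul, map_mul, map_mul, hA, hB]

/-- A renumbering puts `f` first, then `b` and `c` decide which edges are reversed. Each reversal
costs a sign. -/
theorem SymForm.exists_normalize (φ : SymForm k H W) {f g : Fin 2} (hfg : f ≠ g) (b c : Bool) :
    ∃ σ : Leaf H 2 → Leaf H 2, (∀ h, σ (.hair h) = .hair h) ∧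
      (∀ β, σ (.edge f β) = .edge 0 (xor β b)) ∧ (∀ β, σ (.edge g β) = .edge 1 (xor β c)) ∧
      ∀ A B, φ.toFun A B =
        (sgn b * sgn c) • φ.toFun (FreeMagma.map σ A) (FreeMagma.map σ B) := by
  have hπ : ∃ π : Equiv.Perm (Fin 2), π f = 0 ∧ π g = 1 := by
    revert f g
    decide
  obtain ⟨π, hf, hg⟩ := hπ
  refine ⟨(if c then Leaf.reverse 1 else id) ∘ (if b then Leaf.reverse 0 else id) ∘
    Leaf.renumber π, ?_, ?_, ?_, ?_⟩
  · intro h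
    cases b <;> cases c <;> rfl
  · intro β
    cases b <;> cases c <;> simp [Leaf.renumber, Leaf.reverse, hf]
  · intro β
    cases b <;> cases c <;> simp [Leaf.renumber, Leaf.reverse, hg]
  · intro A B
    rw [← map_map, ← map_map, ← map_map, ← map_map, φ.revIf, φ.revIf, φ.renumber, smul_smul,
      smul_smul]
    have : sgn b * sgn c * (sgn c * sgn b) = 1 := by cases b <;> cases c <;> rfl
    rw [mul_assoc] at this
    simp only [mul_assoc, this, one_smul]

variable [CharZero k]

theorem fin_three_cases : ∀ {e f g i : Fin 3}, e ≠ f → e ≠ g → f ≠ g → i ≠ e → i = f ∨ i = g := by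
  decide

/-- Contractions of different edges leave differently numbered edges behind. Placing `f` at 0 and
`g` at 1, with the ends `b` and `c` as tails, brings all terms of a boundary into one Lie algebra.
-/
theorem SymForm.toFun_dropLeaf (φ : SymForm k H W) {e f g : Fin 3} (hef : e ≠ f) (heg : e ≠ g)
    (hfg : f ≠ g) (b c : Bool) {A B : FreeMagma (Leaf H 3)}
    (hA : ∀ b, Leaf.edge e b ∉ rootedLeaves A) (hB : ∀ b, Leaf.edge e b ∉ rootedLeaves B) :
    φ.toFun (FreeMagma.map (dropLeaf e) A) (FreeMagma.map (dropLeaf e) B) =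
      (sgn b * sgn c) •
        φ.form k (ev (φ.leaf k ∘ place f b c) A) (ev (φ.leaf k ∘ place f b c) B) := by
  obtain ⟨f', hf⟩ := Fin.exists_succAbove_eq hef.symm
  obtain ⟨g', hg⟩ := Fin.exists_succAbove_eq heg.symm
  have hfg' : f' ≠ g' := by
    rintro rfl
    exact hfg (hf.symm.trans hg)
  obtain ⟨σ, h1, h2, h3, h4⟩ := φ.exists_normalize hfg' b c
  have key : ∀ C : FreeMagma (Leaf H 3), (∀ b, Leaf.edge e b ∉ rootedLeaves C) →
      ev (φ.leaf k) (FreeMagma.map σ (FreeMagma.map (dropLeaf e) C)) =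
        ev (φ.leaf k ∘ place f b c) C := by
    intro C hC
    rw [map_map, ev_map]
    apply ev_congr
    intro x hx
    simp only [Function.comp_apply]
    congr 1
    cases x with
    | hair h => exact h1 h
    | edge i β =>
      have hi : i ≠ e := by
        rintro rfl
        exact hC β hx
      rcases fin_three_cases hef heg hfg hi with rfl | rfl
      · simp [dropLeaf, ← hf, place, h2]
      · simp [dropLeaf, ← hg, place, h3]
        simp [hg, hfg.symm]
  rw [h4, φ.toFun_eq k, key A hA, key B hB]

/-- The boundary of a hairy graph with two trees, with values in the target of a tree form. -/
noncomputable def TreeForm.boundary {n : ℕ} (φ : TreeForm (Leaf H n) W)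
    (t₁ t₂ : Tree (Leaf H (n + 1))) : W :=
  ∑ e : Fin (n + 1), ((join e false t₁ t₂).elim 0 (fun t => φ.toFun t.1 t.2) -
    (join e true t₁ t₂).elim 0 (fun t => φ.toFun t.1 t.2))

/-- Only the direction in which `e` actually runs contributes; its sign in the boundary is `sgn a`.
-/
theorem SymForm.boundary_term (φ : SymForm k H W) {e f g : Fin 3} (hef : e ≠ f) (heg : e ≠ g)
    (hfg : f ≠ g) (a b c : Bool) {t₁ t₂ : Tree (Leaf H 3)} {A : FreeMagma (Leaf H 3)}
    (hA : t₁.cut (.edge e a) = some A) (hAe : ∀ b, Leaf.edge e b ∉ rootedLeaves A)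
    (h₁ : (e, !a) ∉ t₁.ends) (h₂ : (e, a) ∉ t₂.ends) (h₂' : t₂.ends.count (e, !a) = 1) :
    (join e false t₁ t₂).elim 0 (fun t => φ.toFun t.1 t.2) -
        (join e true t₁ t₂).elim 0 (fun t => φ.toFun t.1 t.2) =
      (sgn a * (sgn b * sgn c)) • φ.form k (ev (φ.leaf k ∘ place f b c) A)
        (root k (φ.leaf k ∘ place f b c) (.edge e !a) t₂.1 t₂.2) := by
  classical
  rw [← count_ends] at h₂'
  obtain ⟨B, hB, hBl⟩ := exists_cut h₂'
  have hBe : ∀ b, Leaf.edge e b ∉ rootedLeaves B := by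
    intro b hb
    rcases eq_or_ne b a with rfl | hne
    · exact h₂ (mem_ends.2 (by rw [← hBl]; exact Multiset.mem_cons_of_mem hb))
    · obtain rfl : b = !a := by cases a <;> cases b <;> simp_all
      rw [← hBl, Multiset.count_cons_self] at h₂'
      exact absurd (Multiset.count_pos.2 hb) (by omega)
  have hja : join e a t₁ t₂ =
      some (FreeMagma.map (dropLeaf e) A, FreeMagma.map (dropLeaf e) B) := by
    rw [join, hA, hB, Option.bind_some, Option.bind_some, dropEdge_eq hAe, dropEdge_eq hBe]
    rfl
  have hjn : join e (!a) t₁ t₂ = none := join_eq_none_left (by rwa [← mem_ends])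
  have key := φ.toFun_dropLeaf hef heg hfg b c hAe hBe
  rw [ev_cut k _ h₂' hB] at key
  cases a
  · rw [Bool.not_false] at hjn
    rw [hja, hjn, mul_smul, ← key]
    simp [sgn]
  · rw [Bool.not_true] at hjn
    rw [hja, hjn, mul_smul, ← key]
    simp [sgn]

theorem sum_fin_three {M : Type*} [AddCommMonoid M] (F : Fin 3 → M) {e f g : Fin 3} (hef : e ≠ f)
    (heg : e ≠ g) (hfg : f ≠ g) : ∑ i, F i = F e + F f + F g := by
  have : (Finset.univ : Finset (Fin 3)) = {e, f, g} := by
    clear F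
    revert e f g
    decide
  rw [this, Finset.sum_insert (by simp [hef, heg]), Finset.sum_insert (by simp [hfg]),
    Finset.sum_singleton, add_assoc]

/-- The three contractions differ by rotations of the tripod, so they carry the same total sign and
the same left factor: the tripod minus a leg is a bracket of two tails. -/
theorem SymForm.boundary_three (φ : SymForm k H W) {e f g : Fin 3} (hef : e ≠ f) (heg : e ≠ g)
    (hfg : f ≠ g) (a b c : Bool) {t : Tree (Leaf H 3)}
    (ht : t.ends = {(e, !a), (f, !b), (g, !c)}) :
    φ.boundary (tripod (.edge e a) (.edge f b) (.edge g c)) t =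
      (sgn a * (sgn b * sgn c)) • (φ.form k ⁅φ.endp 0 false, φ.endp 1 false⁆
          (root k (φ.leaf k ∘ place f b c) (.edge e !a) t.1 t.2) +
        φ.form k ⁅φ.endp 0 false, φ.endp 1 false⁆
          (root k (φ.leaf k ∘ place g c a) (.edge f !b) t.1 t.2) +
        φ.form k ⁅φ.endp 0 false, φ.endp 1 false⁆
          (root k (φ.leaf k ∘ place e a b) (.edge g !c) t.1 t.2)) := by
  rw [TreeForm.boundary, sum_fin_three _ hef heg hfg,
    φ.boundary_term hef heg hfg a b c cut_tripod_fst (by simp [hef, heg])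
      (by simp [tripod, Tree.ends, hef, heg]) (by simp [ht, hef, heg])
      (by simp [ht, hef, heg]),
    φ.boundary_term hfg hef.symm heg.symm b c a (cut_tripod_snd (by simp [hef]))
      (by simp [hef.symm, hfg]) (by simp [tripod, Tree.ends, hef.symm, hfg])
      (by simp [ht, hef.symm, hfg])
      (by simp [ht, hef.symm, hfg]),
    φ.boundary_term heg.symm hfg.symm hef c a b (cut_tripod_thd (by simp [heg]) (by simp [hfg]))
      (by simp [heg.symm, hfg.symm]) (by simp [tripod, Tree.ends, heg.symm, hfg.symm])
      (by simp [ht, heg.symm, hfg.symm])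
      (by simp [ht, heg.symm, hfg.symm])]
  rw [show sgn b * (sgn c * sgn a) = sgn a * (sgn b * sgn c) by ring,
    show sgn c * (sgn a * sgn b) = sgn a * (sgn b * sgn c) by ring, ← smul_add, ← smul_add]
  simp [place, hef.symm, heg, hfg.symm, HairForm.endp]

theorem SymForm.boundary_two (φ : SymForm k H W) {e f g : Fin 3} (hef : e ≠ f) (heg : e ≠ g)
    (hfg : f ≠ g) (a b : Bool) (h : H) {t : Tree (Leaf H 3)}
    (ht : t.ends = {(e, !a), (f, !b), (g, false), (g, true)}) :
    φ.boundary (tripod (.edge e a) (.edge f b) (.hair h)) t =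
      (sgn a * sgn b) • (φ.form k ⁅φ.endp 0 false, φ.hair h⁆
          (root k (φ.leaf k ∘ place f b false) (.edge e !a) t.1 t.2) +
        φ.form k ⁅φ.hair h, φ.endp 0 false⁆
          (root k (φ.leaf k ∘ place e a false) (.edge f !b) t.1 t.2)) := by
  rw [TreeForm.boundary, sum_fin_three _ hef heg hfg,
    φ.boundary_term hef heg hfg a b false cut_tripod_fst (by simp [hef])
      (by simp [tripod, Tree.ends, hef]) (by simp [ht, hef, heg])
      (by simp [ht, hef, heg]),
    φ.boundary_term hef.symm hfg heg b a false (cut_tripod_snd (by simp [hef]))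
      (by simp [hef.symm]) (by simp [tripod, Tree.ends, hef.symm])
      (by simp [ht, hef.symm, hfg])
      (by simp [ht, hef.symm, hfg]),
    join_eq_none_left (by simp [← mem_ends, tripod, Tree.ends, heg.symm, hfg.symm]),
    join_eq_none_left (by simp [← mem_ends, tripod, Tree.ends, heg.symm, hfg.symm])]
  have : sgn false = 1 := rfl
  rw [this, mul_one, mul_one, mul_comm (sgn b)]
  simp [place, HairForm.endp, HairForm.hair]

theorem SymForm.boundary_loop (φ : SymForm k H W) {e f g : Fin 3} (hef : e ≠ f) (heg : e ≠ g)
    (hfg : f ≠ g) (a b : Bool) {t : Tree (Leaf H 3)}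
    (ht : t.ends = {(e, !a), (g, false), (g, true)}) :
    φ.boundary (tripod (.edge e a) (.edge f b) (.edge f !b)) t =
      (sgn a * sgn b) • φ.form k ⁅φ.endp 0 false, φ.endp 0 true⁆
          (root k (φ.leaf k ∘ place f b false) (.edge e !a) t.1 t.2) := by
  rw [TreeForm.boundary, sum_fin_three _ hef heg hfg,
    φ.boundary_term hef heg hfg a b false cut_tripod_fst (by simp [hef])
      (by simp [tripod, Tree.ends, hef]) (by simp [ht, heg])
      (by simp [ht, heg]),
    join_eq_none_right (e := f) (by simp [← mem_ends, ht, hef.symm, hfg]),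
    join_eq_none_right (e := f) (by simp [← mem_ends, ht, hef.symm, hfg]),
    join_eq_none_left (e := g) (by simp [← mem_ends, tripod, Tree.ends, heg.symm, hfg.symm]),
    join_eq_none_left (e := g) (by simp [← mem_ends, tripod, Tree.ends, heg.symm, hfg.symm])]
  have : sgn false = 1 := rfl
  rw [this, mul_one]
  simp [place, HairForm.endp]

end Boundary

/-! ### Theta graphs and the boundaries of tripods joined to combs -/

theorem map_comb {H : Type v} {n : ℕ} (σ : Leaf H n → Leaf H n) (hσ : ∀ h, σ (.hair h) = .hair h)
    (v : List H) (x : Leaf H n) : FreeMagma.map σ (comb v x) = comb v (σ x) := by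
  induction v with
  | nil => rfl
  | cons h v ih => rw [comb_cons, map_mul, ih, FreeMagma.map_of, hσ, comb_cons]

theorem rootAux_comb_ne (k : Type u) [Field k] {H : Type v} {L : Type*} [LieRing L] [LieAlgebra k L]
    {n : ℕ} (ψ : Leaf H n → L) (v : List H) {x y : Leaf H n} (hy : ∀ h, x ≠ .hair h)
    (hxy : y ≠ x) (c : L) : rootAux k ψ x (comb v y) c = 0 := by
  induction v generalizing c with
  | nil => exact rootAux_of_ne k ψ hxy c
  | cons h v ih =>
    rw [comb_cons, rootAux_mul, rootAux_of_ne k ψ (hy h).symm, ih, zero_add]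

section Theta

variable {k : Type u} [Field k] {H : Type v} [AddCommGroup H] [Module k H]
  {W : Type w} [AddCommGroup W] [Module k W]

theorem tensor_word_ext {A B : TensorAlgebra k H ⊗[k] TensorAlgebra k H →ₗ[k] W}
    (h : ∀ u v : List H, A (word k u ⊗ₜ word k v) = B (word k u ⊗ₜ word k v)) : A = B := by
  refine TensorProduct.ext' fun x y => ?_
  induction x using word_induction with
  | add x y hx hy => simp only [TensorProduct.add_tmul, map_add, hx, hy]
  | smul c x hx => simp only [← TensorProduct.smul_tmul', map_smul, hx]
  | wd u =>
    induction y using word_induction with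
    | add x y hx hy => simp only [TensorProduct.tmul_add, map_add, hx, hy]
    | smul c x hx => simp only [TensorProduct.tmul_smul, map_smul, hx]
    | wd v => exact h u v

theorem tensor_word_ext₂ {A B : TensorAlgebra k H ⊗[k] TensorAlgebra k H →ₗ[k]
      TensorAlgebra k H ⊗[k] TensorAlgebra k H →ₗ[k] W}
    (h : ∀ u v s t : List H, A (word k u ⊗ₜ word k v) (word k s ⊗ₜ word k t) =
      B (word k u ⊗ₜ word k v) (word k s ⊗ₜ word k t)) : A = B :=
  tensor_word_ext fun u v => tensor_word_ext fun s t => h u v s t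

variable [CharZero k]

namespace HairForm

variable (φ : HairForm k H 2 W)

/-- The values of the trees of type `H` with the given ends of external edges, with hairs along the
edges. -/
noncomputable def pairing (x y z t : Fin 2 × Bool) :
    TensorAlgebra k H ⊗[k] TensorAlgebra k H →ₗ[k]
      TensorAlgebra k H ⊗[k] TensorAlgebra k H →ₗ[k] W :=
  (φ.form k).compl₁₂ (actLie φ.hair (φ.endp x.1 x.2) (φ.endp y.1 y.2))
    (actLie φ.hair (φ.endp z.1 z.2) (φ.endp t.1 t.2))

theorem pairing_tmul (x y z t : Fin 2 × Bool) (α β γ δ : TensorAlgebra k H) :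
    φ.pairing x y z t (α ⊗ₜ β) (γ ⊗ₜ δ) =
      φ.form k ⁅act φ.hair α (φ.endp x.1 x.2), act φ.hair β (φ.endp y.1 y.2)⁆
        ⁅act φ.hair γ (φ.endp z.1 z.2), act φ.hair δ (φ.endp t.1 t.2)⁆ := rfl

theorem toFun_comb (x y z t : Fin 2 × Bool) (α β γ δ : List H) :
    φ.toFun (comb α (.edge x.1 x.2) * comb β (.edge y.1 y.2))
      (comb γ (.edge z.1 z.2) * comb δ (.edge t.1 t.2)) =
      φ.pairing x y z t (word k α ⊗ₜ word k β) (word k γ ⊗ₜ word k δ) := by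
  rw [φ.toFun_eq k, pairing_tmul]
  simp only [ev_mul]
  rw [ev_comb φ.hair _ fun h => rfl, ev_comb φ.hair _ fun h => rfl, ev_comb φ.hair _ fun h => rfl,
    ev_comb φ.hair _ fun h => rfl]
  rfl

theorem form_act (x : TensorAlgebra k H) (a b : φ.L) :
    φ.form k (act φ.hair x a) b = φ.form k a (act φ.hair (rho k H x) b) :=
  act_form φ.hair (φ.form k) (φ.form_lie k) x a b

/-- Invariance of the form with respect to a hair. -/
theorem pairing_invariant (x y z t : Fin 2 × Bool) (h : H) (p q) :
    φ.pairing x y z t ((TensorAlgebra.ι k h ⊗ₜ 1 + 1 ⊗ₜ TensorAlgebra.ι k h) * p) q =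
      -φ.pairing x y z t p ((TensorAlgebra.ι k h ⊗ₜ 1 + 1 ⊗ₜ TensorAlgebra.ι k h) * q) := by
  have key : ∀ (a b : φ.L) (p : TensorAlgebra k H ⊗[k] TensorAlgebra k H),
      actLie φ.hair a b ((TensorAlgebra.ι k h ⊗ₜ 1 + 1 ⊗ₜ TensorAlgebra.ι k h) * p) =
        ⁅φ.hair h, actLie φ.hair a b p⁆ := by
    intro a b p
    induction p using TensorProduct.induction_on with
    | zero => simp
    | add p q hp hq => simp only [mul_add, map_add, hp, hq, lie_add]
    | tmul p q => simp [add_mul]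
  simp only [pairing, LinearMap.compl₁₂_apply, key]
  rw [← lie_skew, map_neg, LinearMap.neg_apply, φ.form_lie k]

theorem pairing_flip (x y z t : Fin 2 × Bool) (p q) :
    φ.pairing x y z t p q = φ.pairing z t x y q p := by
  simp only [pairing, LinearMap.compl₁₂_apply]
  rw [φ.form_symm k]

/-- The values of the theta graphs. -/
noncomputable abbrev theta := φ.pairing (0, false) (1, false) (0, true) (1, true)

end HairForm

namespace SymForm

variable (φ : SymForm k H W)

/-- Reversing edge 1 exchanges its ends: the crossed H-shaped tree is minus a theta graph. -/
theorem pairing_reverse_one :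
    φ.pairing (0, false) (1, true) (0, true) (1, false) = -φ.theta := by
  refine tensor_word_ext₂ fun u v s t => ?_
  simp only [HairForm.theta, LinearMap.neg_apply, ← HairForm.toFun_comb, ← φ.reverse 1]
  simp only [map_mul, map_comb (Leaf.reverse (1 : Fin 2)) (fun h => rfl), Leaf.reverse]
  rfl

theorem pairing_reverse_zero :
    φ.pairing (0, true) (1, false) (0, false) (1, true) = -φ.theta := by
  refine tensor_word_ext₂ fun u v s t => ?_
  simp only [HairForm.theta, LinearMap.neg_apply, ← HairForm.toFun_comb, ← φ.reverse 0]
  simp only [map_mul, map_comb (Leaf.reverse (0 : Fin 2)) (fun h => rfl), Leaf.reverse]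
  rfl

/-- Reversal of both edges exchanges the two trivalent vertices of the core, and the two signs
cancel. -/
theorem theta_flip (p q) : φ.theta p q = φ.theta q p := by
  have : φ.pairing (0, true) (1, true) (0, false) (1, false) = φ.theta := by
    rw [← neg_neg φ.theta, ← pairing_reverse_zero]
    refine tensor_word_ext₂ fun u v s t => ?_
    simp only [LinearMap.neg_apply, ← HairForm.toFun_comb, ← φ.reverse 1]
    simp only [map_mul, map_comb (Leaf.reverse (1 : Fin 2)) (fun h => rfl), Leaf.reverse]
    rfl
  rw [φ.pairing_flip, this]

/-- Exchanging the numbers of the edges transposes the branches at both vertices, and the two AS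
signs cancel. -/
theorem theta_swap (α β γ δ) : φ.theta (β ⊗ₜ α) (δ ⊗ₜ γ) = φ.theta (α ⊗ₜ β) (γ ⊗ₜ δ) := by
  have : φ.pairing (1, false) (0, false) (1, true) (0, true) = φ.theta := by
    refine tensor_word_ext₂ fun u v s t => ?_
    simp only [HairForm.theta, ← HairForm.toFun_comb]
    rw [← φ.renumber (Equiv.swap 0 1)]
    simp only [map_mul, map_comb (Leaf.renumber (Equiv.swap (0 : Fin 2) 1)) (fun h => rfl),
      Leaf.renumber]
    rfl
  rw [← LinearMap.congr_fun₂ this (β ⊗ₜ α) (δ ⊗ₜ γ), HairForm.pairing_tmul, HairForm.pairing_tmul,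
    ← lie_skew (act φ.hair β _),
    ← lie_skew (act φ.hair δ _), map_neg, map_neg, LinearMap.neg_apply, neg_neg]

end SymForm

section RootComb

variable {L : Type*} [LieRing L] [LieAlgebra k L] (η : H →ₗ[k] L) {n : ℕ}

omit [CharZero k]

/-- Seen from the tip of a comb, its hairs come in the opposite order and on the other side of the
edge; this is `rho`. -/
theorem rootAux_comb_self (ψ : Leaf H n → L) (hψ : ∀ h, ψ (.hair h) = η h) (v : List H) (e : Fin n)
    (b : Bool) (c : L) :
    rootAux k ψ (.edge e b) (comb v (.edge e b)) c = act η (rho k H (word k v)) c := by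
  induction v generalizing c with
  | nil => simp [rootAux_of_self]
  | cons h v ih =>
    rw [comb_cons, rootAux_mul, rootAux_of_ne k ψ (by simp), ih, ev_of, hψ, word_cons, rho_mul,
      map_mul, rho_ι, zero_add, Module.End.mul_apply, map_neg, LinearMap.neg_apply, act_ι, lie_skew]

end RootComb

namespace SymForm

variable (φ : SymForm k H W)

theorem boundary_three_comb {e f g : Fin 3} (hef : e ≠ f) (heg : e ≠ g)
    (hfg : f ≠ g) (a b c : Bool) (v w : List H) :
    φ.boundary (tripod (.edge e a) (.edge f b) (.edge g c))
        (.of (.edge e !a), comb v (.edge f !b) * comb w (.edge g !c)) =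
      (sgn a * (sgn b * sgn c)) • (φ.theta (1 ⊗ₜ 1) (word k v ⊗ₜ word k w) +
        φ.form k ⁅φ.endp 0 false, φ.endp 1 false⁆ (act φ.hair (rho k H (word k v))
          ⁅act φ.hair (word k w) (φ.endp 0 true), φ.endp 1 true⁆) +
        φ.form k ⁅φ.endp 0 false, φ.endp 1 false⁆ (act φ.hair (rho k H (word k w))
          ⁅φ.endp 0 true, act φ.hair (word k v) (φ.endp 1 true)⁆)) := by
  rw [φ.boundary_three hef heg hfg a b c (t := (_, _)) (by
    simp only [Tree.ends, rootedEnds_mul, rootedEnds_comb, rootedEnds_edge,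
      Multiset.insert_eq_cons, ← Multiset.singleton_add])]
  congr 2
  · congr 1
    · rw [HairForm.pairing_tmul]
      congr 1
      · simp
      · simp only [root, ev_of, ev_mul, rootAux_of_self, rootAux_mul]
        rw [rootAux_comb_ne k _ _ (by simp) (by simp [hef.symm]),
          rootAux_comb_ne k _ _ (by simp) (by simp [heg.symm]), add_zero, add_zero,
          ev_comb φ.hair _ (fun h => rfl), ev_comb φ.hair _ (fun h => rfl)]
        simp [place, hfg.symm, HairForm.endp]
    · congr 1
      simp only [root, ev_of, ev_mul, rootAux_mul]
      rw [rootAux_of_ne _ _ (by simp [hef]), zero_add,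
        rootAux_comb_self φ.hair _ (fun h => rfl),
        rootAux_comb_ne k _ _ (by simp) (by simp [hfg.symm]), add_zero,
        ev_comb φ.hair _ (fun h => rfl)]
      simp [place, heg, HairForm.endp]
  · congr 1
    simp only [root, ev_of, ev_mul, rootAux_mul]
    rw [rootAux_of_ne _ _ (by simp [heg]), zero_add,
      rootAux_comb_self φ.hair _ (fun h => rfl),
      rootAux_comb_ne k _ _ (by simp) (by simp [hfg]), zero_add,
      ev_comb φ.hair _ (fun h => rfl)]
    simp [place, hef.symm, HairForm.endp]

/-- The two contractions put the hair of the tripod at the two ends of the edge that remains from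
`e` and `f`. A closed form therefore lets hairs slide along an external edge. -/
theorem boundary_two_comb {e f g : Fin 3} (hef : e ≠ f) (heg : e ≠ g)
    (hfg : f ≠ g) (a b : Bool) (h : H) (u v w : List H) :
    φ.boundary (tripod (.edge e a) (.edge f b) (.hair h))
        (.of (.edge e !a) * comb v (.edge g false),
          comb u (.edge f !b) * comb w (.edge g true)) =
      (-(sgn a * sgn b)) • (φ.theta (TensorAlgebra.ι k h ⊗ₜ word k v) (word k u ⊗ₜ word k w) +
        φ.theta ((word k u * TensorAlgebra.ι k h) ⊗ₜ word k w) (1 ⊗ₜ word k v)) := by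
  rw [φ.boundary_two hef heg hfg a b h (t := (_, _)) (by
    simp only [Tree.ends, rootedEnds_mul, rootedEnds_comb, rootedEnds_edge,
      Multiset.insert_eq_cons, ← Multiset.singleton_add]
    abel), neg_smul, ← smul_neg]
  congr 1
  have h1 : root k (φ.leaf k ∘ place f b false) (.edge e !a)
      (.of (.edge e !a) * comb v (.edge g false))
      (comb u (.edge f !b) * comb w (.edge g true)) =
      ⁅act φ.hair (word k v) (φ.endp 1 false),
        ⁅act φ.hair (word k u) (φ.endp 0 true), act φ.hair (word k w) (φ.endp 1 true)⁆⁆ := by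
    simp only [root, ev_mul, rootAux_mul, rootAux_of_self]
    rw [rootAux_comb_ne k _ _ (by simp) (by simp [heg.symm]),
      rootAux_comb_ne k _ _ (by simp) (by simp [hef.symm]),
      rootAux_comb_ne k _ _ (by simp) (by simp [heg.symm]), add_zero, add_zero, add_zero,
      ev_comb φ.hair _ (fun h => rfl), ev_comb φ.hair _ (fun h => rfl),
      ev_comb φ.hair _ (fun h => rfl)]
    simp [place, hfg.symm, HairForm.endp]
  have h2 : root k (φ.leaf k ∘ place e a false) (.edge f !b)
      (.of (.edge e !a) * comb v (.edge g false))
      (comb u (.edge f !b) * comb w (.edge g true)) =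
      act φ.hair (rho k H (word k u)) ⁅act φ.hair (word k w) (φ.endp 1 true),
        ⁅φ.endp 0 true, act φ.hair (word k v) (φ.endp 1 false)⁆⁆ := by
    simp only [root, ev_mul, rootAux_mul]
    rw [rootAux_of_ne _ _ (by simp [hef]), rootAux_comb_ne k _ _ (by simp) (by simp [hfg.symm]),
      rootAux_comb_self φ.hair _ (fun h => rfl),
      rootAux_comb_ne k _ _ (by simp) (by simp [hfg.symm]), zero_add, zero_add, add_zero,
      ev_comb φ.hair _ (fun h => rfl), ev_comb φ.hair _ (fun h => rfl)]
    simp [place, heg.symm, HairForm.endp]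
  have h3 := LinearMap.congr_fun₂ φ.pairing_reverse_one
    ((word k u * TensorAlgebra.ι k h) ⊗ₜ word k w) (1 ⊗ₜ word k v)
  simp only [HairForm.pairing_tmul, LinearMap.neg_apply, map_mul, Module.End.mul_apply, act_ι,
    map_one, Module.End.one_apply] at h3
  have m : ∀ x y z t : φ.L, φ.form k x ⁅y, ⁅z, t⁆⁆ = φ.form k ⁅x, y⁆ ⁅z, t⁆ :=
    fun x y z t => (φ.form_lie k _ _ _).symm
  rw [h1, h2, ← φ.form_act, m, m, h3, HairForm.pairing_tmul, HairForm.pairing_tmul]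
  simp only [map_mul, Module.End.mul_apply, act_ι, map_one, Module.End.one_apply]
  rw [← lie_skew (φ.endp 0 false) (φ.hair h)]
  simp only [neg_lie, map_neg, LinearMap.neg_apply]
  abel

/-- The second grouping needed in `TreeForm.mem_of_four`: the two ends of `g` trade places, and now
the contraction of `e` produces the crossed tree. -/
theorem boundary_two_comb' {e f g : Fin 3} (hef : e ≠ f) (heg : e ≠ g)
    (hfg : f ≠ g) (a b : Bool) (h : H) (u v w : List H) :
    φ.boundary (tripod (.edge e a) (.edge f b) (.hair h))
        (.of (.edge e !a) * comb w (.edge g true),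
          comb u (.edge f !b) * comb v (.edge g false)) =
      (sgn a * sgn b) • (φ.theta (TensorAlgebra.ι k h ⊗ₜ word k w) (word k u ⊗ₜ word k v) +
        φ.theta ((word k u * TensorAlgebra.ι k h) ⊗ₜ word k v) (1 ⊗ₜ word k w)) := by
  rw [φ.boundary_two hef heg hfg a b h (t := (_, _)) (by
    simp only [Tree.ends, rootedEnds_mul, rootedEnds_comb, rootedEnds_edge,
      Multiset.insert_eq_cons, ← Multiset.singleton_add]
    abel)]
  congr 1
  have h1 : root k (φ.leaf k ∘ place f b false) (.edge e !a)
      (.of (.edge e !a) * comb w (.edge g true))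
      (comb u (.edge f !b) * comb v (.edge g false)) =
      ⁅act φ.hair (word k w) (φ.endp 1 true),
        ⁅act φ.hair (word k u) (φ.endp 0 true), act φ.hair (word k v) (φ.endp 1 false)⁆⁆ := by
    simp only [root, ev_mul, rootAux_mul, rootAux_of_self]
    rw [rootAux_comb_ne k _ _ (by simp) (by simp [heg.symm]),
      rootAux_comb_ne k _ _ (by simp) (by simp [hef.symm]),
      rootAux_comb_ne k _ _ (by simp) (by simp [heg.symm]), add_zero, add_zero, add_zero,
      ev_comb φ.hair _ (fun h => rfl), ev_comb φ.hair _ (fun h => rfl),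
      ev_comb φ.hair _ (fun h => rfl)]
    simp [place, hfg.symm, HairForm.endp]
  have h2 : root k (φ.leaf k ∘ place e a false) (.edge f !b)
      (.of (.edge e !a) * comb w (.edge g true))
      (comb u (.edge f !b) * comb v (.edge g false)) =
      act φ.hair (rho k H (word k u)) ⁅act φ.hair (word k v) (φ.endp 1 false),
        ⁅φ.endp 0 true, act φ.hair (word k w) (φ.endp 1 true)⁆⁆ := by
    simp only [root, ev_mul, rootAux_mul]
    rw [rootAux_of_ne _ _ (by simp [hef]), rootAux_comb_ne k _ _ (by simp) (by simp [hfg.symm]),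
      rootAux_comb_self φ.hair _ (fun h => rfl),
      rootAux_comb_ne k _ _ (by simp) (by simp [hfg.symm]), zero_add, zero_add, add_zero,
      ev_comb φ.hair _ (fun h => rfl), ev_comb φ.hair _ (fun h => rfl)]
    simp [place, heg.symm, HairForm.endp]
  have h3 := LinearMap.congr_fun₂ φ.pairing_reverse_one
    (TensorAlgebra.ι k h ⊗ₜ word k w) (word k u ⊗ₜ word k v)
  simp only [HairForm.pairing_tmul, LinearMap.neg_apply, act_ι] at h3
  have m : ∀ x y z t : φ.L, φ.form k x ⁅y, ⁅z, t⁆⁆ = φ.form k ⁅x, y⁆ ⁅z, t⁆ :=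
    fun x y z t => (φ.form_lie k _ _ _).symm
  rw [h1, h2, ← lie_skew (φ.endp 0 false) (φ.hair h), map_neg, LinearMap.neg_apply,
    ← φ.form_act, m, m, h3, HairForm.pairing_tmul, HairForm.pairing_tmul]
  simp only [map_mul, Module.End.mul_apply, act_ι, map_one, Module.End.one_apply, neg_neg]

/-- There is a single contraction; its bracket of the two ends of one edge is the third term of an
IHX relation whose other terms are a theta graph and a crossed tree. -/
theorem boundary_loop_comb {e f g : Fin 3} (hef : e ≠ f) (heg : e ≠ g)
    (hfg : f ≠ g) (a b : Bool) (v w : List H) :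
    φ.boundary (tripod (.edge e a) (.edge f b) (.edge f !b))
        (.of (.edge e !a), comb v (.edge g false) * comb w (.edge g true)) =
      (sgn a * sgn b) • (φ.theta (1 ⊗ₜ word k v) (1 ⊗ₜ word k w) +
        φ.theta (1 ⊗ₜ word k w) (1 ⊗ₜ word k v)) := by
  rw [φ.boundary_loop hef heg hfg a b (t := (_, _)) (by
    simp only [Tree.ends, rootedEnds_mul, rootedEnds_comb, rootedEnds_edge,
      Multiset.insert_eq_cons, ← Multiset.singleton_add])]
  congr 1
  have h1 : root k (φ.leaf k ∘ place f b false) (.edge e !a) (.of (.edge e !a))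
      (comb v (.edge g false) * comb w (.edge g true)) =
      ⁅act φ.hair (word k v) (φ.endp 1 false), act φ.hair (word k w) (φ.endp 1 true)⁆ := by
    simp only [root, ev_mul, rootAux_mul, rootAux_of_self]
    rw [rootAux_comb_ne k _ _ (by simp) (by simp [heg.symm]),
      rootAux_comb_ne k _ _ (by simp) (by simp [heg.symm]), add_zero, add_zero,
      ev_comb φ.hair _ (fun h => rfl), ev_comb φ.hair _ (fun h => rfl)]
    simp [place, hfg.symm, HairForm.endp]
  have m : ∀ x y z t : φ.L, φ.form k x ⁅y, ⁅z, t⁆⁆ = φ.form k ⁅x, y⁆ ⁅z, t⁆ :=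
    fun x y z t => (φ.form_lie k _ _ _).symm
  have h3 := LinearMap.congr_fun₂ φ.pairing_reverse_one
    (1 ⊗ₜ word k w) (1 ⊗ₜ word k v)
  simp only [HairForm.pairing_tmul, LinearMap.neg_apply, map_one, Module.End.one_apply] at h3
  rw [HairForm.pairing_tmul, HairForm.pairing_tmul]
  simp only [map_one, Module.End.one_apply]
  rw [h1, φ.form_lie k, leibniz_lie,
    ← lie_skew ⁅φ.endp 0 true, act φ.hair (word k v) (φ.endp 1 false)⁆, map_add, map_neg, m, m, h3]
  abel

/-- If the values on theta graphs are given by `G`, the boundary of a graph with a tripod joined by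
three legs is given by a relator. -/
theorem form_three (G : TensorAlgebra k H ⊗[k] TensorAlgebra k H →ₗ[k] W)
    (hG : ∀ v w, φ.theta (1 ⊗ₜ 1) (v ⊗ₜ w) = G (rho k H v ⊗ₜ w))
    (hswap : ∀ v w, G (rho k H w ⊗ₜ rho k H v) = G (v ⊗ₜ w)) (v w : TensorAlgebra k H) :
    φ.theta (1 ⊗ₜ 1) (v ⊗ₜ w) +
        φ.form k ⁅φ.endp 0 false, φ.endp 1 false⁆ (act φ.hair (rho k H v)
          ⁅act φ.hair w (φ.endp 0 true), φ.endp 1 true⁆) +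
        φ.form k ⁅φ.endp 0 false, φ.endp 1 false⁆ (act φ.hair (rho k H w)
          ⁅φ.endp 0 true, act φ.hair v (φ.endp 1 true)⁆) =
      G (triRelator k H (rho k H v) w) := by
  -- Contraction at the tip of a comb leaves the hairs of that comb at the vertex, and `act_lie`
  -- distributes them to both branches. The swap symmetry brings each term into the shape of the
  -- relator.
  have h2 : ∀ X : TensorAlgebra k H ⊗[k] TensorAlgebra k H,
      φ.form k ⁅φ.endp 0 false, φ.endp 1 false⁆
          (actLie φ.hair (act φ.hair w (φ.endp 0 true)) (φ.endp 1 true) X) =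
        G ((rho k H).rTensor _ (TensorProduct.comm k _ _ X * (1 ⊗ₜ w))) := by
    intro X
    induction X using TensorProduct.induction_on with
    | zero => simp
    | add p q hp hq => simp only [map_add, add_mul, hp, hq]
    | tmul p q =>
      have := hG (p * w) q
      rw [HairForm.pairing_tmul] at this
      simp only [map_one, Module.End.one_apply, map_mul, Module.End.mul_apply] at this
      rw [actLie_tmul, this, ← hswap]
      simp
  have h3 : ∀ X : TensorAlgebra k H ⊗[k] TensorAlgebra k H,
      φ.form k ⁅φ.endp 0 false, φ.endp 1 false⁆
          (actLie φ.hair (φ.endp 0 true) (act φ.hair v (φ.endp 1 true))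
            (TensorProduct.map (rho k H) (rho k H) X)) =
        G ((rho k H).lTensor _ ((rho k H v ⊗ₜ 1) * TensorProduct.comm k _ _ X)) := by
    intro X
    induction X using TensorProduct.induction_on with
    | zero => simp
    | add p q hp hq => simp only [map_add, mul_add, hp, hq]
    | tmul p q =>
      have := hG (rho k H p) (rho k H q * v)
      rw [HairForm.pairing_tmul] at this
      simp only [map_one, Module.End.one_apply, map_mul, Module.End.mul_apply] at this
      rw [TensorProduct.map_tmul, actLie_tmul, this, ← hswap]
      simp
  rw [act_lie, act_lie, Delta_rho k w, h2, h3, comm_Delta, comm_Delta, hG, triRelator, map_add,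
    map_add]
  abel

end SymForm

end Theta

/-! ### A form with values in the presentation, from creation operators on words -/

section RootHairForm

variable {k : Type u} [Field k] {H : Type v} [AddCommGroup H] [Module k H] {n : ℕ}
  {L : Type*} [LieRing L] [LieAlgebra k L] {W : Type w} [AddCommGroup W] [Module k W]

/-- The hairy version of `rootForm`. -/
noncomputable def rootHairForm (η : H →ₗ[k] L) (ψ : Leaf H n → L) (hψ : ∀ h, ψ (.hair h) = η h)
    (e : Fin n) (b : Bool) (y : L →ₗ[k] W) : HairForm k H n W where
  toTreeForm := rootForm k ψ (.edge e b) y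
  hair_add h h' B := by
    change y _ = y _ + y _
    simp only [root, ev_of]
    rw [rootAux_of_ne k _ (by simp), rootAux_of_ne k _ (by simp), rootAux_of_ne k _ (by simp),
      hψ, hψ, hψ, zero_add, zero_add, zero_add, map_add, map_add, map_add]
  hair_smul c h B := by
    change y _ = c • y _
    simp only [root, ev_of]
    rw [rootAux_of_ne k _ (by simp), rootAux_of_ne k _ (by simp), hψ, hψ, map_smul, map_smul,
      zero_add, zero_add, map_smul]

theorem rootHairForm_comb (η : H →ₗ[k] L) (ψ : Leaf H n → L) (hψ : ∀ h, ψ (.hair h) = η h)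
    (x : Fin n × Bool) (f : L →ₗ[k] W) {y z t : Fin n × Bool} (hy : y ≠ x) (hz : z ≠ x)
    (ht : t ≠ x) (β γ δ : List H) :
    (rootHairForm η ψ hψ x.1 x.2 f).toFun (.of (.edge x.1 x.2) * comb β (.edge y.1 y.2))
      (comb γ (.edge z.1 z.2) * comb δ (.edge t.1 t.2)) =
    f ⁅act η (word k β) (ψ (.edge y.1 y.2)), ⁅act η (word k γ) (ψ (.edge z.1 z.2)),
        act η (word k δ) (ψ (.edge t.1 t.2))⁆⁆ := by
  change f _ = _
  have key : ∀ {y : Fin n × Bool}, y ≠ x → (Leaf.edge y.1 y.2 : Leaf H n) ≠ .edge x.1 x.2 := by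
    intro y h1 h2
    simp only [Leaf.edge.injEq] at h2
    exact h1 (Prod.ext h2.1 h2.2)
  simp only [root, ev_mul, rootAux_mul, rootAux_of_self]
  rw [rootAux_comb_ne k _ _ (by simp) (key hy), rootAux_comb_ne k _ _ (by simp) (key hz),
    rootAux_comb_ne k _ _ (by simp) (key ht), add_zero, add_zero, add_zero,
    ev_comb η _ hψ, ev_comb η _ hψ, ev_comb η _ hψ]

end RootHairForm

section Operators

attribute [local instance] LieRing.ofAssociativeRing

variable (k : Type u) [Field k] (H : Type v) [AddCommGroup H] [Module k H]

/-- The space of words with at most three letters, on which hairs act diagonally. -/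
abbrev Words : Type (max u v) :=
  k × TensorAlgebra k H × (TensorAlgebra k H ⊗[k] TensorAlgebra k H) ×
    (TensorAlgebra k H ⊗[k] (TensorAlgebra k H ⊗[k] TensorAlgebra k H))

/-- The operator that creates the first letter. -/
noncomputable def opOne : Module.End k (Words k H) :=
  LinearMap.inr k _ _ ∘ₗ LinearMap.inl k _ _ ∘ₗ LinearMap.toSpanSingleton k _ 1 ∘ₗ
    LinearMap.fst k _ _

/-- The operator that creates the second letter. -/
noncomputable def opTwo : Module.End k (Words k H) :=
  LinearMap.inr k _ _ ∘ₗ LinearMap.inr k _ _ ∘ₗ LinearMap.inl k _ _ ∘ₗ TensorProduct.mk k _ _ 1 ∘ₗ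
    LinearMap.fst k _ _ ∘ₗ LinearMap.snd k _ _

/-- The operator that creates the third letter. -/
noncomputable def opThree : Module.End k (Words k H) :=
  LinearMap.inr k _ _ ∘ₗ LinearMap.inr k _ _ ∘ₗ LinearMap.inr k _ _ ∘ₗ TensorProduct.mk k _ _ 1 ∘ₗ
    LinearMap.fst k _ _ ∘ₗ LinearMap.snd k _ _ ∘ₗ LinearMap.snd k _ _

/-- The diagonal action of a hair. -/
noncomputable def opHair : H →ₗ[k] Module.End k (Words k H) where
  toFun h := LinearMap.prodMap 0 (LinearMap.prodMap (LinearMap.mulLeft k (TensorAlgebra.ι k h))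
    (LinearMap.prodMap
      (LinearMap.mulLeft k (TensorAlgebra.ι k h ⊗ₜ 1 + 1 ⊗ₜ TensorAlgebra.ι k h))
      (LinearMap.mulLeft k (TensorAlgebra.ι k h ⊗ₜ 1 +
        1 ⊗ₜ (TensorAlgebra.ι k h ⊗ₜ 1 + 1 ⊗ₜ TensorAlgebra.ι k h)))))
  map_add' h h' := by
    refine LinearMap.ext fun x => ?_
    simp [TensorProduct.add_tmul, TensorProduct.tmul_add, add_mul]
    constructor <;> abel
  map_smul' c h := by
    refine LinearMap.ext fun x => ?_
    simp [← TensorProduct.smul_tmul', TensorProduct.tmul_add, add_mul, smul_add, smul_mul_assoc]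

variable {k H}

theorem opOne_apply (p : Words k H) : opOne k H p = (0, p.1 • 1, 0, 0) := rfl

theorem opTwo_apply (p : Words k H) : opTwo k H p = (0, 0, 1 ⊗ₜ p.2.1, 0) := rfl

theorem opThree_apply (p : Words k H) : opThree k H p = (0, 0, 0, 1 ⊗ₜ p.2.2.1) := rfl

theorem opHair_apply (h : H) (p : Words k H) : opHair k H h p =
    (0, TensorAlgebra.ι k h * p.2.1,
      (TensorAlgebra.ι k h ⊗ₜ 1 + 1 ⊗ₜ TensorAlgebra.ι k h) * p.2.2.1,
      (TensorAlgebra.ι k h ⊗ₜ 1 +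
        1 ⊗ₜ (TensorAlgebra.ι k h ⊗ₜ 1 + 1 ⊗ₜ TensorAlgebra.ι k h)) * p.2.2.2) := rfl

theorem bracket_apply {V : Type*} [AddCommGroup V] [Module k V] (A B : Module.End k V) (x : V) :
    ⁅A, B⁆ x = A (B x) - B (A x) := rfl

/-- In the commutator of a hair with a creation operator, the action on the old letters cancels;
only the action on the new letter stays. The same holds for `act_opTwo` and `act_opThree`. -/
theorem act_opOne (x : TensorAlgebra k H) (p : Words k H) :
    act (opHair k H) x (opOne k H) p = (0, p.1 • x, 0, 0) := by
  induction x using left_induction generalizing p with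
  | add x y hx hy =>
    rw [map_add, LinearMap.add_apply, LinearMap.add_apply, hx, hy, Prod.mk_add_mk, Prod.mk_add_mk,
      Prod.mk_add_mk]
    simp only [add_zero, smul_add]
  | smul c x hx =>
    rw [map_smul, LinearMap.smul_apply, LinearMap.smul_apply, hx, Prod.smul_mk, Prod.smul_mk,
      Prod.smul_mk]
    simp only [smul_zero, smul_comm c]
  | one => rw [map_one, Module.End.one_apply, opOne_apply]
  | mul h x hx =>
    rw [map_mul, Module.End.mul_apply, act_ι, bracket_apply, hx, hx, opHair_apply, opHair_apply]
    simp; rfl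

theorem act_opTwo (x : TensorAlgebra k H) (p : Words k H) :
    act (opHair k H) x (opTwo k H) p = (0, 0, x ⊗ₜ p.2.1, 0) := by
  induction x using left_induction generalizing p with
  | add x y hx hy =>
    rw [map_add, LinearMap.add_apply, LinearMap.add_apply, hx, hy, Prod.mk_add_mk, Prod.mk_add_mk,
      Prod.mk_add_mk]
    simp only [add_zero, TensorProduct.add_tmul]
  | smul c x hx =>
    rw [map_smul, LinearMap.smul_apply, LinearMap.smul_apply, hx, Prod.smul_mk, Prod.smul_mk,
      Prod.smul_mk]
    simp only [smul_zero, TensorProduct.smul_tmul']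
  | one => rw [map_one, Module.End.one_apply, opTwo_apply]
  | mul h x hx =>
    rw [map_mul, Module.End.mul_apply, act_ι, bracket_apply, hx, hx, opHair_apply, opHair_apply]
    simp only [mul_zero, Prod.mk_sub_mk, sub_self]
    rw [add_mul, Algebra.TensorProduct.tmul_mul_tmul, Algebra.TensorProduct.tmul_mul_tmul, one_mul,
      one_mul, add_sub_cancel_right]

theorem act_opThree (x : TensorAlgebra k H) (p : Words k H) :
    act (opHair k H) x (opThree k H) p = (0, 0, 0, x ⊗ₜ p.2.2.1) := by
  induction x using left_induction generalizing p with
  | add x y hx hy =>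
    rw [map_add, LinearMap.add_apply, LinearMap.add_apply, hx, hy, Prod.mk_add_mk, Prod.mk_add_mk,
      Prod.mk_add_mk]
    simp only [add_zero, TensorProduct.add_tmul]
  | smul c x hx =>
    rw [map_smul, LinearMap.smul_apply, LinearMap.smul_apply, hx, Prod.smul_mk, Prod.smul_mk,
      Prod.smul_mk]
    simp only [smul_zero, TensorProduct.smul_tmul']
  | one => rw [map_one, Module.End.one_apply, opThree_apply]
  | mul h x hx =>
    rw [map_mul, Module.End.mul_apply, act_ι, bracket_apply, hx, hx, opHair_apply, opHair_apply]
    simp only [mul_zero, Prod.mk_sub_mk, sub_self]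
    rw [add_mul _ _ (x ⊗ₜ[k] p.2.2.1), Algebra.TensorProduct.tmul_mul_tmul,
      Algebra.TensorProduct.tmul_mul_tmul, one_mul, one_mul, add_sub_cancel_right]

variable (k H)

/-- The values of the leaves as operators. -/
noncomputable def opLeaf : Leaf H 2 → Module.End k (Words k H)
  | .hair h => opHair k H h
  -- Each operator raises the number of letters from one prescribed value, so a product of the three
  -- is nonzero on the vacuum only in the order three, two, one. The tail of edge 0 is the root and
  -- its value plays no role.
  | .edge e b => if b then (if e = 0 then opOne k H else opTwo k H)
      else (if e = 0 then 0 else opThree k H)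

theorem opLeaf_hair (h : H) : opLeaf k H (.hair h) = opHair k H h := rfl

/-- The map `x ⊗ (y ⊗ z) ↦ -(ρ(z) ⊗ y ρ(x))` to the presentation. -/
noncomputable def readOff :
    TensorAlgebra k H ⊗[k] (TensorAlgebra k H ⊗[k] TensorAlgebra k H) →ₗ[k] Presentation k H :=
  -- In `⁅b, ⁅c, d⁆⁆` the product `b d c` has coefficient `-1`, which this sign cancels.
  -TensorProduct.lift (((TensorProduct.mapBilinear (RingHom.id k) _ _ _ _).flip (rho k H) ∘ₗ
    (LinearMap.mul k (TensorAlgebra k H)).flip ∘ₗ rho k H).compr₂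
      (pres k ∘ₗ (TensorProduct.comm k _ _).toLinearMap))

theorem readOff_tmul (x y z : TensorAlgebra k H) :
    readOff k H (x ⊗ₜ (y ⊗ₜ z)) = -pres k (rho k H z ⊗ₜ (y * rho k H x)) := by
  simp [readOff]

/-- The coefficient of the words in which the three letters occur in order. -/
noncomputable def coefficient : Module.End k (Words k H) →ₗ[k] Presentation k H :=
  readOff k H ∘ₗ LinearMap.snd k _ _ ∘ₗ LinearMap.snd k _ _ ∘ₗ LinearMap.snd k _ _ ∘ₗ
    LinearMap.applyₗ ((1, 0, 0, 0) : Words k H)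

/-- The form that reads off the words in which the ends of the two external edges occur in a given
cyclic order. -/
noncomputable def wordForm : HairForm k H 2 (Presentation k H) :=
  rootHairForm (opHair k H) (opLeaf k H) (opLeaf_hair k H) 0 false (coefficient k H)

end Operators

/-! ### Values on theta graphs with hairs at all four ends -/

section Glue

variable (k : Type u) [Field k] {H : Type v} [AddCommGroup H] [Module k H]
  {W : Type w} [AddCommGroup W] [Module k W]

/-- The map `(α ⊗ β, γ ⊗ δ) ↦ α ρ(γ) ⊗ δ ρ(β)`, composed with a linear map. -/
noncomputable def glue (G : TensorAlgebra k H ⊗[k] TensorAlgebra k H →ₗ[k] W) :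
    TensorAlgebra k H ⊗[k] TensorAlgebra k H →ₗ[k]
      TensorAlgebra k H ⊗[k] TensorAlgebra k H →ₗ[k] W :=
  ((LinearMap.mul k (TensorAlgebra k H ⊗[k] TensorAlgebra k H)).compl₁₂ LinearMap.id
    (TensorProduct.map (rho k H) (rho k H))).compr₂ (G ∘ₗ (rho k H).lTensor _)

@[simp] theorem glue_tmul (G : TensorAlgebra k H ⊗[k] TensorAlgebra k H →ₗ[k] W)
    (α β γ δ : TensorAlgebra k H) :
    glue k G (α ⊗ₜ β) (γ ⊗ₜ δ) = G ((α * rho k H γ) ⊗ₜ (δ * rho k H β)) := by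
  simp [glue]

variable {k}

/-- A bilinear map on `T(H) ⊗ T(H)` is invariant under the diagonal action of `H`. -/
def IsDiagInvariant (A : TensorAlgebra k H ⊗[k] TensorAlgebra k H →ₗ[k]
    TensorAlgebra k H ⊗[k] TensorAlgebra k H →ₗ[k] W) : Prop :=
  ∀ h p q, A ((TensorAlgebra.ι k h ⊗ₜ 1 + 1 ⊗ₜ TensorAlgebra.ι k h) * p) q =
    -A p ((TensorAlgebra.ι k h ⊗ₜ 1 + 1 ⊗ₜ TensorAlgebra.ι k h) * q)

/-- Invariance pushes the hairs of the first branch onto the other three, so it may be taken bare.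
-/
theorem eq_of_isDiagInvariant {A B : TensorAlgebra k H ⊗[k] TensorAlgebra k H →ₗ[k]
    TensorAlgebra k H ⊗[k] TensorAlgebra k H →ₗ[k] W} (hA : IsDiagInvariant A)
    (hB : IsDiagInvariant B) (h : ∀ v s t : List H,
      A (1 ⊗ₜ word k v) (word k s ⊗ₜ word k t) = B (1 ⊗ₜ word k v) (word k s ⊗ₜ word k t)) :
    A = B := by
  refine tensor_word_ext fun u v => ?_
  induction u generalizing v with
  | nil => exact tensor_word_ext fun s t => h v s t
  | cons g u ih =>
    refine LinearMap.ext fun q => ?_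
    have hs : word k (g :: u) ⊗ₜ[k] word k v =
        (TensorAlgebra.ι k g ⊗ₜ[k] 1 + 1 ⊗ₜ[k] TensorAlgebra.ι k g) * (word k u ⊗ₜ[k] word k v) -
          word k u ⊗ₜ[k] word k (g :: v) := by
      simp [add_mul]
    rw [hs, map_sub, map_sub, LinearMap.sub_apply, LinearMap.sub_apply, hA, hB, ih, ih]

variable (k)

/-- `ρ ⊗ ρ` negates the diagonal element `h ⊗ 1 + 1 ⊗ h`, so invariance says that this element can
be moved cyclically around a product; that is the commutator relation. -/
theorem glue_isDiagInvariant (G : TensorAlgebra k H ⊗[k] TensorAlgebra k H →ₗ[k] W)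
    (hG : ∀ h v w, G ((TensorAlgebra.ι k h * v) ⊗ₜ[k] w) + G (v ⊗ₜ[k] (TensorAlgebra.ι k h * w)) =
      G ((v * TensorAlgebra.ι k h) ⊗ₜ[k] w) + G (v ⊗ₜ[k] (w * TensorAlgebra.ι k h))) :
    IsDiagInvariant (glue k G) := by
  intro h p q
  have key : ∀ X : TensorAlgebra k H ⊗[k] TensorAlgebra k H,
      G ((rho k H).lTensor _ ((TensorAlgebra.ι k h ⊗ₜ 1 + 1 ⊗ₜ TensorAlgebra.ι k h) * X)) =
        G ((rho k H).lTensor _ (X * (TensorAlgebra.ι k h ⊗ₜ 1 + 1 ⊗ₜ TensorAlgebra.ι k h))) := by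
    intro X
    induction X using TensorProduct.induction_on with
    | zero => simp
    | add a b ha hb => rw [mul_add, add_mul _ _ (_ + _), map_add, map_add, map_add, map_add, ha, hb]
    | tmul a b =>
      have := hG h a (rho k H b)
      simp [add_mul, mul_add, TensorProduct.tmul_neg]
      rw [← sub_eq_add_neg, ← sub_eq_add_neg, sub_eq_sub_iff_add_eq_add, this]
  simp only [glue, LinearMap.compr₂_apply, LinearMap.compl₁₂_apply, LinearMap.mul_apply',
    LinearMap.id_apply, LinearMap.comp_apply, map_rho_mul]
  have hd : TensorProduct.map (rho k H) (rho k H)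
      (TensorAlgebra.ι k h ⊗ₜ 1 + 1 ⊗ₜ TensorAlgebra.ι k h) +
      (TensorAlgebra.ι k h ⊗ₜ 1 + 1 ⊗ₜ TensorAlgebra.ι k h) = 0 := by
    simp only [map_add, TensorProduct.map_tmul, rho_ι, rho_one, TensorProduct.tmul_neg,
      TensorProduct.neg_tmul]
    abel
  rw [mul_assoc, key, mul_assoc]
  apply eq_neg_of_add_eq_zero_left
  rw [← map_add, ← map_add, ← mul_add, ← mul_add, add_comm, hd, mul_zero, mul_zero, map_zero,
    map_zero]

end Glue

/-! ### Symmetrization over renumberings and reversals of the edges -/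

section SymmetricForm

attribute [local instance] LieRing.ofAssociativeRing

variable (k : Type u) [Field k] [CharZero k] {H : Type v} [AddCommGroup H] [Module k H]
  {W : Type w} [AddCommGroup W] [Module k W]

-- With the first branch bare the value is a coefficient of `⁅b, ⁅c, d⁆⁆`, with `b`, `c`, `d`
-- creating the third, first and second letter; only the product `b d c` survives.
variable (H) in
theorem wordForm_theta : (wordForm k H).theta = glue k (pres k) := by
  refine eq_of_isDiagInvariant (fun h p q => (wordForm k H).pairing_invariant _ _ _ _ h p q)
    (glue_isDiagInvariant k _ (pres_comm k)) fun β γ δ => ?_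
  have h := (wordForm k H).toFun_comb (0, false) (1, false) (0, true) (1, true) [] β γ δ
  rw [word_nil] at h
  refine h.symm.trans ((rootHairForm_comb (opHair k H) (opLeaf k H) (opLeaf_hair k H) (0, false)
    (coefficient k H) (by simp) (by simp) (by simp) _ _ _).trans ?_)
  rw [glue_tmul]
  simp [coefficient, opLeaf, Ring.lie_def, act_opOne, act_opTwo, act_opThree, readOff_tmul,
    TensorProduct.tmul_neg]

-- Here the bracket pairs the first and third letters, so none of its four products has the order
-- three, two, one.
variable (H) in
theorem wordForm_crossed :
    (wordForm k H).pairing (0, false) (1, true) (0, true) (1, false) = 0 := by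
  refine eq_of_isDiagInvariant (fun h p q => (wordForm k H).pairing_invariant _ _ _ _ h p q)
    (fun h p q => by simp) fun β γ δ => ?_
  have h := (wordForm k H).toFun_comb (0, false) (1, true) (0, true) (1, false) [] β γ δ
  rw [word_nil] at h
  refine h.symm.trans ((rootHairForm_comb (opHair k H) (opLeaf k H) (opLeaf_hair k H) (0, false)
    (coefficient k H) (by simp) (by simp) (by simp) _ _ _).trans ?_)
  simp [coefficient, opLeaf, Ring.lie_def, act_opOne, act_opTwo, act_opThree]

/-- A renumbering of the two external edges, with reversals. -/
def signedPerm (s : Fin 2) (b : Fin 2 → Bool) : Leaf H 2 → Leaf H 2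
  | .hair h => .hair h
  | .edge i β => .edge (i + s) (xor β (b i))

theorem perm_fin_two_apply : ∀ (π : Equiv.Perm (Fin 2)) (i : Fin 2), π i = i + π 0 := by
  decide

theorem perm_fin_two_cases :
    ∀ π : Equiv.Perm (Fin 2), (π 0 = 0 ∧ π 1 = 1) ∨ (π 0 = 1 ∧ π 1 = 0) := by
  decide

theorem sgn_mul_xor : ∀ (e : Fin 2) (x y : Bool), sgn x * sgn y =
    -(sgn (xor x (decide (0 = e))) * sgn (xor y (decide (1 = e)))) := by
  decide

/-- Symmetrization of a form with respect to the renumberings and reversals of the two external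
edges. -/
noncomputable def HairForm.symmetrize (φ : HairForm k H 2 W) : SymForm k H W where
  -- The group has eight elements, but four of them turn a theta graph into a crossed tree, where
  -- `wordForm` is zero; hence the factor `1/4`.
  toFun A B := (4 : k)⁻¹ • ∑ p : Fin 2 × (Fin 2 → Bool), (sgn (p.2 0) * sgn (p.2 1)) •
    φ.toFun (FreeMagma.map (signedPerm p.1 p.2) A) (FreeMagma.map (signedPerm p.1 p.2) B)
  symm A B := by
    congr 1
    exact Finset.sum_congr rfl fun p _ => by rw [φ.symm]
  move A B C := by simp only [map_mul, φ.move]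
  antisymm A B C := by
    rw [← smul_add, ← Finset.sum_add_distrib]
    simp only [map_mul, ← smul_add, φ.antisymm, smul_zero, Finset.sum_const_zero]
  ihx A B C D := by
    rw [← smul_add, ← smul_add, ← Finset.sum_add_distrib, ← Finset.sum_add_distrib]
    simp only [map_mul, ← smul_add, φ.ihx, smul_zero, Finset.sum_const_zero]
  hair_add h h' B := by
    rw [← smul_add, ← Finset.sum_add_distrib]
    simp only [FreeMagma.map_of, ← smul_add, signedPerm, φ.hair_add]
  hair_smul c h B := by
    rw [smul_comm c, Finset.smul_sum (r := c)]
    simp only [FreeMagma.map_of, signedPerm, φ.hair_smul]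
    exact congrArg _ (Finset.sum_congr rfl fun p _ => smul_comm (_ : ℤ) c (_ : W))
  renumber π A B := by
    congr 1
    have hπ := perm_fin_two_apply π
    refine Fintype.sum_equiv ((Equiv.addRight (π 0)).prodCongr (π.symm.arrowCongr (Equiv.refl _)))
      _ _ fun p => ?_
    have h1 : (signedPerm p.1 p.2 ∘ Leaf.renumber π : Leaf H 2 → Leaf H 2) =
        signedPerm (p.1 + π 0) (p.2 ∘ π) := by
      funext x
      cases x with
      | hair h => rfl
      | edge i β =>
        simp only [Function.comp_apply, Leaf.renumber, signedPerm, Leaf.edge.injEq, and_true]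
        rw [hπ i, add_assoc, add_comm (π 0)]
    have h2 : sgn (p.2 0) * sgn (p.2 1) = sgn (p.2 (π 0)) * sgn (p.2 (π 1)) := by
      rcases perm_fin_two_cases π with h | h
      · rw [h.1, h.2]
      · rw [h.1, h.2, mul_comm]
    rw [map_map, map_map, h1, h2]
    rfl
  reverse e A B := by
    rw [← smul_neg, ← Finset.sum_neg_distrib]
    congr 1
    let r : (Fin 2 → Bool) ≃ (Fin 2 → Bool) :=
      Function.Involutive.toPerm (fun b i => xor (b i) (decide (i = e)))
        (fun b => by funext i; simp)
    refine Fintype.sum_equiv ((Equiv.refl _).prodCongr r) _ _ fun p => ?_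
    have h1 : (signedPerm p.1 p.2 ∘ Leaf.reverse e : Leaf H 2 → Leaf H 2) =
        signedPerm p.1 (r p.2) := by
      funext x
      cases x with
      | hair h => rfl
      | edge i β =>
        by_cases hi : i = e <;>
        simp [Leaf.reverse, signedPerm, r, Function.Involutive.toPerm, hi]
    have h2 : sgn (p.2 0) * sgn (p.2 1) = -(sgn (r p.2 0) * sgn (r p.2 1)) :=
      sgn_mul_xor e (p.2 0) (p.2 1)
    rw [map_map, map_map, h1, h2, neg_smul]
    rfl

theorem sum_fin_two_bool {M : Type*} [AddCommMonoid M] (F : (Fin 2 → Bool) → M) :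
    ∑ f, F f = F ![false, false] + F ![false, true] + F ![true, false] + F ![true, true] := by
  rw [← (finTwoArrowEquiv Bool).symm.sum_comp, Fintype.sum_prod_type]
  simp [finTwoArrowEquiv]
  abel

theorem HairForm.pairing_swap (φ : HairForm k H 2 W) (x y z t : Fin 2 × Bool)
    (α β γ δ : TensorAlgebra k H) : φ.pairing y x t z (β ⊗ₜ α) (δ ⊗ₜ γ) =
      φ.pairing x y z t (α ⊗ₜ β) (γ ⊗ₜ δ) := by
  rw [pairing_tmul, pairing_tmul, ← lie_skew (act φ.hair β _), ← lie_skew (act φ.hair δ _), map_neg,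
    map_neg, LinearMap.neg_apply, neg_neg]

theorem HairForm.symmetrize_theta (φ : HairForm k H 2 W)
    (hφ : φ.pairing (0, false) (1, true) (0, true) (1, false) = 0) (α β γ δ : List H) :
    (φ.symmetrize k).theta (word k α ⊗ₜ word k β) (word k γ ⊗ₜ word k δ) =
      (4 : k)⁻¹ • (φ.theta (word k α ⊗ₜ word k β) (word k γ ⊗ₜ word k δ) +
        φ.theta (word k γ ⊗ₜ word k δ) (word k α ⊗ₜ word k β) +
        (φ.theta (word k β ⊗ₜ word k α) (word k δ ⊗ₜ word k γ) +
        φ.theta (word k δ ⊗ₜ word k γ) (word k β ⊗ₜ word k α))) := by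
  have h0' : ∀ p q, φ.pairing (0, true) (1, false) (0, false) (1, true) p q = 0 := by
    intro p q
    rw [HairForm.pairing_flip, hφ]
    rfl
  have h0 : ∀ p q, φ.pairing (0, false) (1, true) (0, true) (1, false) p q = 0 := by
    intro p q
    rw [hφ]
    rfl
  rw [HairForm.theta, ← HairForm.toFun_comb]
  change (4 : k)⁻¹ • ∑ p : Fin 2 × (Fin 2 → Bool), (sgn (p.2 0) * sgn (p.2 1)) •
    φ.toFun (FreeMagma.map _ _) (FreeMagma.map _ _) = _
  rw [Fintype.sum_prod_type, Fin.sum_univ_two, sum_fin_two_bool, sum_fin_two_bool]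
  simp only [map_mul, map_comb (signedPerm _ _) (fun h => rfl), signedPerm]
  change (4 : k)⁻¹ • (
    ((1 : ℤ) • φ.toFun (comb α (.edge 0 false) * comb β (.edge 1 false))
        (comb γ (.edge 0 true) * comb δ (.edge 1 true)) +
      (-1 : ℤ) • φ.toFun (comb α (.edge 0 false) * comb β (.edge 1 true))
        (comb γ (.edge 0 true) * comb δ (.edge 1 false)) +
      (-1 : ℤ) • φ.toFun (comb α (.edge 0 true) * comb β (.edge 1 false))
        (comb γ (.edge 0 false) * comb δ (.edge 1 true)) +
      (1 : ℤ) • φ.toFun (comb α (.edge 0 true) * comb β (.edge 1 true))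
        (comb γ (.edge 0 false) * comb δ (.edge 1 false))) +
    ((1 : ℤ) • φ.toFun (comb α (.edge 1 false) * comb β (.edge 0 false))
        (comb γ (.edge 1 true) * comb δ (.edge 0 true)) +
      (-1 : ℤ) • φ.toFun (comb α (.edge 1 false) * comb β (.edge 0 true))
        (comb γ (.edge 1 true) * comb δ (.edge 0 false)) +
      (-1 : ℤ) • φ.toFun (comb α (.edge 1 true) * comb β (.edge 0 false))
        (comb γ (.edge 1 false) * comb δ (.edge 0 true)) +
      (1 : ℤ) • φ.toFun (comb α (.edge 1 true) * comb β (.edge 0 true))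
        (comb γ (.edge 1 false) * comb δ (.edge 0 false)))) = _
  have hc := fun x y z t : Fin 2 × Bool => φ.toFun_comb x y z t α β γ δ
  rw [hc (0, false) (1, false) (0, true) (1, true), hc (0, false) (1, true) (0, true) (1, false),
    hc (0, true) (1, false) (0, false) (1, true), hc (0, true) (1, true) (0, false) (1, false),
    hc (1, false) (0, false) (1, true) (0, true), hc (1, false) (0, true) (1, true) (0, false),
    hc (1, true) (0, false) (1, false) (0, true), hc (1, true) (0, true) (1, false) (0, false),
    φ.pairing_flip (0, true) (1, true), φ.pairing_swap k (0, false) (1, false),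
    φ.pairing_swap k (0, true) (1, false), φ.pairing_swap k (0, false) (1, true),
    φ.pairing_swap k (0, true) (1, true), φ.pairing_flip (0, true) (1, true), h0, h0', h0, h0']
  simp only [one_smul, smul_zero, add_zero]

variable (H) in
/-- The symmetric form with values in the presentation. -/
noncomputable def presForm : SymForm k H (Presentation k H) := (wordForm k H).symmetrize

-- The four surviving terms of the average have the same class, because they differ by the action of
-- `ℤ/2 × ℤ/2`.
variable (H) in
theorem presForm_theta : (presForm k H).theta = glue k (pres k) := by
  refine tensor_word_ext₂ fun α β γ δ => ?_
  rw [presForm, HairForm.symmetrize_theta k _ (wordForm_crossed k H), wordForm_theta, glue_tmul,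
    glue_tmul, glue_tmul, glue_tmul]
  have h1 : ∀ α β γ δ : TensorAlgebra k H,
      pres k ((β * rho k H δ) ⊗ₜ (γ * rho k H α)) =
        pres k ((α * rho k H γ) ⊗ₜ (δ * rho k H β)) := by
    intro α β γ δ
    rw [← pres_swap, rho_mul, rho_mul, rho_rho, rho_rho]
  have h2 : ∀ α β γ δ : TensorAlgebra k H,
      pres k ((γ * rho k H α) ⊗ₜ (β * rho k H δ)) =
        pres k ((α * rho k H γ) ⊗ₜ (δ * rho k H β)) := by
    intro α β γ δ
    rw [pres_flip, h1]
  rw [h2 (word k α), h1 (word k α), pres_flip k (word k α * _)]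
  rw [inv_smul_eq_iff₀ (by norm_num)]
  module

end SymmetricForm

/-! ### Counting the univalent vertices of hairy graphs -/

section Hairy

variable {H : Type v} {n : ℕ}

theorem Tree.ends_eq (t : Tree (Leaf H n)) : t.ends = t.leaves.filterMap Leaf.end? := by
  rw [Tree.ends, Tree.leaves, Multiset.filterMap_add]
  rfl

theorem exists_hairs (m : Multiset (Leaf H n)) : ∃ hs : Multiset H,
    m = hs.map Leaf.hair + (m.filterMap Leaf.end?).map fun p => Leaf.edge p.1 p.2 := by
  induction m using Multiset.induction_on with
  | empty => exact ⟨0, rfl⟩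
  | cons x m ih =>
    obtain ⟨hs, hm⟩ := ih
    cases x with
    | hair h =>
      refine ⟨h ::ₘ hs, ?_⟩
      rw [Multiset.filterMap_cons_none _ _ (by rfl), Multiset.map_cons, Multiset.cons_add, ← hm]
    | edge f c =>
      refine ⟨hs, ?_⟩
      rw [Multiset.filterMap_cons_some _ _ _ (by rfl), Multiset.map_cons, Multiset.add_cons, ← hm]

/-- Replaces the choice of the multiset of hairs by two quantities that are easy to follow under
relabelling and regrouping. -/
theorem isHairy_iff {s : ℕ} {m : Multiset (Leaf H n)} : IsHairy s m ↔
    m.filterMap Leaf.end? = (Finset.univ : Finset (Fin n × Bool)).val ∧ m.card = s + n * 2 := by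
  have hc : (Finset.univ : Finset (Fin n × Bool)).val.card = n * 2 := by
    change (Finset.univ : Finset (Fin n × Bool)).card = _
    simp
  constructor
  · rintro ⟨hs, rfl, rfl⟩
    constructor
    · rw [Multiset.filterMap_add, Multiset.filterMap_map, Multiset.filterMap_map]
      have h1 : hs.filterMap (Leaf.end? ∘ (Leaf.hair : H → Leaf H n)) = 0 := by
        induction hs using Multiset.induction_on with
        | empty => rfl
        | cons h hs ih => rw [Multiset.filterMap_cons_none _ _ (by rfl), ih]
      have h2 : (Leaf.end? ∘ fun p : Fin n × Bool => (Leaf.edge p.1 p.2 : Leaf H n)) = some := rfl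
      rw [h1, h2, Multiset.filterMap_some, zero_add]
    · rw [Multiset.card_add, Multiset.card_map, Multiset.card_map, hc]
  · rintro ⟨h1, h2⟩
    obtain ⟨hs, hm⟩ := exists_hairs m
    rw [h1] at hm
    refine ⟨hs, ?_, hm⟩
    rw [hm, Multiset.card_add, Multiset.card_map, Multiset.card_map, hc] at h2
    omega

theorem isHairy_congr {s : ℕ} {m m' : Multiset (Leaf H n)} (h : m.filterMap Leaf.end? =
    m'.filterMap Leaf.end?) (h' : m.card = m'.card) : IsHairy s m ↔ IsHairy s m' := by
  rw [isHairy_iff, isHairy_iff, h, h']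

theorem rootedLeaves_map {X Y : Type v} (f : X → Y) (A : FreeMagma X) :
    rootedLeaves (FreeMagma.map f A) = (rootedLeaves A).map f := by
  induction A with
  | ih1 x => rfl
  | ih2 A B hA hB => rw [map_mul, rootedLeaves_mul, rootedLeaves_mul, hA, hB, Multiset.map_add]

theorem leaves_relabel {X Y : Type v} (f : X → Y) (t : Tree X) :
    (t.relabel f).leaves = t.leaves.map f := by
  rw [Tree.leaves, Tree.leaves, Multiset.map_add, ← rootedLeaves_map, ← rootedLeaves_map]
  rfl

theorem isHairy_relabel {s : ℕ} (σ : Equiv.Perm (Fin n × Bool)) {f : Leaf H n → Leaf H n}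
    (hf : ∀ x, (f x).end? = x.end?.map σ) (t : Tree (Leaf H n)) :
    IsHairy s (t.relabel f).leaves ↔ IsHairy s t.leaves := by
  rw [isHairy_iff, isHairy_iff, leaves_relabel, Multiset.card_map, Multiset.filterMap_map]
  have h1 : Leaf.end? ∘ f = fun x => x.end?.map σ := funext hf
  have h2 : t.leaves.filterMap (fun x => x.end?.map σ) = (t.leaves.filterMap Leaf.end?).map σ :=
    (Multiset.map_filterMap _ _ _).symm
  have h3 : (Finset.univ : Finset (Fin n × Bool)).val.map σ = Finset.univ.val := by
    have := congrArg Finset.val (Finset.map_univ_equiv σ)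
    rwa [Finset.map_val] at this
  rw [h1, h2, ← h3, (Multiset.map_injective σ.injective).eq_iff, h3]

theorem isHairy_renumber {s : ℕ} (π : Equiv.Perm (Fin n)) (t : Tree (Leaf H n)) :
    IsHairy s (t.relabel (Leaf.renumber π)).leaves ↔ IsHairy s t.leaves :=
  isHairy_relabel (π.prodCongr (Equiv.refl Bool)) (fun x => by cases x <;> rfl) t

theorem isHairy_reverse {s : ℕ} (e : Fin n) (t : Tree (Leaf H n)) :
    IsHairy s (t.relabel (Leaf.reverse e)).leaves ↔ IsHairy s t.leaves := by
  have hi : Function.Involutive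
      fun p : Fin n × Bool => (p.1, if p.1 = e then !p.2 else p.2) := by
    rintro ⟨f, b⟩
    by_cases h : f = e <;> simp [h]
  exact isHairy_relabel (hi.toPerm _) (fun x => by cases x <;> rfl) t

theorem univ_ends (e : Fin (n + 1)) (b : Bool) :
    (Finset.univ : Finset (Fin (n + 1) × Bool)).val = (e, b) ::ₘ (e, !b) ::ₘ
      (Finset.univ : Finset (Fin n × Bool)).val.map fun p => (e.succAbove p.1, p.2) := by
  rw [Multiset.Nodup.ext Finset.univ.nodup]
  · rintro ⟨f, c⟩
    simp only [Finset.mem_val, Finset.mem_univ, true_iff, Multiset.mem_cons, Multiset.mem_map,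
      true_and, Prod.mk.injEq]
    rcases eq_or_ne f e with rfl | hf
    · cases b <;> cases c <;> simp
    · obtain ⟨g, rfl⟩ := Fin.exists_succAbove_eq hf
      exact Or.inr (Or.inr ⟨(g, c), rfl, rfl⟩)
  · rw [Multiset.nodup_cons, Multiset.nodup_cons]
    refine ⟨?_, ?_, Multiset.Nodup.map ?_ Finset.univ.nodup⟩
    · simp [Fin.succAbove_ne]
    · simp [Fin.succAbove_ne]
    · rintro ⟨f, c⟩ ⟨g, d⟩ h
      simpa using h

/-- Each end of `e` occurs exactly once in both trees together, so cutting at the two ends removes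
both; the rest is renumbered without loss. -/
theorem isHairy_join [Zero H] {s : ℕ} {e : Fin (n + 1)} {b : Bool} {t₁ t₂ : Tree (Leaf H (n + 1))}
    {t : Tree (Leaf H n)} (h : IsHairy s (t₁.leaves + t₂.leaves)) (ht : join e b t₁ t₂ = some t) :
    IsHairy s t.leaves := by
  classical
  obtain ⟨hs, h1, h2⟩ := h
  rw [univ_ends e b, Multiset.map_cons, Multiset.map_cons, Multiset.map_map, Multiset.add_cons,
    Multiset.add_cons] at h2
  have hb1 : Leaf.edge e b ∈ t₁.leaves := by
    by_contra hb
    rw [join_eq_none_left hb] at ht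
    cases ht
  have hb2 : Leaf.edge e (!b) ∈ t₂.leaves := by
    by_contra hb
    rw [join_eq_none_right hb] at ht
    cases ht
  have hrest : ∀ c, Leaf.edge e c ∉ hs.map (Leaf.hair : H → Leaf H (n + 1)) +
      (Finset.univ : Finset (Fin n × Bool)).val.map
        ((fun p => Leaf.edge p.1 p.2) ∘ fun p => (e.succAbove p.1, p.2)) := by
    intro c
    simp [Fin.succAbove_ne]
  have hc : ∀ c, (t₁.leaves + t₂.leaves).count (Leaf.edge e c) = 1 := by
    intro c
    rw [h2, Multiset.count_cons, Multiset.count_cons, Multiset.count_eq_zero_of_notMem (hrest c)]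
    cases b <;> cases c <;> simp
  have hc1 : t₁.leaves.count (.edge e b) = 1 := by
    have := hc b
    rw [Multiset.count_add] at this
    have := Multiset.count_pos.2 hb1
    omega
  have hc2 : t₂.leaves.count (.edge e (!b)) = 1 := by
    have := hc (!b)
    rw [Multiset.count_add] at this
    have := Multiset.count_pos.2 hb2
    omega
  obtain ⟨A, hA, hA'⟩ := exists_cut hc1
  obtain ⟨B, hB, hB'⟩ := exists_cut hc2
  have hAB : rootedLeaves A + rootedLeaves B = hs.map (Leaf.hair : H → Leaf H (n + 1)) +
      (Finset.univ : Finset (Fin n × Bool)).val.map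
        ((fun p => Leaf.edge p.1 p.2) ∘ fun p => (e.succAbove p.1, p.2)) := by
    rw [← hA', ← hB', Multiset.cons_add, Multiset.add_cons, Multiset.cons_inj_right,
      Multiset.cons_inj_right] at h2
    exact h2
  rw [join, hA, hB, Option.bind_some, Option.bind_some,
    dropEdge_eq fun c hc => hrest c (hAB ▸ Multiset.mem_add.2 (Or.inl hc)),
    dropEdge_eq fun c hc => hrest c (hAB ▸ Multiset.mem_add.2 (Or.inr hc))] at ht
  obtain rfl : (FreeMagma.map (dropLeaf e) A, FreeMagma.map (dropLeaf e) B) = t :=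
    Option.some_injective _ ht
  refine ⟨hs, h1, ?_⟩
  rw [Tree.leaves, rootedLeaves_map, rootedLeaves_map, ← Multiset.map_add, hAB, Multiset.map_add,
    Multiset.map_map, Multiset.map_map]
  congr 1
  refine Multiset.map_congr rfl fun p _ => ?_
  simp [dropLeaf]

theorem univ_ends_three {e f g : Fin 3} (hef : e ≠ f) (heg : e ≠ g) (hfg : f ≠ g) (a b c : Bool) :
    (Finset.univ : Finset (Fin 3 × Bool)).val =
      {(e, a), (e, !a)} + {(f, b), (f, !b)} + {(g, c), (g, !c)} := by
  revert e f g a b c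
  decide

theorem ends_add {s : ℕ} {t₁ t₂ : Tree (Leaf H n)} (h : IsHairy s (t₁.leaves + t₂.leaves)) :
    t₁.ends + t₂.ends = (Finset.univ : Finset (Fin n × Bool)).val := by
  rw [← (isHairy_iff.1 h).1, Multiset.filterMap_add, Tree.ends_eq, Tree.ends_eq]

end Hairy

/-! ### Vanishing on boundaries: reduction to combs, and the case of `presForm` -/

section Reduction

variable {k : Type u} [Field k] {H : Type v} [AddCommGroup H] [Module k H]
  {W : Type w} [AddCommGroup W] [Module k W]

/-- The sum of two tree forms. -/
def TreeForm.add {X : Type v} (φ ψ : TreeForm X W) : TreeForm X W where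
  toFun A B := φ.toFun A B + ψ.toFun A B
  symm A B := by rw [φ.symm, ψ.symm]
  move A B C := by rw [φ.move, ψ.move]
  antisymm A B C := by
    rw [add_add_add_comm, φ.antisymm, ψ.antisymm, add_zero]
  ihx A B C D := by
    have h := congrArg₂ (· + ·) (φ.ihx A B C D) (ψ.ihx A B C D)
    rw [add_zero] at h
    rw [← h]
    abel

variable [CharZero k] (φ : SymForm k H W)

-- For a fixed tripod the boundary is a sum of values `rootForm`, hence a tree form in the other
-- tree, so `TreeForm.mem_of_three` leaves only combs to check. The next two lemmas use the same
-- argument.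
include k in
theorem SymForm.boundary_three_eq_zero {e f g : Fin 3} (hef : e ≠ f) (heg : e ≠ g) (hfg : f ≠ g)
    (a b c : Bool) (h : ∀ v w : List H, φ.boundary (tripod (.edge e a) (.edge f b) (.edge g c))
        (.of (.edge e !a), comb v (.edge f !b) * comb w (.edge g !c)) = 0)
    {t : Tree (Leaf H 3)} (ht : t.ends = {(e, !a), (f, !b), (g, !c)}) :
    φ.boundary (tripod (.edge e a) (.edge f b) (.edge g c)) t = 0 := by
  let y := (sgn a * (sgn b * sgn c)) • φ.form k ⁅φ.endp 0 false, φ.endp 1 false⁆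
  let F : TreeForm (Leaf H 3) W :=
    ((rootForm k (φ.leaf k ∘ place f b c) (.edge e !a) y).add
      (rootForm k (φ.leaf k ∘ place g c a) (.edge f !b) y)).add
      (rootForm k (φ.leaf k ∘ place e a b) (.edge g !c) y)
  have hF : ∀ {t : Tree (Leaf H 3)}, t.ends = {(e, !a), (f, !b), (g, !c)} →
      φ.boundary (tripod (.edge e a) (.edge f b) (.edge g c)) t = F.toFun t.1 t.2 := by
    intro t ht
    rw [φ.boundary_three hef heg hfg a b c ht, smul_add, smul_add]
    rfl
  rw [hF ht, ← Submodule.mem_bot k]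
  refine TreeForm.mem_of_three k F ⊥ (e, !a) (f, !b) (g, !c) (fun v w => ?_) ht
  rw [Submodule.mem_bot, ← h v w, hF]
  simp only [Tree.ends, rootedEnds_mul, rootedEnds_comb, rootedEnds_edge,
      Multiset.insert_eq_cons, ← Multiset.singleton_add]

include k in
theorem SymForm.boundary_two_eq_zero {e f g : Fin 3} (hef : e ≠ f) (heg : e ≠ g) (hfg : f ≠ g)
    (a b : Bool) (x : H)
    (h : ∀ u v w : List H, φ.boundary (tripod (.edge e a) (.edge f b) (.hair x))
        (.of (.edge e !a) * comb v (.edge g false),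
          comb u (.edge f !b) * comb w (.edge g true)) = 0)
    (h' : ∀ u v w : List H, φ.boundary (tripod (.edge e a) (.edge f b) (.hair x))
        (.of (.edge e !a) * comb w (.edge g true),
          comb u (.edge f !b) * comb v (.edge g false)) = 0)
    {t : Tree (Leaf H 3)} (ht : t.ends = {(e, !a), (f, !b), (g, false), (g, true)}) :
    φ.boundary (tripod (.edge e a) (.edge f b) (.hair x)) t = 0 := by
  let F : TreeForm (Leaf H 3) W :=
    (rootForm k (φ.leaf k ∘ place f b false) (.edge e !a)
      ((sgn a * sgn b) • φ.form k ⁅φ.endp 0 false, φ.hair x⁆)).add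
      (rootForm k (φ.leaf k ∘ place e a false) (.edge f !b)
        ((sgn a * sgn b) • φ.form k ⁅φ.hair x, φ.endp 0 false⁆))
  have hF : ∀ {t : Tree (Leaf H 3)}, t.ends = {(e, !a), (f, !b), (g, false), (g, true)} →
      φ.boundary (tripod (.edge e a) (.edge f b) (.hair x)) t = F.toFun t.1 t.2 := by
    intro t ht
    rw [φ.boundary_two hef heg hfg a b x ht, smul_add]
    rfl
  rw [hF ht, ← Submodule.mem_bot k]
  refine TreeForm.mem_of_four k F ⊥ (e, !a) (f, !b) (g, false) (g, true) (fun u v w => ?_)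
    (fun u v w => ?_) ht
  · rw [Submodule.mem_bot, ← h u v w, hF]
    simp only [Tree.ends, rootedEnds_mul, rootedEnds_comb, rootedEnds_edge,
      Multiset.insert_eq_cons, ← Multiset.singleton_add]
    abel
  · rw [Submodule.mem_bot, ← h' u v w, hF]
    simp only [Tree.ends, rootedEnds_mul, rootedEnds_comb, rootedEnds_edge,
      Multiset.insert_eq_cons, ← Multiset.singleton_add]
    abel

include k in
theorem SymForm.boundary_loop_eq_zero {e f g : Fin 3} (hef : e ≠ f) (heg : e ≠ g) (hfg : f ≠ g)
    (a b : Bool) (h : ∀ v w : List H, φ.boundary (tripod (.edge e a) (.edge f b) (.edge f !b))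
        (.of (.edge e !a), comb v (.edge g false) * comb w (.edge g true)) = 0)
    {t : Tree (Leaf H 3)} (ht : t.ends = {(e, !a), (g, false), (g, true)}) :
    φ.boundary (tripod (.edge e a) (.edge f b) (.edge f !b)) t = 0 := by
  let F : TreeForm (Leaf H 3) W := rootForm k (φ.leaf k ∘ place f b false) (.edge e !a)
    ((sgn a * sgn b) • φ.form k ⁅φ.endp 0 false, φ.endp 0 true⁆)
  have hF : ∀ {t : Tree (Leaf H 3)}, t.ends = {(e, !a), (g, false), (g, true)} →
      φ.boundary (tripod (.edge e a) (.edge f b) (.edge f !b)) t = F.toFun t.1 t.2 := by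
    intro t ht
    rw [φ.boundary_loop hef heg hfg a b ht]
    rfl
  rw [hF ht, ← Submodule.mem_bot k]
  refine TreeForm.mem_of_three k F ⊥ (e, !a) (g, false) (g, true) (fun v w => ?_) ht
  rw [Submodule.mem_bot, ← h v w, hF]
  simp only [Tree.ends, rootedEnds_mul, rootedEnds_comb, rootedEnds_edge,
      Multiset.insert_eq_cons, ← Multiset.singleton_add]

theorem exists_third {e f : Fin 3} (hef : e ≠ f) : ∃ g, e ≠ g ∧ f ≠ g := by
  revert e f
  decide

end Reduction

section PresForm

variable (k : Type u) [Field k] [CharZero k] {H : Type v} [AddCommGroup H] [Module k H]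

theorem presForm_theta_tmul (α β γ δ : TensorAlgebra k H) :
    (presForm k H).theta (α ⊗ₜ β) (γ ⊗ₜ δ) = pres k ((α * rho k H γ) ⊗ₜ (δ * rho k H β)) := by
  rw [presForm_theta, glue_tmul]

/-- Each kind of tripod is matched by one feature of the presentation: three legs by the second
relators, a hair by coinvariance under `ρ ⊗ ρ`, a loop by the vanishing of `1 ⊗ T(H)`. -/
theorem presForm_boundary {s : ℕ} {t₁ t₂ : Tree (Leaf H 3)}
    (ht : IsHairy s (t₁.leaves + t₂.leaves)) (h₁ : IsS₂Tripod t₁) :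
    (presForm k H).boundary t₁ t₂ = 0 := by
  have hends := ends_add ht
  cases h₁ with
  | three e f g a b c hef heg hfg =>
    refine SymForm.boundary_three_eq_zero (presForm k H) hef heg hfg a b c (fun v w => ?_) ?_
    · rw [SymForm.boundary_three_comb _ hef heg hfg,
        (presForm k H).form_three (pres k) (fun v w => ?_) (pres_swap k), pres_tri, smul_zero]
      rw [presForm_theta_tmul, one_mul, rho_one, mul_one]
    · rw [univ_ends_three hef heg hfg a b c] at hends
      -- The ends on the other tree are those that the tripod leaves over.
      refine add_left_cancel (a := ({(e, a), (f, b), (g, c)} : Multiset (Fin 3 × Bool))) ?_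
      refine Eq.trans (Eq.trans ?_ hends) ?_
      · simp [Tree.ends, tripod, Multiset.insert_eq_cons, ← Multiset.singleton_add]
      · simp only [Multiset.insert_eq_cons, ← Multiset.singleton_add]
        abel
  | two e f a b x hef =>
    obtain ⟨g, heg, hfg⟩ := exists_third hef
    refine SymForm.boundary_two_eq_zero (presForm k H) hef heg hfg a b x (fun u v w => ?_)
      (fun u v w => ?_) ?_
    · rw [SymForm.boundary_two_comb _ hef heg hfg, presForm_theta_tmul, presForm_theta_tmul]
      -- `ρ` turns `u h` into `-h ρ(u)` and `v ρ(w)` into `w ρ(v)`: the second theta value is minus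
      -- the first.
      rw [← pres_rho k (word k u * _ * _)]
      simp [rho_mul, rho_rho, rho_ι, TensorProduct.neg_tmul]
    · rw [SymForm.boundary_two_comb' _ hef heg hfg, presForm_theta_tmul, presForm_theta_tmul]
      rw [← pres_rho k (word k u * _ * _)]
      simp [rho_mul, rho_rho, rho_ι, TensorProduct.neg_tmul]
    · rw [univ_ends_three hef heg hfg a b false] at hends
      refine add_left_cancel (a := ({(e, a), (f, b)} : Multiset (Fin 3 × Bool))) ?_
      refine Eq.trans (Eq.trans ?_ hends) ?_
      · simp [Tree.ends, tripod, Multiset.insert_eq_cons, ← Multiset.singleton_add]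
      · simp only [Multiset.insert_eq_cons, ← Multiset.singleton_add, Bool.not_false]
        abel
  | loop e f a b hef =>
    obtain ⟨g, heg, hfg⟩ := exists_third hef
    refine SymForm.boundary_loop_eq_zero (presForm k H) hef heg hfg a b (fun v w => ?_) ?_
    · rw [SymForm.boundary_loop_comb _ hef heg hfg, presForm_theta_tmul, presForm_theta_tmul,
        rho_one, one_mul, pres_one_left, pres_one_left, add_zero, smul_zero]
    · rw [univ_ends_three hef heg hfg a b false] at hends
      refine add_left_cancel (a := ({(e, a), (f, b), (f, !b)} : Multiset (Fin 3 × Bool))) ?_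
      refine Eq.trans (Eq.trans ?_ hends) ?_
      · simp [Tree.ends, tripod, Multiset.insert_eq_cons, ← Multiset.singleton_add]
      · simp only [Multiset.insert_eq_cons, ← Multiset.singleton_add, Bool.not_false]
        abel

end PresForm

/-! ### Symmetric forms as linear maps on chains and on `Ω` -/

section Evaluation

variable {k : Type u} [Field k] {H : Type v} [AddCommGroup H] [Module k H]
  {W : Type w} [AddCommGroup W] [Module k W] (φ : SymForm k H W)

/-- The evaluation of a form on combinations of hairy graphs. -/
noncomputable def SymForm.evalGraph (s : ℕ) : (Graph H 2 s →₀ k) →ₗ[k] W :=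
  Finsupp.linearCombination k fun t : Graph H 2 s => φ.toFun t.1.1 t.1.2

theorem SymForm.evalGraph_gen {s : ℕ} {t : Tree (Leaf H 2)} (ht : IsHairy s t.leaves) :
    φ.evalGraph s (gen k 2 s t) = φ.toFun t.1 t.2 := by
  rw [evalGraph, gen, dif_pos ht]
  exact (Finsupp.linearCombination_single k (1 : k) _).trans (one_smul k _)

omit [AddCommGroup H] [Module k H] in
theorem gen_eq_zero {r s : ℕ} {t : Tree (Leaf H r)} (ht : ¬ IsHairy s t.leaves) :
    gen k r s t = 0 := by
  simp [gen, ht]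

/-- The trees in one relation are all hairy or none is. In the second case every `gen` is zero, in
the first the relation is an axiom of `φ`. -/
theorem SymForm.evalGraph_rel {s : ℕ} {x : Graph H 2 s →₀ k} (hx : ChainRel k 2 s x) :
    φ.evalGraph s x = 0 := by
  have key : ∀ {A B C D : FreeMagma (Leaf H 2)}, rootedLeaves A + rootedLeaves B =
      rootedLeaves C + rootedLeaves D → (IsHairy s (Tree.leaves (A, B)) ↔
        IsHairy s (Tree.leaves (C, D))) := by
    intro A B C D h
    rw [Tree.leaves, Tree.leaves, h]
  cases hx with
  | mark_symm A B =>
    have e1 := key (add_comm (rootedLeaves A) (rootedLeaves B))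
    by_cases h : IsHairy s (Tree.leaves (B, A))
    · rw [map_sub, φ.evalGraph_gen h, φ.evalGraph_gen (e1.2 h), φ.symm, sub_self]
    · rw [gen_eq_zero h, gen_eq_zero (e1.not.2 h), sub_zero, map_zero]
  | mark_move A B C =>
    have e1 : IsHairy s (Tree.leaves (A * B, C)) ↔ IsHairy s (Tree.leaves (A, B * C)) :=
      key (by rw [rootedLeaves_mul, rootedLeaves_mul, add_assoc])
    by_cases h : IsHairy s (Tree.leaves (A, B * C))
    · rw [map_sub, φ.evalGraph_gen h, φ.evalGraph_gen (e1.2 h), φ.move, sub_self]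
    · rw [gen_eq_zero h, gen_eq_zero (e1.not.2 h), sub_zero, map_zero]
  | renumber π t =>
    by_cases h : IsHairy s t.leaves
    · rw [map_sub, φ.evalGraph_gen h, φ.evalGraph_gen ((isHairy_renumber π t).2 h), sub_eq_zero]
      exact φ.renumber π t.1 t.2
    · rw [gen_eq_zero h, gen_eq_zero ((isHairy_renumber π t).not.2 h), sub_zero, map_zero]
  | reverse e t =>
    by_cases h : IsHairy s t.leaves
    · rw [map_add, φ.evalGraph_gen h, φ.evalGraph_gen ((isHairy_reverse e t).2 h),
        add_eq_zero_iff_eq_neg]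
      exact φ.reverse e t.1 t.2
    · rw [gen_eq_zero h, gen_eq_zero ((isHairy_reverse e t).not.2 h), add_zero, map_zero]
  | antisymm A B C =>
    have e1 : IsHairy s (Tree.leaves (A * B, C)) ↔ IsHairy s (Tree.leaves (B * A, C)) :=
      key (by rw [rootedLeaves_mul, rootedLeaves_mul, add_comm (rootedLeaves A)])
    by_cases h : IsHairy s (Tree.leaves (B * A, C))
    · rw [map_add, φ.evalGraph_gen h, φ.evalGraph_gen (e1.2 h)]
      exact φ.antisymm A B C
    · rw [gen_eq_zero h, gen_eq_zero (e1.not.2 h), add_zero, map_zero]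
  | ihx A B C D =>
    have e1 : IsHairy s (Tree.leaves (A * B * C, D)) ↔ IsHairy s (Tree.leaves (B * C * A, D)) :=
      key (by simp only [rootedLeaves_mul]; abel)
    have e2 : IsHairy s (Tree.leaves (A * B * C, D)) ↔ IsHairy s (Tree.leaves (C * A * B, D)) :=
      key (by simp only [rootedLeaves_mul]; abel)
    by_cases h : IsHairy s (Tree.leaves (A * B * C, D))
    · rw [map_add, map_add, φ.evalGraph_gen h, φ.evalGraph_gen (e1.1 h),
        φ.evalGraph_gen (e2.1 h)]
      exact φ.ihx A B C D
    · rw [gen_eq_zero h, gen_eq_zero (e1.not.1 h), gen_eq_zero (e2.not.1 h), add_zero, add_zero,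
        map_zero]
  | hair_add x x' B =>
    have e1 : ∀ y z : H, IsHairy s (Tree.leaves (.of (.hair y), B)) ↔
        IsHairy s (Tree.leaves (.of (.hair z), B)) := fun y z =>
      isHairy_congr (by
        rw [← Tree.ends_eq, ← Tree.ends_eq, Tree.ends, Tree.ends, rootedEnds_hair,
          rootedEnds_hair]) (by simp [Tree.leaves])
    by_cases h : IsHairy s (Tree.leaves (.of (.hair x), B))
    · rw [map_sub, map_sub, φ.evalGraph_gen h, φ.evalGraph_gen ((e1 _ _).1 h),
        φ.evalGraph_gen ((e1 _ _).1 h), φ.hair_add]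
      abel
    · rw [gen_eq_zero h, gen_eq_zero ((e1 _ _).not.1 h), gen_eq_zero ((e1 _ _).not.1 h), sub_zero,
        sub_zero, map_zero]
  | hair_smul c x B =>
    have e1 : ∀ y z : H, IsHairy s (Tree.leaves (.of (.hair y), B)) ↔
        IsHairy s (Tree.leaves (.of (.hair z), B)) := fun y z =>
      isHairy_congr (by
        rw [← Tree.ends_eq, ← Tree.ends_eq, Tree.ends, Tree.ends, rootedEnds_hair,
          rootedEnds_hair]) (by simp [Tree.leaves])
    by_cases h : IsHairy s (Tree.leaves (.of (.hair x), B))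
    · rw [map_sub, map_smul, φ.evalGraph_gen h, φ.evalGraph_gen ((e1 _ _).1 h), φ.hair_smul,
        sub_self]
    · rw [gen_eq_zero h, gen_eq_zero ((e1 _ _).not.1 h), smul_zero, sub_zero, map_zero]

/-- The evaluation of a form on chains. -/
noncomputable def SymForm.evalChain (s : ℕ) : Chains k H 2 s →ₗ[k] W :=
  Submodule.liftQ _ (φ.evalGraph s) (Submodule.span_le.2 fun _ hx => φ.evalGraph_rel hx)

theorem SymForm.evalChain_chain {s : ℕ} {t : Tree (Leaf H 2)} (ht : IsHairy s t.leaves) :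
    φ.evalChain s (chain k 2 s t) = φ.toFun t.1 t.2 :=
  φ.evalGraph_gen ht

/-- A linear map on chains whose values on hairy graphs are given by a form sends boundaries to
boundaries. -/
theorem TreeForm.boundary_eq {r s : ℕ} {ψ : TreeForm (Leaf H r) W} {F : Chains k H r s →ₗ[k] W}
    (hF : ∀ t : Tree (Leaf H r), IsHairy s t.leaves → F (chain k r s t) = ψ.toFun t.1 t.2)
    {t₁ t₂ : Tree (Leaf H (r + 1))} (ht : IsHairy s (t₁.leaves + t₂.leaves)) :
    F (HairyGraph.boundary k r s t₁ t₂) = ψ.boundary t₁ t₂ := by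
  have h : ∀ e b, F ((join e b t₁ t₂).elim 0 (chain k r s)) =
      (join e b t₁ t₂).elim 0 (fun t => ψ.toFun t.1 t.2) := by
    intro e b
    cases hj : join e b t₁ t₂ with
    | none => exact map_zero F
    | some t => exact hF t (isHairy_join ht hj)
  rw [HairyGraph.boundary, map_sum]
  refine Finset.sum_congr rfl fun e _ => ?_
  rw [map_sub, h, h]

/-- The evaluation of a form that vanishes on boundaries. -/
noncomputable def SymForm.evalOmega (s : ℕ)
    (hφ : ∀ t₁ t₂ : Tree (Leaf H 3), IsHairy s (t₁.leaves + t₂.leaves) → IsS₂Tripod t₁ →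
      φ.boundary t₁ t₂ = 0) : Omega k H s 2 →ₗ[k] W :=
  Submodule.liftQ (boundaryS₂ k H 2 s) (φ.evalChain s) (Submodule.span_le.2 (by
    rintro _ ⟨t₁, t₂, h1, h2, rfl⟩
    exact (TreeForm.boundary_eq (fun t ht => φ.evalChain_chain ht) h1).trans (hφ t₁ t₂ h1 h2)))

theorem SymForm.evalOmega_toOmega {s : ℕ} {hφ} {t : Tree (Leaf H 2)} (ht : IsHairy s t.leaves) :
    φ.evalOmega s hφ (toOmega k s 2 (chain k 2 s t)) = φ.toFun t.1 t.2 :=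
  φ.evalChain_chain ht

end Evaluation

/-! ### Closed forms factor through the presentation -/

section Relations

variable {k : Type u} [Field k] [CharZero k] {H : Type v} [AddCommGroup H] [Module k H]
  {W : Type w} [AddCommGroup W] [Module k W]

/-- A form vanishes on the boundaries of hairy graphs one of whose trees is a tripod. -/
def SymForm.Closed (φ : SymForm k H W) : Prop :=
  ∀ (s : ℕ) (t₁ t₂ : Tree (Leaf H 3)), IsHairy s (t₁.leaves + t₂.leaves) → IsS₂Tripod t₁ →
    φ.boundary t₁ t₂ = 0

omit [AddCommGroup H] [Module k H] in
theorem exists_isHairy {n : ℕ} {m : Multiset (Leaf H n)}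
    (h : m.filterMap Leaf.end? = (Finset.univ : Finset (Fin n × Bool)).val) :
    ∃ s, IsHairy s m := by
  obtain ⟨hs, hm⟩ := exists_hairs m
  rw [h] at hm
  exact ⟨hs.card, hs, rfl, hm⟩

namespace SymForm

variable {φ : SymForm k H W} (hφ : φ.Closed)

include hφ

omit [CharZero k] in
theorem Closed.boundary_eq_zero {t₁ t₂ : Tree (Leaf H 3)}
    (h : t₁.ends + t₂.ends = (Finset.univ : Finset (Fin 3 × Bool)).val) (h₁ : IsS₂Tripod t₁) :
    φ.boundary t₁ t₂ = 0 := by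
  obtain ⟨s, hs⟩ := exists_isHairy (m := t₁.leaves + t₂.leaves)
    (by rw [Multiset.filterMap_add, ← Tree.ends_eq, ← Tree.ends_eq, h])
  exact hφ s t₁ t₂ hs h₁

theorem Closed.theta_two (h : H) (u v w : TensorAlgebra k H) :
    φ.theta (TensorAlgebra.ι k h ⊗ₜ v) (u ⊗ₜ w) =
      -φ.theta (1 ⊗ₜ v) ((u * TensorAlgebra.ι k h) ⊗ₜ w) := by
  induction u using word_induction with
  | add x y hx hy =>
    simp only [add_mul, TensorProduct.add_tmul, map_add, hx, hy, neg_add]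
  | smul c x hx =>
    simp only [smul_mul_assoc, ← TensorProduct.smul_tmul', map_smul, hx, smul_neg]
  | wd u =>
  induction v using word_induction with
  | add x y hx hy =>
    simp only [TensorProduct.tmul_add, map_add, LinearMap.add_apply, hx, hy, neg_add]
  | smul c x hx =>
    simp only [TensorProduct.tmul_smul, map_smul, LinearMap.smul_apply, hx, smul_neg]
  | wd v =>
  induction w using word_induction with
  | add x y hx hy => simp only [TensorProduct.tmul_add, map_add, hx, hy, neg_add]
  | smul c x hx => simp only [TensorProduct.tmul_smul, map_smul, hx, smul_neg]
  | wd w =>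
  have h1 := φ.boundary_two_comb (e := 0) (f := 1) (g := 2) (by decide) (by decide) (by decide)
    false false h u v w
  rw [hφ.boundary_eq_zero (by
    simp only [tripod, Tree.ends, rootedEnds_mul, rootedEnds_comb, rootedEnds_edge, rootedEnds_hair]
    decide) (.two 0 1 false false h (by decide)), show -(sgn false * sgn false) = -1 from rfl,
    neg_one_smul, eq_comm, neg_eq_zero, φ.theta_flip ((_ * _) ⊗ₜ _)] at h1
  exact eq_neg_of_add_eq_zero_left h1

/-- A hair next to the tail of an edge passes to the head with a minus sign. `Closed.theta_two` is
the case without further hairs at that tail; invariance at the middle edge adds them one at a time.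
-/
theorem Closed.theta_slide (h : H) (α u v w : TensorAlgebra k H) :
    φ.theta ((α * TensorAlgebra.ι k h) ⊗ₜ v) (u ⊗ₜ w) =
      -φ.theta (α ⊗ₜ v) ((u * TensorAlgebra.ι k h) ⊗ₜ w) := by
  induction α using left_induction generalizing u v w with
  | add x y hx hy =>
    simp only [add_mul, TensorProduct.add_tmul, map_add, LinearMap.add_apply, hx, hy, neg_add]
  | smul c x hx =>
    simp only [smul_mul_assoc, ← TensorProduct.smul_tmul', map_smul, LinearMap.smul_apply, hx,
      smul_neg]
  | one => rw [one_mul, hφ.theta_two]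
  | mul g α ih =>
    have h1 := φ.pairing_invariant (0, false) (1, false) (0, true) (1, true) g
      ((α * TensorAlgebra.ι k h) ⊗ₜ v) (u ⊗ₜ w)
    have h2 := φ.pairing_invariant (0, false) (1, false) (0, true) (1, true) g
      (α ⊗ₜ v) ((u * TensorAlgebra.ι k h) ⊗ₜ w)
    simp only [add_mul, Algebra.TensorProduct.tmul_mul_tmul, one_mul, map_add,
      LinearMap.add_apply, ih, ← mul_assoc] at h1 h2 ⊢
    linear_combination (norm := abel) h1 + h2

theorem Closed.theta_rho (α u v w : TensorAlgebra k H) :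
    φ.theta (α ⊗ₜ v) (rho k H u ⊗ₜ w) = φ.theta ((α * u) ⊗ₜ v) (1 ⊗ₜ w) := by
  induction u using left_induction generalizing α with
  | add x y hx hy =>
    simp only [mul_add, TensorProduct.add_tmul, map_add, LinearMap.add_apply, hx, hy]
  | smul c x hx =>
    simp only [mul_smul_comm, ← TensorProduct.smul_tmul', map_smul, LinearMap.smul_apply, hx]
  | one => rw [rho_one, mul_one]
  | mul h x ih =>
    rw [rho_mul, rho_ι, mul_neg, TensorProduct.neg_tmul, map_neg, ← hφ.theta_slide, ih, mul_assoc]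

/-- The value of a theta graph with all hairs at the tails. -/
theorem Closed.theta_eq (α β γ δ : TensorAlgebra k H) :
    φ.theta (α ⊗ₜ β) (γ ⊗ₜ δ) = φ.theta ((α * rho k H γ) ⊗ₜ (β * rho k H δ)) (1 ⊗ₜ 1) := by
  have h1 := hφ.theta_rho α (rho k H γ) β δ
  have h2 := hφ.theta_rho β (rho k H δ) (α * rho k H γ) 1
  rw [rho_rho] at h1 h2
  rw [h1, ← φ.theta_swap, h2, φ.theta_swap]

/-- By `theta_flip` the two terms of a loop boundary are equal, so twice the value is zero. This is
why only `T⁺(H)` occurs in the presentation. -/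
theorem Closed.theta_one (v w : TensorAlgebra k H) : φ.theta (1 ⊗ₜ v) (1 ⊗ₜ w) = 0 := by
  induction v using word_induction with
  | add x y hx hy =>
    simp only [TensorProduct.tmul_add, map_add, LinearMap.add_apply, hx, hy, add_zero]
  | smul c x hx =>
    simp only [TensorProduct.tmul_smul, map_smul, LinearMap.smul_apply, hx, smul_zero]
  | wd v =>
  induction w using word_induction with
  | add x y hx hy => simp only [TensorProduct.tmul_add, map_add, hx, hy, add_zero]
  | smul c x hx => simp only [TensorProduct.tmul_smul, map_smul, hx, smul_zero]
  | wd w =>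
  have h1 := φ.boundary_loop_comb (e := 0) (f := 1) (g := 2) (by decide) (by decide) (by decide)
    false false v w
  rw [hφ.boundary_eq_zero (by
    simp only [tripod, Tree.ends, rootedEnds_mul, rootedEnds_comb, rootedEnds_edge]
    decide) (.loop 0 1 false false (by decide)), show sgn false * sgn false = 1 from rfl,
    one_smul, φ.theta_flip (1 ⊗ₜ word k w), ← two_smul k, eq_comm,
    smul_eq_zero_iff_right two_ne_zero] at h1
  exact h1

omit hφ

variable (φ) in
/-- The value of the theta graph with hairs near the tail of the first edge and the head of the
second one. -/
noncomputable def thetaValue : TensorAlgebra k H ⊗[k] TensorAlgebra k H →ₗ[k] W :=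
  TensorProduct.lift (φ.theta.compl₁₂ ((TensorProduct.mk k _ _).flip 1) (TensorProduct.mk k _ _ 1))

theorem thetaValue_tmul (v w : TensorAlgebra k H) :
    φ.thetaValue (v ⊗ₜ w) = φ.theta (v ⊗ₜ 1) (1 ⊗ₜ w) := rfl

include hφ

theorem Closed.theta_eq_thetaValue (α β γ δ : TensorAlgebra k H) :
    φ.theta (α ⊗ₜ β) (γ ⊗ₜ δ) = φ.thetaValue ((α * rho k H γ) ⊗ₜ (δ * rho k H β)) := by
  rw [thetaValue_tmul, hφ.theta_eq α, hφ.theta_eq (α * rho k H γ) 1 1]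
  simp [rho_mul, rho_rho, rho_one]

/-- With all hairs slid to the tails, this is the exchange of the two edges; `Closed.thetaValue_rho`
is likewise the exchange of tails and heads. -/
theorem Closed.thetaValue_swap (v w : TensorAlgebra k H) :
    φ.thetaValue (rho k H w ⊗ₜ rho k H v) = φ.thetaValue (v ⊗ₜ w) := by
  rw [thetaValue_tmul, thetaValue_tmul, hφ.theta_eq, hφ.theta_eq v, rho_rho, rho_one, mul_one,
    mul_one, one_mul, one_mul, φ.theta_swap]

theorem Closed.thetaValue_rho (v w : TensorAlgebra k H) :
    φ.thetaValue (rho k H v ⊗ₜ rho k H w) = φ.thetaValue (v ⊗ₜ w) := by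
  rw [thetaValue_tmul, thetaValue_tmul, φ.theta_flip, hφ.theta_eq, hφ.theta_eq v, rho_rho, rho_one,
    mul_one, mul_one, one_mul, one_mul]

/-- A hair on the middle edge can be pushed off through either vertex; the two results differ by the
commutator relator. -/
theorem Closed.thetaValue_comm (h : H) (v w : TensorAlgebra k H) :
    φ.thetaValue (commRelator k H h v w) = 0 := by
  have h1 := φ.pairing_invariant (0, false) (1, false) (0, true) (1, true) h (v ⊗ₜ 1) (1 ⊗ₜ w)
  simp only [add_mul, Algebra.TensorProduct.tmul_mul_tmul, one_mul, mul_one, map_add,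
    LinearMap.add_apply, hφ.theta_eq_thetaValue, rho_one, rho_ι, mul_neg, TensorProduct.neg_tmul,
    TensorProduct.tmul_neg, map_neg] at h1
  simp only [commRelator, add_mul, mul_add, Algebra.TensorProduct.tmul_mul_tmul, one_mul, mul_one,
    map_add, map_neg]
  linear_combination (norm := abel) -h1

theorem Closed.thetaValue_tri (v w : TensorAlgebra k H) :
    φ.thetaValue (triRelator k H v w) = 0 := by
  have hG : ∀ v w, φ.theta (1 ⊗ₜ 1) (v ⊗ₜ w) = φ.thetaValue (rho k H v ⊗ₜ w) := by
    intro v w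
    rw [hφ.theta_eq_thetaValue, one_mul, rho_one, mul_one]
  -- The boundary yields relators with `ρ(v)` in place of `v`; as `ρ` is an involution these are all
  -- of them.
  have key : ∀ v w, φ.thetaValue (triRelator k H (rho k H v) w) = 0 := by
    intro v w
    rw [← φ.form_three _ hG hφ.thetaValue_swap]
    induction v using word_induction with
    | add x y hx hy =>
      have h1 := congrArg₂ (· + ·) hx hy
      simp only [add_zero] at h1
      simp only [TensorProduct.add_tmul, map_add, LinearMap.add_apply, lie_add]
      rw [← h1]
      abel
    | smul c x hx =>
      have h1 := congrArg (c • ·) hx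
      simp only [smul_zero, smul_add] at h1
      simp only [← TensorProduct.smul_tmul', map_smul, LinearMap.smul_apply, lie_smul]
      exact h1
    | wd v =>
    induction w using word_induction with
    | add x y hx hy =>
      have h1 := congrArg₂ (· + ·) hx hy
      simp only [add_zero] at h1
      simp only [TensorProduct.tmul_add, map_add, LinearMap.add_apply, add_lie]
      rw [← h1]
      abel
    | smul c x hx =>
      have h1 := congrArg (c • ·) hx
      simp only [smul_zero, smul_add] at h1
      simp only [TensorProduct.tmul_smul, map_smul, LinearMap.smul_apply, smul_lie]
      exact h1
    | wd w =>
    have h1 := φ.boundary_three_comb (e := 0) (f := 1) (g := 2) (by decide) (by decide) (by decide)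
      false false false v w
    rw [hφ.boundary_eq_zero (by
      simp only [tripod, Tree.ends, rootedEnds_mul, rootedEnds_comb, rootedEnds_edge]
      decide) (.three 0 1 2 false false false (by decide) (by decide) (by decide)),
      show sgn false * (sgn false * sgn false) = 1 from rfl, one_smul] at h1
    exact h1.symm
  rw [← rho_rho k v]
  exact key _ _

/-- A form that vanishes on boundaries is given on theta graphs by a linear map on the
presentation. -/
theorem Closed.exists_presentation : ∃ Ψ : Presentation k H →ₗ[k] W,
    ∀ x, Ψ (pres k x) = φ.thetaValue x := by
  refine exists_lift k φ.thetaValue ?_ ?_ hφ.thetaValue_rho hφ.thetaValue_swap hφ.thetaValue_comm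
    hφ.thetaValue_tri
  · exact fun w => hφ.theta_one 1 w
  · intro v
    rw [thetaValue_tmul, ← φ.theta_swap]
    exact hφ.theta_one v 1

/-- `TreeForm.mem_of_four` leaves two kinds of H-shaped trees, theta graphs and crossed trees. With
the chosen order of the ends, the grouping that pairs the two ends of one edge is the one avoided.
-/
theorem Closed.mem_range {Ψ : Presentation k H →ₗ[k] W}
    (hΨ : ∀ x, Ψ (pres k x) = φ.thetaValue x) {s : ℕ} {t : Tree (Leaf H 2)}
    (ht : IsHairy s t.leaves) : φ.toFun t.1 t.2 ∈ LinearMap.range Ψ := by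
  have h1 : ∀ p q : TensorAlgebra k H, ∀ r l : TensorAlgebra k H,
      φ.theta (p ⊗ₜ q) (r ⊗ₜ l) ∈ LinearMap.range Ψ := by
    intro p q r l
    rw [hφ.theta_eq_thetaValue, ← hΨ]
    exact LinearMap.mem_range_self _ _
  refine TreeForm.mem_of_four k φ.toTreeForm (LinearMap.range Ψ) (0, false) (0, true) (1, false)
    (1, true) (fun u v w => ?_) (fun u v w => ?_) ?_
  · have := φ.toFun_comb (0, false) (1, false) (0, true) (1, true) [] v u w
    rw [comb_nil] at this
    rw [this]
    exact h1 _ _ _ _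
  · have := φ.toFun_comb (0, false) (1, true) (0, true) (1, false) [] w u v
    rw [comb_nil] at this
    rw [this, φ.pairing_reverse_one]
    exact neg_mem (h1 _ _ _ _)
  · have h2 := (isHairy_iff.1 ht).1
    rw [← Tree.ends_eq] at h2
    exact h2.trans (by decide)

end SymForm
end Relations

/-! ### The universal closed form and the isomorphism -/

section OmegaForm

variable (k : Type u) [Field k] {H : Type v} [AddCommGroup H] [Module k H]

/-- The class of a combination of hairy graphs in the direct sum of the spaces `Ω`. -/
noncomputable def omegaClass (s : ℕ) :
    (Graph H 2 s →₀ k) →ₗ[k] ⨁ s : ℕ, Omega k H s 2 :=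
  DirectSum.lof k ℕ (fun s : ℕ => Omega k H s 2) s ∘ₗ toOmega k s 2 ∘ₗ Submodule.mkQ _

variable {k}

theorem omegaClass_rel {s : ℕ} {x : Graph H 2 s →₀ k} (hx : ChainRel k 2 s x) :
    omegaClass k s x = 0 := by
  have : Submodule.mkQ (Submodule.span k {x | ChainRel k 2 s x}) x = 0 :=
    (Submodule.Quotient.mk_eq_zero _).2 (Submodule.subset_span hx)
  rw [omegaClass, LinearMap.comp_apply, LinearMap.comp_apply, this, map_zero, map_zero]

variable (k H)

/-- The classes of hairy graphs, as a form on trees. -/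
noncomputable def omegaForm : SymForm k H (⨁ s : ℕ, Omega k H s 2) where
  -- Two external edges have four ends, so the rest of the leaves are the hairs. If the tree is not
  -- a hairy graph, in particular if the subtraction truncates, `gen` is zero.
  toFun A B := omegaClass k ((Tree.leaves (A, B)).card - 4) (gen k 2 _ (A, B))
  symm A B := by
    have h : Tree.leaves (B, A) = Tree.leaves (A, B) := add_comm _ _
    rw [h, ← sub_eq_zero, ← map_sub]
    exact omegaClass_rel (.mark_symm A B)
  move A B C := by
    have h : Tree.leaves (A, B * C) = Tree.leaves (A * B, C) := by
      simp only [Tree.leaves, rootedLeaves_mul, add_assoc]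
    rw [h, ← sub_eq_zero, ← map_sub]
    exact omegaClass_rel (.mark_move A B C)
  antisymm A B C := by
    have h : Tree.leaves (B * A, C) = Tree.leaves (A * B, C) := by
      simp only [Tree.leaves, rootedLeaves_mul]
      abel
    rw [h, ← map_add]
    exact omegaClass_rel (.antisymm A B C)
  ihx A B C D := by
    have h : Tree.leaves (B * C * A, D) = Tree.leaves (A * B * C, D) := by
      simp only [Tree.leaves, rootedLeaves_mul]
      abel
    have h' : Tree.leaves (C * A * B, D) = Tree.leaves (A * B * C, D) := by
      simp only [Tree.leaves, rootedLeaves_mul]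
      abel
    rw [h, h', ← map_add, ← map_add]
    exact omegaClass_rel (.ihx A B C D)
  hair_add x x' B := by
    have h : ∀ y z : H, (Tree.leaves (.of (.hair y), B)).card =
        (Tree.leaves (.of (.hair z : Leaf H 2), B)).card := fun y z => by simp [Tree.leaves]
    rw [h (x + x') x, h x' x, ← sub_eq_zero, ← sub_sub, ← map_sub, ← map_sub]
    exact omegaClass_rel (.hair_add x x' B)
  hair_smul c x B := by
    have h : (Tree.leaves (.of (.hair (c • x)), B)).card =
        (Tree.leaves (.of (.hair x : Leaf H 2), B)).card := by simp [Tree.leaves]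
    rw [h, ← sub_eq_zero, ← map_smul, ← map_sub]
    exact omegaClass_rel (.hair_smul c x B)
  renumber π A B := by
    have h : (Tree.leaves (FreeMagma.map (Leaf.renumber π) A,
        FreeMagma.map (Leaf.renumber π) B)).card = (Tree.leaves (A, B)).card := by
      rw [show (FreeMagma.map (Leaf.renumber π) A, FreeMagma.map (Leaf.renumber π) B) =
        Tree.relabel (Leaf.renumber π) (A, B) from rfl, leaves_relabel, Multiset.card_map]
    rw [h, ← sub_eq_zero, ← map_sub]
    exact omegaClass_rel (.renumber π (A, B))
  reverse e A B := by
    have h : (Tree.leaves (FreeMagma.map (Leaf.reverse e) A,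
        FreeMagma.map (Leaf.reverse e) B)).card = (Tree.leaves (A, B)).card := by
      rw [show (FreeMagma.map (Leaf.reverse e) A, FreeMagma.map (Leaf.reverse e) B) =
        Tree.relabel (Leaf.reverse e) (A, B) from rfl, leaves_relabel, Multiset.card_map]
    rw [h, eq_neg_iff_add_eq_zero, ← map_add]
    exact omegaClass_rel (.reverse e (A, B))

variable {H}

theorem omegaForm_apply {s : ℕ} {t : Tree (Leaf H 2)} (ht : IsHairy s t.leaves) :
    (omegaForm k H).toFun t.1 t.2 =
      DirectSum.lof k ℕ (fun s : ℕ => Omega k H s 2) s (toOmega k s 2 (chain k 2 s t)) := by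
  have h : t.leaves.card - 4 = s := by
    rw [(isHairy_iff.1 ht).2]
    omega
  subst h
  rfl

variable (H)

theorem omegaForm_closed [CharZero k] : (omegaForm k H).Closed := by
  intro s t₁ t₂ ht h₁
  refine (TreeForm.boundary_eq (F := DirectSum.lof k ℕ (fun s : ℕ => Omega k H s 2) s ∘ₗ
    toOmega k s 2) (fun t ht => (omegaForm_apply k ht).symm) ht).symm.trans ?_
  have : toOmega k s 2 (HairyGraph.boundary k 2 s t₁ t₂) = 0 :=
    (Submodule.Quotient.mk_eq_zero _).2 (Submodule.subset_span ⟨t₁, t₂, ht, h₁, rfl⟩)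
  rw [LinearMap.comp_apply, this, map_zero]

variable {k H}

theorem omega_induction {p : (⨁ s : ℕ, Omega k H s 2) → Prop} (add : ∀ x y, p x → p y → p (x + y))
    (smul : ∀ (c : k) x, p x → p (c • x)) (zero : p 0)
    (tree : ∀ (s : ℕ) (t : Tree (Leaf H 2)), IsHairy s t.leaves →
      p ((omegaForm k H).toFun t.1 t.2)) (x) : p x := by
  induction x using DirectSum.induction_on with
  | zero => exact zero
  | add x y hx hy => exact add x y hx hy
  | of s x =>
    obtain ⟨x, rfl⟩ := Submodule.mkQ_surjective (boundaryS₂ k H 2 s) x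
    obtain ⟨x, rfl⟩ := Submodule.mkQ_surjective _ x
    change p (omegaClass k s x)
    induction x using Finsupp.induction_linear with
    | zero => rwa [map_zero]
    | add x y hx hy =>
      rw [map_add]
      exact add _ _ hx hy
    | single t c =>
      have h1 : Finsupp.single t c = c • gen k 2 s t.1 := by
        rw [gen, dif_pos t.2]
        exact (Finsupp.smul_single_one t c).symm
      rw [h1, map_smul]
      refine smul _ _ ?_
      have := tree s t.1 t.2
      rwa [omegaForm_apply k t.2] at this

omit [AddCommGroup H] in
theorem isHairy_thetaTree (v w : List H) :
    IsHairy (v.length + w.length) (thetaTree v w).leaves := by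
  have hc : ∀ (v : List H) (x : Leaf H 2), (rootedLeaves (comb v x)).card = v.length + 1 := by
    intro v x
    induction v with
    | nil => rfl
    | cons h v ih =>
      rw [comb_cons, rootedLeaves_mul, Multiset.card_add, ih, rootedLeaves_of,
        Multiset.card_singleton, List.length_cons, add_comm]
  rw [isHairy_iff, ← Tree.ends_eq]
  constructor
  · simp only [Tree.ends, thetaTree, rootedEnds_mul, rootedEnds_comb, rootedEnds_edge]
    decide
  · simp only [Tree.leaves, thetaTree, rootedLeaves_mul, Multiset.card_add, hc, rootedLeaves_of,
      Multiset.card_singleton]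
    omega

theorem SymForm.toFun_thetaTree [CharZero k] {W : Type w} [AddCommGroup W] [Module k W]
    (φ : SymForm k H W) (v w : List H) : φ.toFun (thetaTree v w).1 (thetaTree v w).2 =
      φ.theta (word k v ⊗ₜ 1) (1 ⊗ₜ word k w) :=
  φ.toFun_comb (0, false) (1, false) (0, true) (1, true) v [] [] w

theorem omegaForm_theta (v w : List H) :
    (omegaForm k H).toFun (thetaTree v w).1 (thetaTree v w).2 =
      DirectSum.lof k ℕ (fun s : ℕ => Omega k H s 2) (v.length + w.length) (theta k v w) :=
  omegaForm_apply k (isHairy_thetaTree v w)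

theorem pres_surjective : Function.Surjective (pres k : _ →ₗ[k] Presentation k H) := by
  intro x
  obtain ⟨x, rfl⟩ := Submodule.mkQ_surjective _ x
  obtain ⟨x, rfl⟩ := Submodule.mkQ_surjective _ x
  refine ⟨TensorProduct.map (inclPlus k H) (inclPlus k H) x, ?_⟩
  have h1 : projPlus k H ∘ₗ inclPlus k H = LinearMap.id := by
    refine LinearMap.ext fun x => Subtype.ext ?_
    have hx : (TensorAlgebra.algebraMapInv : TensorAlgebra k H →ₐ[k] k) x.1 = 0 := x.2
    change x.1 - algebraMap k _ (TensorAlgebra.algebraMapInv x.1) = x.1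
    rw [hx, map_zero, sub_zero]
  have h2 : projPlus₂ k H (TensorProduct.map (inclPlus k H) (inclPlus k H) x) = x := by
    rw [projPlus₂, ← LinearMap.comp_apply, ← TensorProduct.map_comp, h1, TensorProduct.map_id]
    rfl
  change Submodule.Quotient.mk (Submodule.Quotient.mk (projPlus₂ k H _)) = _
  rw [h2]
  rfl

variable [CharZero k]

variable (k H) in
/-- The map from the spaces `Ω` to the presentation. -/
noncomputable def toPresentation : (⨁ s : ℕ, Omega k H s 2) →ₗ[k] Presentation k H :=
  DirectSum.toModule k ℕ _ fun s =>
    (presForm k H).evalOmega s fun _ _ ht h₁ => presForm_boundary k ht h₁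

theorem toPresentation_omegaForm {s : ℕ} {t : Tree (Leaf H 2)} (ht : IsHairy s t.leaves) :
    toPresentation k H ((omegaForm k H).toFun t.1 t.2) = (presForm k H).toFun t.1 t.2 := by
  rw [omegaForm_apply k ht, toPresentation, DirectSum.toModule_lof]
  exact SymForm.evalOmega_toOmega _ ht

theorem toPresentation_theta (v w : List H) :
    toPresentation k H ((omegaForm k H).toFun (thetaTree v w).1 (thetaTree v w).2) =
      wordClass k v w := by
  rw [toPresentation_omegaForm (isHairy_thetaTree v w), SymForm.toFun_thetaTree,
    presForm_theta_tmul, rho_one, mul_one, mul_one, pres_word]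

theorem toPresentation_thetaValue (x : TensorAlgebra k H ⊗[k] TensorAlgebra k H) :
    toPresentation k H ((omegaForm k H).thetaValue x) = pres k x := by
  rw [← LinearMap.comp_apply]
  refine LinearMap.congr_fun (tensor_word_ext fun v w => ?_) x
  rw [LinearMap.comp_apply, SymForm.thetaValue_tmul, ← SymForm.toFun_thetaTree,
    toPresentation_theta, pres_word]

/-- The map `Ψ` given by the universal form is a right inverse of `toPresentation`, as comparison on
theta graphs shows, and it is onto because its range contains the classes of all hairy graphs. -/
theorem toPresentation_bijective : Function.Bijective (toPresentation k H) := by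
  have hφ := omegaForm_closed k H
  obtain ⟨Ψ, hΨ⟩ := hφ.exists_presentation
  have h1 : ∀ y, toPresentation k H (Ψ y) = y := by
    intro y
    obtain ⟨x, rfl⟩ := pres_surjective y
    rw [hΨ, toPresentation_thetaValue]
  have h2 : ∀ x, x ∈ LinearMap.range Ψ := by
    intro x
    induction x using omega_induction with
    | add x y hx hy => exact add_mem hx hy
    | smul c x hx => exact Submodule.smul_mem _ c hx
    | zero => exact zero_mem _
    | tree s t ht => exact hφ.mem_range hΨ ht
  refine Function.bijective_iff_has_inverse.2 ⟨Ψ, fun x => ?_, h1⟩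
  obtain ⟨y, rfl⟩ := h2 x
  rw [h1]

end OmegaForm
end HairyGraph

theorem mainTheorem6 (k : Type*) [Field k] [CharZero k]
    (H : Type*) [AddCommGroup H] [Module k H] :
    ∃ Φ : (⨁ s : ℕ, HairyGraph.Omega k H s 2) ≃ₗ[k] HairyGraph.Presentation k H,
      ∀ v w : List H,
        Φ (DirectSum.lof k ℕ (fun s : ℕ => HairyGraph.Omega k H s 2) (v.length + w.length)
          (HairyGraph.theta k v w)) = HairyGraph.wordClass k v w := by
  refine ⟨LinearEquiv.ofBijective _ HairyGraph.toPresentation_bijective, fun v w => ?_⟩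
  rw [← HairyGraph.omegaForm_theta]
  exact HairyGraph.toPresentation_theta v w
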